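/- Let $g\ge 2$ and let $F_g=\mathbb{H}^2/\Gamma_g$ be the closed orientable hyperbolic surface of genus $g$, where $\Gamma_g$ is the group of Möbius transformations generated by the hyperbolic translations $\delta_j$ given by the matrices $M_g^{-j}Q_gM_g^{j}$, $1\le j\le 2g$, with $$M_g=\begin{pmatrix}\cos\frac{(2g-1)\pi}{4g}&\sin\frac{(2g-1)\pi}{4g}\\-\sin\frac{(2g-1)\pi}{4g}&\cos\frac{(2g-1)\pi}{4g}\end{pmatrix},\qquad Q_g=\begin{pmatrix}\lambda_g&0\\0&\lambda_g^{-1}\end{pmatrix},\qquad \lambda_g=\frac{\cos\frac{\pi}{4g}+\sqrt{\cos\frac{\pi}{2g}}}{\sin\frac{\pi}{4g}}.$$ Let $p\colon\mathbb{H}^2\to F_g$ be the covering projection and $p_{S^1}\colon\mathbb{R}\to S^1$, $t\mapsto e^{2\pi i t}$. Let $c_1,\dots,c_{2g}$ be letters, $c_j^{\pm1}$ standing for $\delta_j^{\pm1}$. A word in the letters $c_j^{\pm 1}$ is $D$-reduced if it contains none of the following words as a (contiguous) subword: - $c_j(c_{j-1}\cdots c_1c_{2g}^{-1}\cdots c_{j+1}^{-1})^sc_j^{-1}$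 and $c_j(c_{j+1}\cdots c_{2g}c_1^{-1}\cdots c_{j-1}^{-1})^sc_j^{-1}$ for $2\le j\le 2g$, $s\ge1$; - $c_{2g}^{-1}\cdots c_1^{-1}$ and $c_1\cdots c_{2g}$; - $c_i^{-1}\cdots c_{2g}^{-1}c_1\cdots c_{i-1}$ and $c_{i-1}^{-1}\cdots c_1^{-1}c_{2g}\cdots c_i$ for $2\le i\le 2g$; - $c_i^{-1}c_i$ and $c_ic_i^{-1}$ for $1\le i\le 2g$. (These are the leading words of a Gröbner–Shirshov basis $D$ for the presentation $\pi_1(F_g)=\langle c_1,\dots,c_{2g}\mid c_1\cdots c_{2g}=c_{2g}\cdots c_1\rangle$.) A word is cyclically $D$-reduced if all its rotations are $D$-reduced. The piecewise-geodesic loop determined by a non-empty word $u_1\cdots u_m$ is the loop $\varphi\colon S^1\to F_g$ such that, for $k=1,\dots,m$, the path $[0,1]\ni t\mapsto\varphi(e^{2\pi i(k-1+t)/m})$ is the image under $p$ of the constant-speed geodesic from $i$ to $u_k(i)$. For maps $f\colon X\to Y$ and $h\colon X'\to Y$ put $\mathrm{cvp}(f,h)=\{(x,x')\in X\times X'\mid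 f(x)=h(x')\}$. A lifting of $\varphi\colon S^1\to F_g$ is a continuous map $\tilde\varphi\colon\mathbb{R}\to\mathbb{H}^2$ with $p\circ\tilde\varphi=\varphi\circ p_{S^1}$. A common value class of $\varphi,\psi\colon S^1\to F_g$ is a non-empty set of the form $(p_{S^1}\times p_{S^1})(\mathrm{cvp}(\tilde\varphi,\tilde\psi))$, where $\tilde\varphi,\tilde\psi$ are liftings of $\varphi,\psi$. **Theorem.** Let $\varphi,\psi\colon S^1\to F_g$ be piecewise-geodesic loops determined by non-empty cyclically $D$-reduced words. Then for any lifting $\tilde\varphi$ of $\varphi$ and any lifting $\tilde\psi$ of $\psi$, the set $\mathrm{cvp}(\tilde\varphi,\tilde\psi)\subset\mathbb{R}^2$ is connected (possibly empty). Hence each common value class of $\varphi$ and $\psi$ is connected, and the common value classes of $\varphi$ and $\psi$ are exactly the connected components of $\mathrm{cvp}(\varphi,\psi)\subset S^1\times S^1$. -/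

import Mathlib

open scoped UpperHalfPlane MatrixGroups

noncomputable section

namespace SurfaceLoops

/-! ### Common value pairs -/

/-- The set of common value pairs of two maps with the same target. -/
def cvp {X X' Y : Type*} (f : X → Y) (h : X' → Y) : Set (X × X') :=
  {z | f z.1 = h z.2}

/-! ### The hyperbolic surface of genus `g ≥ 2` -/

/-- The rotation angle `(2g-1)π/(4g)` occurring in the matrix `M_g`. -/
def angle (g : ℕ) : ℝ := (2 * (g : ℝ) - 1) * Real.pi / (4 * (g : ℝ))

/-- The upper left entry `(cos (π/4g) + √(cos (π/2g))) / sin (π/4g)` of `Q_g`. -/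
def stretch (g : ℕ) : ℝ :=
  (Real.cos (Real.pi / (4 * (g : ℝ))) + Real.sqrt (Real.cos (Real.pi / (2 * (g : ℝ))))) /
    Real.sin (Real.pi / (4 * (g : ℝ)))

theorem stretch_pos (g : ℕ) [hg : Fact (2 ≤ g)] : 0 < stretch g := by
  have h2 : (2 : ℝ) ≤ (g : ℝ) := by exact_mod_cast hg.out
  have hpi := Real.pi_pos
  have hx : Real.pi / (4 * (g : ℝ)) < Real.pi / 2 :=
    div_lt_div_of_pos_left hpi (by norm_num) (by linarith)
  have hx0 : 0 < Real.pi / (4 * (g : ℝ)) := by positivity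
  refine div_pos (add_pos_of_pos_of_nonneg ?_ (Real.sqrt_nonneg _)) ?_
  · exact Real.cos_pos_of_mem_Ioo ⟨by linarith, hx⟩
  · exact Real.sin_pos_of_pos_of_lt_pi hx0 (by linarith)

/-- The matrix `M_g`. -/
def rotationMatrix (g : ℕ) : SL(2, ℝ) :=
  ⟨!![Real.cos (angle g), Real.sin (angle g); -Real.sin (angle g), Real.cos (angle g)], by
    rw [Matrix.det_fin_two_of]
    have h := Real.sin_sq_add_cos_sq (angle g)
    linarith [sq (Real.sin (angle g)), sq (Real.cos (angle g))]⟩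

/-- The matrix `Q_g`. -/
def stretchMatrix (g : ℕ) [Fact (2 ≤ g)] : SL(2, ℝ) :=
  ⟨!![stretch g, 0; 0, (stretch g)⁻¹], by
    rw [Matrix.det_fin_two_of, mul_inv_cancel₀ (stretch_pos g).ne']
    ring⟩

/-- The hyperbolic translation `δ_j`, given by the matrix `M_g^{-j} Q_g M_g^j`. The indices
`1, …, 2g` are represented by `Fin (2 * g)`, so that `j : Fin (2 * g)` stands for `j + 1`. -/
def delta (g : ℕ) [Fact (2 ≤ g)] (j : Fin (2 * g)) : SL(2, ℝ) :=
  ((rotationMatrix g) ^ ((j : ℕ) + 1))⁻¹ * stretchMatrix g * (rotationMatrix g) ^ ((j : ℕ) + 1)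

/-- The group `Γ_g` generated by `δ_1, …, δ_{2g}`; it acts on `ℍ` by Möbius transformations. -/
def Gam (g : ℕ) [Fact (2 ≤ g)] : Subgroup SL(2, ℝ) :=
  Subgroup.closure (Set.range (delta g))

/-- The closed orientable surface `F_g = ℍ / Γ_g`, with the quotient topology. -/
abbrev Surface (g : ℕ) [Fact (2 ≤ g)] : Type :=
  Quotient (MulAction.orbitRel (Gam g) ℍ)

/-- The universal covering `p : ℍ → F_g`. -/
def proj (g : ℕ) [Fact (2 ≤ g)] (z : ℍ) : Surface g :=
  Quotient.mk (MulAction.orbitRel (Gam g) ℍ) z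

/-! ### Words in the generators, and the Gröbner–Shirshov basis `D` -/

/-- A letter: `(j, true)` is `c_{j+1}` and `(j, false)` is `c_{j+1}⁻¹`. -/
abbrev Letter (g : ℕ) : Type := Fin (2 * g) × Bool

/-- The hyperbolic translation corresponding to a letter. -/
def letterTranslation (g : ℕ) [Fact (2 ≤ g)] (a : Letter g) : SL(2, ℝ) :=
  if a.2 then delta g a.1 else (delta g a.1)⁻¹

variable {g : ℕ}

/-- The word `c_{i_1} c_{i_2} ⋯`. -/
def pos (l : List (Fin (2 * g))) : List (Letter g) := l.map fun i => (i, true)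

/-- The word `c_{i_1}⁻¹ c_{i_2}⁻¹ ⋯`. -/
def neg (l : List (Fin (2 * g))) : List (Letter g) := l.map fun i => (i, false)

/-- All indices, in increasing order. -/
def all (g : ℕ) : List (Fin (2 * g)) := List.finRange (2 * g)

/-- The indices smaller than `j`, in increasing order. -/
def below (j : Fin (2 * g)) : List (Fin (2 * g)) := (all g).filter fun i => i < j

/-- The indices larger than `j`, in increasing order. -/
def above (j : Fin (2 * g)) : List (Fin (2 * g)) := (all g).filter fun i => j < i

/-- The indices at least `j`, in increasing order. -/
def atLeast (j : Fin (2 * g)) : List (Fin (2 * g)) := (all g).filter fun i => j ≤ i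

/-- The power `w ^ s` of a word. -/
def wpow (w : List (Letter g)) (s : ℕ) : List (Letter g) := (List.replicate s w).flatten

/-- The Gröbner–Shirshov basis `D`: `Basis g v w` says that the binomial `v - w`, with leading
word `v`, belongs to `D`. The condition `0 < (j : ℕ)` excludes the first generator `c_1`. -/
inductive Basis (g : ℕ) : List (Letter g) → List (Letter g) → Prop
  /-- `c_j (c_{j-1}⋯c_1 c_{2g}⁻¹⋯c_{j+1}⁻¹)^s c_j⁻¹ - (c_{j+1}⁻¹⋯c_{2g}⁻¹ c_1⋯c_{j-1})^s` -/
  | d1 (j : Fin (2 * g)) (s : ℕ) (hj : 0 < (j : ℕ)) (hs : 1 ≤ s) :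
      Basis g
        ((j, true) :: (wpow (pos (below j).reverse ++ neg (above j).reverse) s ++ [(j, false)]))
        (wpow (neg (above j) ++ pos (below j)) s)
  /-- `c_j (c_{j+1}⋯c_{2g} c_1⁻¹⋯c_{j-1}⁻¹)^s c_j⁻¹ - (c_{j-1}⁻¹⋯c_1⁻¹ c_{2g}⋯c_{j+1})^s` -/
  | d2 (j : Fin (2 * g)) (s : ℕ) (hj : 0 < (j : ℕ)) (hs : 1 ≤ s) :
      Basis g
        ((j, true) :: (wpow (pos (above j) ++ neg (below j)) s ++ [(j, false)]))
        (wpow (neg (below j).reverse ++ pos (above j).reverse) s)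
  /-- `c_{2g}⁻¹⋯c_1⁻¹ - c_1⁻¹⋯c_{2g}⁻¹` -/
  | d3 : Basis g (neg (all g).reverse) (neg (all g))
  /-- `c_1⋯c_{2g} - c_{2g}⋯c_1` -/
  | d4 : Basis g (pos (all g)) (pos (all g).reverse)
  /-- `c_i⁻¹⋯c_{2g}⁻¹ c_1⋯c_{i-1} - c_{i-1}⋯c_1 c_{2g}⁻¹⋯c_i⁻¹` -/
  | d5 (i : Fin (2 * g)) (hi : 0 < (i : ℕ)) :
      Basis g (neg (atLeast i) ++ pos (below i))
        (pos (below i).reverse ++ neg (atLeast i).reverse)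
  /-- `c_{i-1}⁻¹⋯c_1⁻¹ c_{2g}⋯c_i - c_i⋯c_{2g} c_1⁻¹⋯c_{i-1}⁻¹` -/
  | d6 (i : Fin (2 * g)) (hi : 0 < (i : ℕ)) :
      Basis g (neg (below i).reverse ++ pos (atLeast i).reverse)
        (pos (atLeast i) ++ neg (below i))
  /-- `c_i⁻¹ c_i - 1` -/
  | d7 (i : Fin (2 * g)) : Basis g [(i, false), (i, true)] []
  /-- `c_i c_i⁻¹ - 1` -/
  | d8 (i : Fin (2 * g)) : Basis g [(i, true), (i, false)] []

/-- A word is `D`-reduced if no leading word of an element of `D` occurs in it as a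
(contiguous) subword. -/
def IsDReduced (u : List (Letter g)) : Prop :=
  ∀ v w : List (Letter g), Basis g v w → ¬ v <:+: u

/-- A word is cyclically `D`-reduced if all its rotations are `D`-reduced. -/
def IsCyclicallyDReduced (u : List (Letter g)) : Prop :=
  ∀ k : ℕ, IsDReduced (u.rotate k)

/-! ### Piecewise-geodesic loops, liftings and common value classes -/

/-- On `[0,1]`, `γ` is the geodesic from `a` to `b` of constant speed (with respect to the
hyperbolic metric of `ℍ`). -/
def IsGeodesicSegment (γ : ℝ → ℍ) (a b : ℍ) : Prop :=
  γ 0 = a ∧ γ 1 = b ∧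
    ∀ s ∈ Set.Icc (0 : ℝ) 1, ∀ t ∈ Set.Icc (0 : ℝ) 1, dist (γ s) (γ t) = |s - t| * dist a b

/-- The universal covering `ℝ → S¹`, `t ↦ e^{2πit}`. -/
def circleProj (t : ℝ) : Circle := Circle.exp (2 * Real.pi * t)

/-- `φ` is the piecewise-geodesic loop determined by the non-empty word `u = u_1 ⋯ u_m`: for
`k = 1, …, m` (here `k - 1` is a term of `Fin m`) the path `λ ↦ φ(e^{2πi(k-1+λ)/m})` on `[0,1]`
is the projection to `F_g` of the geodesic of constant speed from `i` to `u_k(i)`. -/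
def IsPiecewiseGeodesicLoop [Fact (2 ≤ g)] (u : List (Letter g)) (φ : C(Circle, Surface g)) :
    Prop :=
  u ≠ [] ∧ ∀ k : Fin u.length, ∃ γ : ℝ → ℍ,
    IsGeodesicSegment γ UpperHalfPlane.I (letterTranslation g (u.get k) • UpperHalfPlane.I) ∧
      ∀ t ∈ Set.Icc (0 : ℝ) 1,
        φ (circleProj ((((k : ℕ) : ℝ) + t) / (u.length : ℝ))) = proj g (γ t)

/-- `φ'` is a lifting of the loop `φ` to the universal coverings of `S¹` and `F_g`. -/
def IsLifting [Fact (2 ≤ g)] (φ' : C(ℝ, ℍ)) (φ : C(Circle, Surface g)) : Prop :=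
  ∀ t : ℝ, proj g (φ' t) = φ (circleProj t)

/-- A common value class of `φ` and `ψ`: a non-empty set of the form
`(p_{S¹} × p_{S¹})(cvp(φ', ψ'))` for liftings `φ'` of `φ` and `ψ'` of `ψ`. -/
def IsCommonValueClass [Fact (2 ≤ g)] (φ ψ : C(Circle, Surface g)) (C : Set (Circle × Circle)) :
    Prop :=
  C.Nonempty ∧ ∃ φ' ψ' : C(ℝ, ℍ), IsLifting φ' φ ∧ IsLifting ψ' ψ ∧
    C = Prod.map circleProj circleProj '' cvp φ' ψ'

end SurfaceLoops

end

/-! The translates of the geodesics from `i` to its images under the letters form a Cayley graph of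
`Γ_g` drawn in `ℍ`. A lifting of a loop runs along this graph and spells a bi-infinite periodic
word. All its finite subwords are `D`-reduced: a leading word longer than the period would repeat
its first letter, which none does (`IsCyclicallyDReduced.seg_periodic`).

Connectedness rests on two facts. Half-edges meet only at a vertex, along each other, or at a common
midpoint (`smul_edge_eq_edge`), so every common value is joined by a straight segment of common
values to a pair of parameters of a common vertex (`IsReducedPath.exists_vertex`). Reduced words are
unique normal forms (`eq_of_eval_smul_eq`), so between two common vertices both liftings spell the
same word, after reversing one of them if they run in opposite directions. Hence the straight
segment between the two pairs consists of common values (`IsReducedPath.segment_subset`), and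
everything is joined to one vertex pair.

Uniqueness of normal forms is a ping-pong argument. The sides of the regular `4g`-gon around `i` lie
on "walls", which are linear forms in the hyperboloid coordinates. A reduced word should carry the
polygon behind the wall of its first letter (`wall_pos_of_isDReduced`). Half-planes of angularly
adjacent letters overlap, so the induction also records, on each side, how many further turns around
the current face are allowed; a budget `m` corresponds to a wall rotated about a vertex of the
polygon, with sines as coefficients (`InRegion.step`). Half relators and ladders among the leading
words are exactly what exhausts a budget (`Valid.not_turn`). Of the two ways around a face from a
given vertex one is always excluded, which separates overlapping first letters (`first_letter_eq`).

Conversely the relations hold in `SL(2, ℝ)` and rewriting terminates, so every group element has a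
reduced word. The two halves together give freeness and discontinuity of the action along the graph
(`exists_dist_graph`), hence uniqueness of liftings up to `Γ_g` (`exists_eq_smul`). Finally, the
group element relating two fixed liftings is locally constant on common values, so a common value
class is clopen in `cvp φ ψ`; being connected, it is a component. -/

set_option linter.unusedSectionVars false

/-! ### Hyperbolic geometry of the regular `4g`-gon -/

namespace SurfaceLoops
open Real
noncomputable section

/-! ### Quadratic coordinates on the upper half-plane -/

/-- The entries of the positive definite matrix `γ γᵀ` attached to the point `γ • i`. -/
def quad (z : ℍ) : ℝ × ℝ × ℝ :=
  ((z.re ^ 2 + z.im ^ 2) / z.im, z.re / z.im, 1 / z.im)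

theorem im_smul_SL (γ : SL(2, ℝ)) (z : ℍ) :
    (γ • z).im = z.im / ((γ 1 0 * z.re + γ 1 1) ^ 2 + (γ 1 0 * z.im) ^ 2) ∧
    (γ • z).re = ((γ 0 0 * z.re + γ 0 1) * (γ 1 0 * z.re + γ 1 1) + γ 0 0 * γ 1 0 * z.im ^ 2) /
      ((γ 1 0 * z.re + γ 1 1) ^ 2 + (γ 1 0 * z.im) ^ 2) ∧
    0 < (γ 1 0 * z.re + γ 1 1) ^ 2 + (γ 1 0 * z.im) ^ 2 := by
  have hdet := Matrix.SpecialLinearGroup.det_coe γ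
  rw [Matrix.det_fin_two] at hdet
  have hy := z.im_pos
  have hN : 0 < (γ 1 0 * z.re + γ 1 1) ^ 2 + (γ 1 0 * z.im) ^ 2 := by
    by_cases hc : γ 1 0 = 0
    · have hd : γ 1 1 ≠ 0 := by
        intro hd; rw [hc, hd] at hdet; simp at hdet
      rw [hc, zero_mul, zero_add, zero_mul]; positivity
    · have := mul_pos (sq_pos_of_ne_zero hc) (sq_pos_of_pos hy)
      nlinarith [sq_nonneg (γ 1 0 * z.re + γ 1 1)]
  have hcoe := UpperHalfPlane.coe_specialLinearGroup_apply γ z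
  simp only [Algebra.algebraMap_self, RingHom.id_apply] at hcoe
  have him : (γ • z).im = (((γ • z : ℍ)) : ℂ).im := rfl
  have hre : (γ • z).re = (((γ • z : ℍ)) : ℂ).re := rfl
  refine ⟨?_, ?_, hN⟩
  · rw [him, hcoe, Complex.div_im]
    simp only [Complex.normSq_apply, Complex.add_re, Complex.mul_re, Complex.ofReal_re,
      Complex.ofReal_im, Complex.add_im, Complex.mul_im, UpperHalfPlane.coe_re,
      UpperHalfPlane.coe_im]
    have e : ((γ 1 0 * z.re - 0 * z.im + γ 1 1) * (γ 1 0 * z.re - 0 * z.im + γ 1 1) +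
      (γ 1 0 * z.im + 0 * z.re + 0) * (γ 1 0 * z.im + 0 * z.re + 0)) =
        (γ 1 0 * z.re + γ 1 1) ^ 2 + (γ 1 0 * z.im) ^ 2 := by ring
    rw [e, ← sub_div]
    congr 1
    linear_combination z.im * hdet
  · rw [hre, hcoe, Complex.div_re]
    simp only [Complex.normSq_apply, Complex.add_re, Complex.mul_re, Complex.ofReal_re,
      Complex.ofReal_im, Complex.add_im, Complex.mul_im, UpperHalfPlane.coe_re,
      UpperHalfPlane.coe_im]
    have e : ((γ 1 0 * z.re - 0 * z.im + γ 1 1) * (γ 1 0 * z.re - 0 * z.im + γ 1 1) +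
      (γ 1 0 * z.im + 0 * z.re + 0) * (γ 1 0 * z.im + 0 * z.re + 0)) =
        (γ 1 0 * z.re + γ 1 1) ^ 2 + (γ 1 0 * z.im) ^ 2 := by ring
    rw [e, ← add_div]
    congr 1
    ring

/-- Möbius transformations act on the symmetric matrix by `S ↦ γ S γᵀ`, that is, linearly. Every
later statement about moving walls thereby becomes linear algebra. -/
theorem quad_smul (γ : SL(2, ℝ)) (z : ℍ) :
    quad (γ • z) =
      (γ 0 0 ^ 2 * (quad z).1 + 2 * γ 0 0 * γ 0 1 * (quad z).2.1 + γ 0 1 ^ 2 * (quad z).2.2,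
       γ 0 0 * γ 1 0 * (quad z).1 + (γ 0 0 * γ 1 1 + γ 0 1 * γ 1 0) * (quad z).2.1
        + γ 0 1 * γ 1 1 * (quad z).2.2,
       γ 1 0 ^ 2 * (quad z).1 + 2 * γ 1 0 * γ 1 1 * (quad z).2.1 + γ 1 1 ^ 2 * (quad z).2.2) := by
  have hdet := Matrix.SpecialLinearGroup.det_coe γ
  rw [Matrix.det_fin_two] at hdet
  have hy := z.im_pos
  obtain ⟨h1, h2, h3⟩ := im_smul_SL γ z
  have h3' := h3.ne'
  simp only [quad, h1, h2]
  set a := γ 0 0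
  set b := γ 0 1
  set c := γ 1 0
  set d := γ 1 1
  set x := z.re
  set y := z.im
  set N := (c * x + d) ^ 2 + (c * y) ^ 2 with hN
  refine Prod.ext ?_ (Prod.ext ?_ ?_)
  · have hsq : ((a * x + b) * (c * x + d) + a * c * y ^ 2) ^ 2 + y ^ 2 =
        ((a * x + b) ^ 2 + (a * y) ^ 2) * N := by
      rw [hN]
      linear_combination (-y ^ 2 * (a * d - b * c + 1)) * hdet
    have e : (((a * x + b) * (c * x + d) + a * c * y ^ 2) / N) ^ 2 + (y / N) ^ 2 =
        ((a * x + b) ^ 2 + (a * y) ^ 2) / N := by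
      rw [div_pow, div_pow, ← add_div, hsq]; field_simp
    rw [e]; field_simp; ring
  · field_simp; ring
  · field_simp; rw [hN]; ring

/-- The symmetric matrix has determinant `1`: this is the equation of the hyperboloid, with the
half-trace as time coordinate. -/
theorem quad_det (z : ℍ) :
    (((quad z).1 - (quad z).2.2) / 2) ^ 2 + (quad z).2.1 ^ 2 =
      (((quad z).1 + (quad z).2.2) / 2) ^ 2 - 1 := by
  have := z.im_pos
  simp only [quad]; field_simp; ring

/-! ### Constants of the regular `4g`-gon -/

/-- The angle `π/2g` of the regular polygon. -/
def beta (g : ℕ) : ℝ := π / (2 * g)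

/-- The hyperbolic functions of the walls. -/
def chi (g : ℕ) : ℝ := cos (beta g / 2)

/-- The square root of `cos (π/2g)`. -/
def dee (g : ℕ) : ℝ := √(cos (beta g))

section
variable (g : ℕ) [hg : Fact (2 ≤ g)]

theorem two_le_cast : (2 : ℝ) ≤ g := by exact_mod_cast hg.out

theorem beta_pos : 0 < beta g := by
  have := two_le_cast g; have := pi_pos; unfold beta; positivity

theorem two_g_mul_beta : 2 * g * beta g = π := by
  have := two_le_cast g; unfold beta; field_simp

theorem beta_le : beta g ≤ π / 4 := by
  have h := two_le_cast g
  have := two_g_mul_beta g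
  have := beta_pos g
  nlinarith

theorem cos_beta_pos : 0 < cos (beta g) := by
  have := beta_pos g; have := beta_le g; have := pi_pos
  exact cos_pos_of_mem_Ioo ⟨by linarith, by linarith⟩

theorem dee_sq : dee g ^ 2 = cos (beta g) := sq_sqrt (cos_beta_pos g).le

theorem dee_pos : 0 < dee g := sqrt_pos.2 (cos_beta_pos g)

theorem cos_beta_lt_one : cos (beta g) < 1 := by
  have h := beta_pos g; have h2 := beta_le g; have := pi_pos
  simpa using cos_lt_cos_of_nonneg_of_le_pi le_rfl (by linarith : beta g ≤ π) h

theorem dee_lt_one : dee g < 1 := by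
  have := dee_sq g; have := cos_beta_lt_one g; have := dee_pos g; nlinarith

theorem chi_pos : 0 < chi g := by
  have := beta_pos g; have := beta_le g; have := pi_pos
  exact cos_pos_of_mem_Ioo ⟨by linarith, by linarith⟩

theorem chi_lt_one : chi g < 1 := by
  have h := beta_pos g; have h2 := beta_le g; have := pi_pos
  have := cos_lt_cos_of_nonneg_of_le_pi le_rfl (by linarith : beta g / 2 ≤ π)
    (by linarith : 0 < beta g / 2)
  rwa [cos_zero] at this

theorem sin_half_pos : 0 < sin (beta g / 2) := by
  have h := beta_pos g; have h2 := beta_le g; have := pi_pos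
  exact sin_pos_of_pos_of_lt_pi (by linarith) (by linarith)

theorem chi_sq : 2 * chi g ^ 2 = 1 + dee g ^ 2 := by
  have := cos_sq (beta g / 2)
  rw [dee_sq, chi, this]; ring_nf

theorem sin_half_sq : sin (beta g / 2) ^ 2 = chi g ^ 2 - dee g ^ 2 := by
  have h1 := chi_sq g
  have h2 := sin_sq_add_cos_sq (beta g / 2)
  unfold chi at *; linarith

theorem dee_lt_chi : dee g < chi g := by
  have h1 := sin_half_sq g; have := sin_half_pos g; have := chi_pos g; have := dee_pos g
  nlinarith

theorem stretch_eq : stretch g = (chi g + dee g) / sin (beta g / 2) := by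
  have h := two_le_cast g
  have e : π / (4 * (g : ℝ)) = beta g / 2 := by unfold beta; field_simp; ring
  unfold stretch dee chi
  rw [e]; rfl

theorem stretch_inv : (stretch g)⁻¹ = (chi g - dee g) / sin (beta g / 2) := by
  rw [stretch_eq, inv_div]
  have h1 := sin_half_sq g; have h2 := sin_half_pos g; have := chi_pos g; have := dee_pos g
  rw [div_eq_div_iff (by positivity) h2.ne']
  nlinarith

/-- The form in which the value of `λ_g` is used: it makes `Q_g` translate by twice the distance
from `i` to the wall. -/
theorem stretch_sq : (chi g - dee g) * stretch g ^ 2 = chi g + dee g := by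
  have h := stretch_inv g
  have hp := stretch_pos g
  have h2 := sin_half_pos g
  have h3 := stretch_eq g
  have e : chi g - dee g = sin (beta g / 2) * (stretch g)⁻¹ := by rw [h]; field_simp
  have e2 : chi g + dee g = sin (beta g / 2) * stretch g := by rw [h3]; field_simp
  rw [e, e2]; field_simp

theorem one_lt_stretch : 1 < stretch g := by
  have h3 := stretch_sq g
  have := dee_pos g; have := dee_lt_chi g; have hp := stretch_pos g
  by_contra hc
  push Not at hc
  nlinarith [mul_nonneg (sub_nonneg.2 hc) hp.le]

theorem angle_eq : 2 * angle g = π - beta g := by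
  have h := two_le_cast g
  unfold angle beta; field_simp; ring

/-! ### The walls -/

/-- The function on `ℍ` whose zero set is the geodesic at distance half an edge length from `i`,
orthogonal to the ray in the direction `a`; it is negative at `i`. -/
def wallAt (a : ℝ) (z : ℍ) : ℝ :=
  chi g * (((quad z).1 - (quad z).2.2) / 2 * cos a + (quad z).2.1 * sin a) -
    dee g * (((quad z).1 + (quad z).2.2) / 2)

theorem rotationMatrix_apply :
    rotationMatrix g 0 0 = cos (angle g) ∧ rotationMatrix g 0 1 = sin (angle g) ∧
    rotationMatrix g 1 0 = -sin (angle g) ∧ rotationMatrix g 1 1 = cos (angle g) := by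
  simp [rotationMatrix]

theorem stretchMatrix_apply :
    stretchMatrix g 0 0 = stretch g ∧ stretchMatrix g 0 1 = 0 ∧
    stretchMatrix g 1 0 = 0 ∧ stretchMatrix g 1 1 = (stretch g)⁻¹ := by
  simp [stretchMatrix]

theorem stretchMatrix_inv_apply :
    (stretchMatrix g)⁻¹ 0 0 = (stretch g)⁻¹ ∧ (stretchMatrix g)⁻¹ 0 1 = 0 ∧
    (stretchMatrix g)⁻¹ 1 0 = 0 ∧ (stretchMatrix g)⁻¹ 1 1 = stretch g := by
  have h := Matrix.SpecialLinearGroup.coe_inv (stretchMatrix g)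
  rw [Matrix.adjugate_fin_two] at h
  obtain ⟨h1, h2, h3, h4⟩ := stretchMatrix_apply g
  rw [h1, h2, h3, h4, neg_zero] at h
  exact ⟨congrFun (congrFun h 0) 0, congrFun (congrFun h 0) 1, congrFun (congrFun h 1) 0,
    congrFun (congrFun h 1) 1⟩

/-- The matrix `M_g` fixes `i` and turns directions by twice its angle, which is `π - β`. -/
theorem wallAt_rotation (a : ℝ) (z : ℍ) :
    wallAt g a (rotationMatrix g • z) = wallAt g (a + (π - beta g)) z := by
  obtain ⟨h1, h2, h3, h4⟩ := rotationMatrix_apply g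
  rw [← angle_eq]
  have hs := sin_sq_add_cos_sq (angle g)
  simp only [wallAt, quad_smul, h1, h2, h3, h4, cos_add, sin_add, cos_two_mul, sin_two_mul]
  set s := sin (angle g)
  set c := cos (angle g)
  linear_combination -(chi g * (((quad z).1 - (quad z).2.2) / 2 * cos a + (quad z).2.1 * sin a) +
    dee g * (((quad z).1 + (quad z).2.2) / 2)) * hs

theorem wallAt_rotation_zpow (a : ℝ) (n : ℤ) (z : ℍ) :
    wallAt g a (rotationMatrix g ^ n • z) = wallAt g (a + n * (π - beta g)) z := by
  induction n using Int.induction_on generalizing z with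
  | zero => simp
  | succ n ih =>
    rw [zpow_add, zpow_one, mul_smul, ih, wallAt_rotation]
    congr 1; push_cast; ring
  | pred n ih =>
    have := wallAt_rotation g (a + ((-n - 1 : ℤ) : ℝ) * (π - beta g)) ((rotationMatrix g)⁻¹ • z)
    rw [smul_inv_smul] at this
    rw [zpow_sub_one, mul_smul, ih, this]
    congr 1; push_cast; ring

theorem wallAt_add_int (a : ℝ) (k : ℤ) (z : ℍ) : wallAt g (a + k * (2 * π)) z = wallAt g a z := by
  simp only [wallAt, cos_add_int_mul_two_pi, sin_add_int_mul_two_pi]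

theorem stretch_sq_inv : (chi g + dee g) * ((stretch g)⁻¹) ^ 2 = chi g - dee g := by
  have h := stretch_sq g
  have hp := stretch_pos g
  rw [← h]; field_simp

/-- The side pairing: `Q_g⁻¹` takes the wall ahead of `i` to the wall behind it and exchanges the
two sides. -/
theorem wallAt_stretch_zero (z : ℍ) :
    wallAt g π ((stretchMatrix g)⁻¹ • z) = -wallAt g 0 z := by
  obtain ⟨h1, h2, h3, h4⟩ := stretchMatrix_inv_apply g
  have e1 := stretch_sq g
  have e2 := stretch_sq_inv g
  simp only [wallAt, quad_smul, h1, h2, h3, h4, cos_pi, sin_pi, cos_zero, sin_zero]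
  linear_combination (-(quad z).1 / 2) * e2 + ((quad z).2.2 / 2) * e1

/-- Here `a` stands for `±β`. The pulled-back wall passes through the vertex common to the walls in
the directions `0` and `a`, so it is a combination of these two; the interior angle `β` gives the
coefficient `2 cos β`. -/
theorem wallAt_stretch_beta (a : ℝ) (ha : cos a = cos (beta g)) (z : ℍ) :
    wallAt g (π - a) ((stretchMatrix g)⁻¹ • z) =
      wallAt g a z + 2 * cos (beta g) * wallAt g 0 z := by
  obtain ⟨h1, h2, h3, h4⟩ := stretchMatrix_inv_apply g
  have e1 := stretch_sq g
  have e2 := stretch_sq_inv g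
  have hl := dee_lt_chi g
  have hd := dee_pos g
  have hc := chi_sq g
  simp only [wallAt, quad_smul, h1, h2, h3, h4, cos_pi_sub, sin_pi_sub, cos_zero, sin_zero, ha, ← dee_sq]
  have hs : stretch g * (stretch g)⁻¹ = 1 := mul_inv_cancel₀ (stretch_pos g).ne'
  set C := chi g
  set D := dee g
  -- After multiplication by `C + D` the stretch factor is eliminated by `e2`, and what remains is a
  -- multiple of `2C² = 1 + D²`; `k1` is the same with `C - D`.
  have k2 : -(C * D ^ 2 + D) * ((stretch g)⁻¹) ^ 2 = C * D ^ 2 - D + 2 * D ^ 2 * (C - D) := by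
    apply mul_left_cancel₀ (show C + D ≠ 0 by linarith)
    linear_combination (-(C * D ^ 2 + D)) * e2 - 2 * D ^ 2 * hc
  have k1 : (C * D ^ 2 - D) * (stretch g) ^ 2 = -(C * D ^ 2) - D - 2 * D ^ 2 * (C + D) := by
    apply mul_left_cancel₀ (show C - D ≠ 0 by linarith)
    linear_combination (C * D ^ 2 - D) * e1 + 2 * D ^ 2 * hc
  linear_combination ((quad z).1 / 2) * k2 + ((quad z).2.2 / 2) * k1 +  C * (quad z).2.1 * sin a * hs

/-- Two walls in directions at angular distance at least `2π/2g` bound disjoint half-planes. -/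
theorem wallAt_neg_of_nonneg {a b : ℝ} (hab : cos (a - b) ≤ cos (2 * beta g)) {z : ℍ}
    (ha : 0 ≤ wallAt g a z) : wallAt g b z < 0 := by
  have hq := quad_det z
  have ht : 0 < (quad z).1 + (quad z).2.2 := by
    have := z.im_pos
    simp only [quad]; positivity
  have e1 : cos a + cos b = 2 * cos ((a + b) / 2) * cos ((a - b) / 2) := cos_add_cos a b
  have e2 : sin a + sin b = 2 * sin ((a + b) / 2) * cos ((a - b) / 2) := sin_add_sin a b
  have e3 : cos ((a - b) / 2) ^ 2 ≤ (dee g ^ 2) ^ 2 := by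
    have h1 := cos_sq ((a - b) / 2)
    have h2 := cos_sq (beta g)
    rw [show 2 * ((a - b) / 2) = a - b by ring] at h1
    rw [dee_sq]; linarith
  have hs := sin_sq_add_cos_sq ((a + b) / 2)
  -- The sum of the two forms is negative everywhere: its space part points along the bisector,
  -- shrunk by `|cos ((a - b) / 2)| ≤ cos β = D²`, and `C D < 1`.
  have hsum : wallAt g a z + wallAt g b z = 2 * (chi g * (cos ((a - b) / 2) *
      (((quad z).1 - (quad z).2.2) / 2 * cos ((a + b) / 2) + (quad z).2.1 * sin ((a + b) / 2))) -
      dee g * (((quad z).1 + (quad z).2.2) / 2)) := by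
    simp only [wallAt]
    linear_combination chi g * (((quad z).1 - (quad z).2.2) / 2) * e1 + chi g * (quad z).2.1 * e2
  set m := cos ((a + b) / 2)
  set n := sin ((a + b) / 2)
  set u := ((quad z).1 - (quad z).2.2) / 2 with hu
  set v := (quad z).2.1
  set t := ((quad z).1 + (quad z).2.2) / 2 with htt
  have ht' : 0 < t := by rw [htt]; linarith
  have huv : u ^ 2 + v ^ 2 ≤ t ^ 2 := by linarith
  have hd := dee_pos g
  have hX : (u * m + v * n) ^ 2 ≤ t ^ 2 := by
    have : (u * m + v * n) ^ 2 + (u * n - v * m) ^ 2 = u ^ 2 + v ^ 2 := by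
      linear_combination (u ^ 2 + v ^ 2) * hs
    linarith [sq_nonneg (u * n - v * m)]
  have hY : cos ((a - b) / 2) * (u * m + v * n) ≤ dee g ^ 2 * t := by
    apply le_of_abs_le
    apply abs_le_of_sq_le_sq _ (by positivity)
    rw [mul_pow, mul_pow]
    exact mul_le_mul e3 hX (sq_nonneg _) (by positivity)
  have hc := chi_pos g
  have hcl := chi_lt_one g
  have hdl := dee_lt_one g
  have h3 : chi g * (dee g ^ 2 * t) < dee g * t := by
    have : chi g * dee g < 1 := by nlinarith
    nlinarith [mul_pos hd ht']
  nlinarith [mul_le_mul_of_nonneg_left hY hc.le]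

/-- The hyperbolic translation attached to the `n`-th letter in the cyclic order of the letters. -/
def trans (n : ℤ) : SL(2, ℝ) :=
  rotationMatrix g ^ (-(n + 1)) * stretchMatrix g * rotationMatrix g ^ (n + 1)

/-- The wall crossed by the edge from `i` to `trans g n • i`. -/
def wall (n : ℤ) (z : ℍ) : ℝ := wallAt g ((n + 1) * (π - beta g)) z

variable {g}

/-- `4g` steps by `π - β` make `2g - 1` full turns, because `2gβ = π`. -/
theorem wall_congr {n m : ℤ} (h : n ≡ m [ZMOD 4 * g]) (z : ℍ) : wall g n z = wall g m z := by
  obtain ⟨k, hk⟩ := h.dvd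
  have hb := two_g_mul_beta g
  have hm : (m : ℝ) = n + 4 * g * k := by
    have : m = n + 4 * g * k := by linarith
    rw [this]; push_cast; ring
  have e : ((m : ℝ) + 1) * (π - beta g) =
      (n + 1) * (π - beta g) + (((2 * g - 1) * k : ℤ) : ℝ) * (2 * π) := by
    rw [hm]; push_cast; linear_combination (-2 * k : ℝ) * hb
  rw [wall, wall, e, wallAt_add_int]

theorem wall_trans_inv_aux (a : ℝ) (n : ℤ) (z : ℍ) :
    wallAt g (a + (n + 1) * (π - beta g)) ((trans g n)⁻¹ • z) =
      wallAt g a ((stretchMatrix g)⁻¹ • (rotationMatrix g ^ (n + 1) • z)) := by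
  have e : (trans g n)⁻¹ = rotationMatrix g ^ (-(n + 1)) * ((stretchMatrix g)⁻¹ *
      rotationMatrix g ^ (n + 1)) := by
    unfold trans; group
  rw [e, mul_smul, mul_smul, wallAt_rotation_zpow]
  congr 1; push_cast; ring

theorem wall_opp_trans_inv (n : ℤ) (z : ℍ) :
    wall g (n + 2 * g) ((trans g n)⁻¹ • z) = -wall g n z := by
  have hb := two_g_mul_beta g
  have e : ((n + 2 * g : ℤ) + 1 : ℝ) * (π - beta g) =
      π + (n + 1) * (π - beta g) + ((g - 1 : ℤ) : ℝ) * (2 * π) := by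
    push_cast; linear_combination -hb
  rw [wall, e, wallAt_add_int, wall_trans_inv_aux, wallAt_stretch_zero, wallAt_rotation_zpow, wall]
  congr 2; push_cast; ring

/-- The directions of `n` and `n + 2g - e` differ by `β`. After crossing wall `n`, the wall `n + e`
is the next one through the same vertex of the polygon; this is one step of the rotation around that
vertex. -/
theorem wall_adj_trans_inv {e : ℤ} (he : e = 1 ∨ e = -1) (n : ℤ) (z : ℍ) :
    wall g (n + e) ((trans g n)⁻¹ • z) =
      wall g (n + 2 * g - e) z + 2 * cos (beta g) * wall g n z := by
  have hb := two_g_mul_beta g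
  have e0 : wallAt g 0 (rotationMatrix g ^ (n + 1) • z) = wall g n z := by
    rw [wallAt_rotation_zpow, wall]; congr 1; push_cast; ring
  rcases he with rfl | rfl
  · have e1 : ((n + 1 : ℤ) + 1 : ℝ) * (π - beta g) =
      (π - beta g) + (n + 1) * (π - beta g) := by
      push_cast; ring
    rw [wall, e1, wall_trans_inv_aux, wallAt_stretch_beta g _ rfl, wallAt_rotation_zpow, e0]
    congr 1
    have e2 : ((n + 2 * g - 1 : ℤ) + 1 : ℝ) * (π - beta g) =
      beta g + (n + 1 : ℤ) * (π - beta g) + ((g - 1 : ℤ) : ℝ) * (2 * π) := by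
      push_cast; linear_combination -hb
    rw [wall, e2, wallAt_add_int]
  · have e1 : ((n + -1 : ℤ) + 1 : ℝ) * (π - beta g) =
      (π - -beta g) + (n + 1) * (π - beta g) + ((-1 : ℤ) : ℝ) * (2 * π) := by
      push_cast; ring
    rw [wall, e1, wallAt_add_int, wall_trans_inv_aux, wallAt_stretch_beta g _ (cos_neg _),
      wallAt_rotation_zpow, e0]
    congr 1
    have e2 : ((n + 2 * g - -1 : ℤ) + 1 : ℝ) * (π - beta g) =
      -beta g + (n + 1 : ℤ) * (π - beta g) + ((g : ℤ) : ℝ) * (2 * π) := by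
      push_cast; linear_combination -hb
    rw [wall, e2, wallAt_add_int]

theorem cos_le_cos_of_mem {b x : ℝ} (hb : 0 ≤ b) (h1 : b ≤ x) (h2 : x ≤ 2 * π - b) :
    cos x ≤ cos b := by
  rcases le_total x π with h | h
  · exact cos_le_cos_of_nonneg_of_le_pi hb h h1
  · rw [← cos_two_pi_sub x]
    exact cos_le_cos_of_nonneg_of_le_pi hb (by linarith) (by linarith)

/-- Cosines of the angles between the directions of two letters. -/
theorem cos_letter_angle {d : ℤ} (hd : 0 ≤ d) (hd' : d < 4 * g) {k : ℕ} (hk : k ≤ 2)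
    (he : Even d → k ≤ d ∧ d ≤ 4 * g - k) (ho : ¬ Even d → (k : ℤ) ≤ |d - 2 * g|) :
    cos (d * (π - beta g)) ≤ cos (k * beta g) := by
  have hb := two_g_mul_beta g
  have hbp := beta_pos g
  have hg2 := hg.out
  have hk0 : 0 ≤ (k : ℝ) * beta g := by positivity
  -- Modulo `2π` the angle is `-dβ` for even `d` and `-(d - 2g)β` for odd `d`. The angular order of
  -- the letters therefore differs from their cyclic numbering: the angular neighbours of `0` are
  -- `2g ± 1`.
  by_cases h : Even d
  · obtain ⟨h1, h2⟩ := he h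
    obtain ⟨c, rfl⟩ := h
    have e : ((c + c : ℤ) : ℝ) * (π - beta g) = -((c + c : ℤ) * beta g) + (c : ℤ) * (2 * π) := by
      push_cast; ring
    rw [e, cos_add_int_mul_two_pi, cos_neg]
    have h1' : (k : ℝ) ≤ (c + c : ℤ) := by exact_mod_cast h1
    have h2' : ((c + c : ℤ) : ℝ) ≤ 4 * g - k := by exact_mod_cast h2
    apply cos_le_cos_of_mem hk0
    · nlinarith
    · nlinarith
  · have h1 := ho h
    obtain ⟨c, rfl⟩ := Int.not_even_iff_odd.1 h
    have e : ((2 * c + 1 : ℤ) : ℝ) * (π - beta g) =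
        -(((2 * c + 1 - 2 * g : ℤ) : ℝ) * beta g) + (c : ℤ) * (2 * π) := by
      push_cast; linear_combination -hb
    rw [e, cos_add_int_mul_two_pi, cos_neg, ← cos_abs, abs_mul, abs_of_pos hbp]
    have h1' : (k : ℝ) ≤ |((2 * c + 1 - 2 * g : ℤ) : ℝ)| := by exact_mod_cast h1
    have h2 : |2 * c + 1 - 2 * (g : ℤ)| ≤ 2 * g := by
      rw [abs_le]; constructor <;> omega
    have h2' : |((2 * c + 1 - 2 * g : ℤ) : ℝ)| ≤ 2 * g := by exact_mod_cast h2
    apply cos_le_cos_of_mem hk0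
    · nlinarith
    · have : (k : ℝ) ≤ 2 := by exact_mod_cast hk
      have h2g : (2 : ℝ) ≤ g := by exact_mod_cast hg2
      nlinarith

theorem cos_letter_angle_emod (n m : ℤ) :
    cos ((n + 1) * (π - beta g) - (m + 1) * (π - beta g)) =
      cos (((n - m) % (4 * g) : ℤ) * (π - beta g)) := by
  have hb := two_g_mul_beta g
  have h := Int.emod_add_mul_ediv (n - m) (4 * g)
  set k := (n - m) / (4 * g)
  have h' : (n : ℝ) - m = ((n - m) % (4 * g) : ℤ) + 4 * g * k := by exact_mod_cast h.symm
  have e : ((n : ℝ) + 1) * (π - beta g) - (m + 1) * (π - beta g) =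
      ((n - m) % (4 * g) : ℤ) * (π - beta g) + (((2 * g - 1) * k : ℤ) : ℝ) * (2 * π) := by
    push_cast; linear_combination (π - beta g) * h' - (2 * k : ℝ) * hb
  rw [e, cos_add_int_mul_two_pi]

/-- Half-planes of letters that are not neighbours in the angular order are disjoint. -/
theorem wall_neg_of_nonneg {n m : ℤ} {z : ℍ} (h0 : (n - m) % (4 * g) ≠ 0)
    (h1 : (n - m) % (4 * g) ≠ 2 * g + 1) (h2 : (n - m) % (4 * g) ≠ 2 * g - 1)
    (hn : 0 ≤ wall g n z) : wall g m z < 0 := by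
  have hg2 := hg.out
  refine wallAt_neg_of_nonneg g ?_ hn
  rw [cos_letter_angle_emod]
  have hl := Int.emod_nonneg (n - m) (by omega : (4 * g : ℤ) ≠ 0)
  have hu := Int.emod_lt_of_pos (n - m) (by omega : (0 : ℤ) < 4 * g)
  set d := (n - m) % (4 * g)
  have := cos_letter_angle (g := g) hl hu (k := 2) le_rfl
    (by rintro ⟨c, hc⟩; push_cast; omega)
    (by intro ho; rw [Int.not_even_iff] at ho; rw [le_abs]; push_cast; omega)
  exact_mod_cast this

end
end
end SurfaceLoops

/-! ### Letters, runs of letters and leading words -/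

namespace SurfaceLoops
open Real
noncomputable section
section
variable {g : ℕ} [hg : Fact (2 ≤ g)]

/-! ### The cyclic order of the letters -/

/-- The letters in the cyclic order `c_1, …, c_{2g}, c_1⁻¹, …, c_{2g}⁻¹`, as a `4g`-periodic
sequence. -/
def letter (n : ℤ) : Letter g :=
  (⟨(n % (2 * g)).toNat, by
    have := hg.out
    have := Int.emod_lt_of_pos n (by omega : (0 : ℤ) < 2 * g)
    have := Int.emod_nonneg n (by omega : (2 * g : ℤ) ≠ 0)
    omega⟩, decide (n % (4 * g) < 2 * g))

/-- The index of a letter in the cyclic order. -/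
def idx (a : Letter g) : ℤ := ((a.1 : ℕ) : ℤ) + (if a.2 then 0 else 2 * (g : ℤ))

theorem emod_two_g (n : ℤ) : n % (2 * g) = if n % (4 * g) < 2 * g then n % (4 * g) else
    n % (4 * g) - 2 * g := by
  have := hg.out
  have h0 := Int.emod_nonneg n (by omega : (4 * g : ℤ) ≠ 0)
  have h1 := Int.emod_lt_of_pos n (by omega : (0 : ℤ) < 4 * g)
  have h2 : n % (2 * g) = (n % (4 * g)) % (2 * g) :=
    (Int.emod_emod_of_dvd n ⟨2, by ring⟩).symm
  rw [h2]
  split_ifs with h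
  · exact Int.emod_eq_of_lt h0 h
  · rw [← Int.sub_emod_right]
    exact Int.emod_eq_of_lt (by omega) (by omega)

theorem idx_letter (n : ℤ) : idx (letter n : Letter g) = n % (4 * g) := by
  have := hg.out
  have h0 := Int.emod_nonneg n (by omega : (4 * g : ℤ) ≠ 0)
  have h1 := Int.emod_lt_of_pos n (by omega : (0 : ℤ) < 4 * g)
  have h2 := emod_two_g (g := g) n
  have h3 := Int.emod_nonneg n (by omega : (2 * g : ℤ) ≠ 0)
  simp only [idx, letter, decide_eq_true_eq, h2]
  split_ifs <;> omega

theorem letter_idx (a : Letter g) : letter (idx a) = a := by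
  obtain ⟨⟨j, hj⟩, b⟩ := a
  have := hg.out
  cases b
  · have h4 : (((j : ℤ) + 2 * g) % (4 * g)) = j + 2 * g :=
      Int.emod_eq_of_lt (by omega) (by omega)
    have h2 := emod_two_g (g := g) (j + 2 * g)
    rw [h4, if_neg (by omega)] at h2
    simp only [idx, letter]
    refine Prod.ext (Fin.ext ?_) ?_
    · simp only [Bool.false_eq_true, if_false, h2]; omega
    · simp only [Bool.false_eq_true, if_false, h4]; simp
  · have h4 : (((j : ℤ) + 0) % (4 * g)) = j :=
      Int.emod_eq_of_lt (by omega) (by omega) |>.trans (by simp)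
    have h2 := emod_two_g (g := g) (j + 0)
    rw [h4, if_pos (by omega)] at h2
    simp only [idx, letter]
    refine Prod.ext (Fin.ext ?_) ?_
    · simp only [if_true, h2]; omega
    · simp only [if_true, h4]; simp; omega

theorem letter_congr {n m : ℤ} (h : n ≡ m [ZMOD 4 * g]) : (letter n : Letter g) = letter m := by
  have h' : n % (4 * g) = m % (4 * g) := h
  rw [← letter_idx (letter n : Letter g), ← letter_idx (letter m : Letter g), idx_letter,
    idx_letter, h']

theorem letter_eq_iff {n m : ℤ} : (letter n : Letter g) = letter m ↔ n ≡ m [ZMOD 4 * g] := by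
  refine ⟨fun h => ?_, letter_congr⟩
  have := congrArg idx h
  rwa [idx_letter, idx_letter] at this

theorem letter_pos (j : Fin (2 * g)) : ((j, true) : Letter g) = letter (j : ℕ) := by
  rw [← letter_idx (j, true)]; simp [idx]

theorem letter_neg (j : Fin (2 * g)) : ((j, false) : Letter g) = letter ((j : ℕ) + 2 * g) := by
  rw [← letter_idx (j, false)]; simp [idx]

/-! ### Runs of consecutive letters -/

/-- The word of `k` successive letters in the cyclic order, with step `e`. -/
def run (e n : ℤ) (k : ℕ) : List (Letter g) := (List.range k).map fun i : ℕ => letter (n + e * i)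

theorem run_length (e n : ℤ) (k : ℕ) : (run e n k : List (Letter g)).length = k := by simp [run]

theorem run_zero (e n : ℤ) : (run e n 0 : List (Letter g)) = [] := rfl

theorem run_add (e n : ℤ) (k l : ℕ) :
    (run e n (k + l) : List (Letter g)) = run e n k ++ run e (n + e * k) l := by
  simp only [run, List.range_add, List.map_append, List.map_map]
  congr 1
  apply List.map_congr_left
  intro i _
  simp only [Function.comp_apply]
  congr 1; push_cast; ring

theorem run_split (e n : ℤ) {k a b : ℕ} (h : k = a + b) :
    (run e n k : List (Letter g)) = run e n a ++ run e (n + e * a) b := by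
  rw [h, run_add]

theorem run_one (e n : ℤ) : (run e n 1 : List (Letter g)) = [letter n] := by
  simp [run]

theorem run_succ (e n : ℤ) (k : ℕ) :
    (run e n (k + 1) : List (Letter g)) = letter n :: run e (n + e) k := by
  rw [add_comm, run_add, run_one]; simp

theorem run_concat (e n : ℤ) (k : ℕ) :
    (run e n (k + 1) : List (Letter g)) = run e n k ++ [letter (n + e * k)] := by
  rw [run_add, run_one]

theorem run_congr (e : ℤ) {n m : ℤ} (h : n ≡ m [ZMOD 4 * g]) (k : ℕ) :
    (run e n k : List (Letter g)) = run e m k :=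
  List.map_congr_left fun _ _ => letter_congr (h.add_right _)

theorem run_reverse (n : ℤ) (k : ℕ) :
    (run 1 n k : List (Letter g)).reverse = run (-1) (n + k - 1) k := by
  induction k generalizing n with
  | zero => rfl
  | succ k ih =>
    rw [run_succ, List.reverse_cons, ih, run_concat]
    congr 2
    · push_cast; ring
    · congr 1; push_cast; ring

/-- Leading words are identified with runs through the list of underlying natural numbers, where the
filters defining `below`, `above` and `atLeast` become intervals. -/
theorem pos_eq_run {l : List (Fin (2 * g))} {a k : ℕ} (h : l.map Fin.val = List.range' a k) :
    pos l = run 1 a k := by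
  have : pos l = (l.map Fin.val).map fun i : ℕ => (letter i : Letter g) := by
    simp only [pos, List.map_map]
    exact List.map_congr_left fun j _ => letter_pos j
  rw [this, h, List.range'_eq_map_range, List.map_map, run]
  exact List.map_congr_left fun j _ => by simp

theorem neg_eq_run {l : List (Fin (2 * g))} {a k : ℕ} (h : l.map Fin.val = List.range' a k) :
    neg l = run 1 (a + 2 * g) k := by
  have : neg l = (l.map Fin.val).map fun i : ℕ => (letter (i + 2 * g) : Letter g) := by
    simp only [neg, List.map_map]
    exact List.map_congr_left fun j _ => letter_neg j
  rw [this, h, List.range'_eq_map_range, List.map_map, run]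
  refine List.map_congr_left fun j _ => ?_
  simp only [Function.comp_apply]
  congr 1; push_cast; ring

theorem pos_reverse (l : List (Fin (2 * g))) : pos l.reverse = (pos l).reverse := by
  simp [pos]

theorem neg_reverse (l : List (Fin (2 * g))) : neg l.reverse = (neg l).reverse := by
  simp [neg]

theorem map_val_all : (all g).map Fin.val = List.range' 0 (2 * g) := by
  rw [all, ← List.range_eq_range']
  exact List.map_coe_finRange_eq_range

theorem map_val_filter (p : ℕ → Bool) :
    ((all g).filter fun i : Fin (2 * g) => p i).map Fin.val = (List.range' 0 (2 * g)).filter p := by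
  rw [← map_val_all, List.filter_map]; rfl

theorem map_val_below (j : Fin (2 * g)) : (below j).map Fin.val = List.range' 0 j := by
  refine (map_val_filter (g := g) fun i => i < j).trans ?_
  have e : List.range' 0 (2 * g) = List.range' 0 j ++ List.range' (0 + 1 * j) (2 * g - j) := by
    rw [List.range'_append]; congr 1; omega
  rw [e, List.filter_append, List.filter_eq_self.2, List.filter_eq_nil_iff.2,
    List.append_nil]
  · intro a ha; simp [List.mem_range'] at ha ⊢; omega
  · intro a ha; simp [List.mem_range'] at ha ⊢; omega

theorem map_val_atLeast (j : Fin (2 * g)) :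
    (atLeast j).map Fin.val = List.range' j (2 * g - j) := by
  refine (map_val_filter (g := g) fun i => j ≤ i).trans ?_
  have e : List.range' 0 (2 * g) = List.range' 0 j ++ List.range' (0 + 1 * j) (2 * g - j) := by
    rw [List.range'_append]; congr 1; omega
  rw [e, List.filter_append, List.filter_eq_nil_iff.2, List.filter_eq_self.2,
    List.nil_append, zero_add, one_mul]
  · intro a ha; simp [List.mem_range'] at ha ⊢; omega
  · intro a ha; simp [List.mem_range'] at ha ⊢; omega

theorem map_val_above (j : Fin (2 * g)) :
    (above j).map Fin.val = List.range' (j + 1) (2 * g - 1 - j) := by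
  refine (map_val_filter (g := g) fun i => j < i).trans ?_
  have e : List.range' 0 (2 * g) =
      List.range' 0 (j + 1) ++ List.range' (0 + 1 * (j + 1)) (2 * g - 1 - j) := by
    rw [List.range'_append]; congr 1; omega
  rw [e, List.filter_append, List.filter_eq_nil_iff.2, List.filter_eq_self.2,
    List.nil_append, zero_add, one_mul]
  · intro a ha; simp [List.mem_range'] at ha ⊢; omega
  · intro a ha; simp [List.mem_range'] at ha ⊢; omega

/-! ### The leading words as runs -/

theorem pos_all : pos (all g) = run 1 0 (2 * g) := pos_eq_run map_val_all

theorem neg_all : neg (all g) = run 1 (2 * g) (2 * g) := by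
  rw [neg_eq_run map_val_all]; simp

theorem pos_all_reverse : pos (all g).reverse = run (-1) (2 * g - 1) (2 * g) := by
  rw [pos_reverse, pos_all, run_reverse]; congr 1; push_cast; ring

theorem neg_all_reverse : neg (all g).reverse = run (-1) (4 * g - 1) (2 * g) := by
  rw [neg_reverse, neg_all, run_reverse]; congr 1; push_cast; ring

theorem neg_atLeast_pos_below (i : Fin (2 * g)) :
    neg (atLeast i) ++ pos (below i) = run 1 (i + 2 * g) (2 * g) := by
  have hi := i.2
  rw [neg_eq_run (map_val_atLeast i), pos_eq_run (map_val_below i)]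
  have e : 2 * g = (2 * g - i) + i := by omega
  rw [run_split 1 _ e]
  congr 1
  apply run_congr
  refine (Int.modEq_iff_dvd.2 ⟨1, ?_⟩)
  push_cast [Nat.cast_sub hi.le]; ring

theorem pos_below_neg_atLeast_reverse (i : Fin (2 * g)) :
    pos (below i).reverse ++ neg (atLeast i).reverse = run (-1) (i - 1) (2 * g) := by
  rw [pos_reverse, neg_reverse, ← List.reverse_append, neg_atLeast_pos_below, run_reverse]
  apply run_congr
  refine (Int.modEq_iff_dvd.2 ⟨-1, ?_⟩)
  push_cast; ring

theorem pos_atLeast_neg_below (i : Fin (2 * g)) :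
    pos (atLeast i) ++ neg (below i) = run 1 i (2 * g) := by
  have hi := i.2
  rw [pos_eq_run (map_val_atLeast i), neg_eq_run (map_val_below i)]
  have e : 2 * g = (2 * g - i) + i := by omega
  rw [run_split 1 _ e]
  congr 2
  push_cast [Nat.cast_sub hi.le]; ring

theorem neg_below_pos_atLeast_reverse (i : Fin (2 * g)) :
    neg (below i).reverse ++ pos (atLeast i).reverse = run (-1) (i + 2 * g - 1) (2 * g) := by
  rw [pos_reverse, neg_reverse, ← List.reverse_append, pos_atLeast_neg_below, run_reverse]
  congr 1

theorem pos_above_neg_below (j : Fin (2 * g)) :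
    pos (above j) ++ neg (below j) = run 1 (j + 1) (2 * g - 1) := by
  have hi := j.2
  rw [pos_eq_run (map_val_above j), neg_eq_run (map_val_below j)]
  have e : 2 * g - 1 = (2 * g - 1 - j) + j := by omega
  rw [run_split 1 _ e]
  congr 2
  have : ((2 * g - 1 - j : ℕ) : ℤ) = 2 * g - 1 - j := by omega
  rw [this]; push_cast; ring

theorem neg_below_pos_above_reverse (j : Fin (2 * g)) :
    neg (below j).reverse ++ pos (above j).reverse = run (-1) (j + 2 * g - 1) (2 * g - 1) := by
  rw [pos_reverse, neg_reverse, ← List.reverse_append, pos_above_neg_below, run_reverse]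
  have := hg.out
  congr 1; omega

theorem neg_above_pos_below (j : Fin (2 * g)) :
    neg (above j) ++ pos (below j) = run 1 (j + 2 * g + 1) (2 * g - 1) := by
  have hi := j.2
  rw [neg_eq_run (map_val_above j), pos_eq_run (map_val_below j)]
  have e : 2 * g - 1 = (2 * g - 1 - j) + j := by omega
  rw [run_split 1 _ e]
  have : ((2 * g - 1 - j : ℕ) : ℤ) = 2 * g - 1 - j := by omega
  congr 1
  · congr 1; push_cast; ring
  · apply run_congr
    refine (Int.modEq_iff_dvd.2 ⟨1, ?_⟩)
    rw [this]; push_cast; ring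

theorem pos_below_neg_above_reverse (j : Fin (2 * g)) :
    pos (below j).reverse ++ neg (above j).reverse = run (-1) (j - 1) (2 * g - 1) := by
  rw [pos_reverse, neg_reverse, ← List.reverse_append, neg_above_pos_below, run_reverse]
  have := hg.out
  apply run_congr
  refine (Int.modEq_iff_dvd.2 ⟨-1, ?_⟩)
  have : ((2 * g - 1 : ℕ) : ℤ) = 2 * g - 1 := by omega
  rw [this]; ring

/-! ### Words avoided by reduced words -/

/-- Whether the half relator with step `e` starting at the `n`-th letter is not a leading word. -/
def Own (g : ℕ) (e n : ℤ) : Prop := (if e = 1 then n - 1 else n) % (4 * g) < 2 * g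

theorem exists_fin_of_lt {n : ℤ} (h0 : 0 ≤ n) (h1 : n < 2 * g) : ∃ j : Fin (2 * g), (j : ℤ) = n :=
  ⟨⟨n.toNat, by omega⟩, by simp; omega⟩

theorem emod_modEq (n : ℤ) : n % (4 * g) ≡ n [ZMOD 4 * g] := Int.mod_modEq _ _

theorem emod_sub_one {n : ℤ} (h : n % (4 * g) = 0) : (n - 1) % (4 * g) = 4 * g - 1 := by
  have := hg.out
  obtain ⟨k, rfl⟩ := Int.dvd_of_emod_eq_zero h
  rw [show 4 * g * k - 1 = 4 * g - 1 + 4 * g * (k - 1) by ring, Int.add_mul_emod_self_left]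
  exact Int.emod_eq_of_lt (by omega) (by omega)

theorem IsDReduced.not_infix_backtrack {u : List (Letter g)} (hu : IsDReduced u) (n : ℤ) :
    ¬ [letter n, letter (n + 2 * g)] <:+: u := by
  have := hg.out
  have h0 := Int.emod_nonneg n (by omega : (4 * g : ℤ) ≠ 0)
  have h1 := Int.emod_lt_of_pos n (by omega : (0 : ℤ) < 4 * g)
  by_cases h : n % (4 * g) < 2 * g
  · obtain ⟨j, hj⟩ := exists_fin_of_lt h0 h
    have := hu _ _ (Basis.d8 j)
    rwa [letter_pos, letter_neg, hj, letter_congr (emod_modEq n),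
      letter_congr ((emod_modEq n).add_right _)] at this
  · obtain ⟨j, hj⟩ := exists_fin_of_lt (g := g) (n := n % (4 * g) - 2 * g) (by omega) (by omega)
    have := hu _ _ (Basis.d7 j)
    have e : n % (4 * g) - 2 * g ≡ n + 2 * g [ZMOD 4 * g] := by
      refine (emod_modEq (g := g) n).sub_right _ |>.trans ?_
      exact Int.modEq_iff_dvd.2 ⟨1, by ring⟩
    rwa [letter_pos, letter_neg, hj, letter_congr e, sub_add_cancel,
      letter_congr (emod_modEq n)] at this

/-- The families `d3` to `d6` together contain, for each step, exactly the half relators whose start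
fails `Own`. -/
theorem IsDReduced.not_infix_half {u : List (Letter g)} (hu : IsDReduced u) {e n : ℤ}
    (he : e = 1 ∨ e = -1) (hn : ¬ Own g e n) : ¬ run e n (2 * g) <:+: u := by
  have := hg.out
  rcases he with rfl | rfl
  · simp only [Own, if_true, not_lt] at hn
    have h1 := Int.emod_lt_of_pos (n - 1) (by omega : (0 : ℤ) < 4 * g)
    have em := (emod_modEq (g := g) (n - 1)).add_right 1
    rw [sub_add_cancel] at em
    rw [← run_congr _ em]
    -- The start is represented in `2g + 1, …, 4g`, so that `c_1` appears as `4g`; this value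
    -- belongs to `d4` and the others to `d5`.
    by_cases h : (n - 1) % (4 * g) + 1 = 4 * g
    · have := hu _ _ Basis.d4
      rw [h, run_congr (g := g) 1 (m := 0) (Int.modEq_iff_dvd.2 ⟨-1, by ring⟩), ← pos_all]
      exact this
    · obtain ⟨j, hj⟩ := exists_fin_of_lt (g := g) (n := (n - 1) % (4 * g) + 1 - 2 * g)
        (by omega) (by omega)
      have := hu _ _ (Basis.d5 j (by omega))
      rwa [neg_atLeast_pos_below, hj, sub_add_cancel] at this
  · simp only [Own, not_lt] at hn
    norm_num at hn
    have h1 := Int.emod_lt_of_pos n (by omega : (0 : ℤ) < 4 * g)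
    rw [← run_congr _ (emod_modEq (g := g) n)]
    by_cases h : n % (4 * g) = 4 * g - 1
    · have := hu _ _ Basis.d3
      rw [h, ← neg_all_reverse]
      exact this
    · obtain ⟨j, hj⟩ := exists_fin_of_lt (g := g) (n := n % (4 * g) + 1 - 2 * g)
        (by omega) (by omega)
      have := hu _ _ (Basis.d6 j (by omega))
      rwa [neg_below_pos_atLeast_reverse, hj, sub_add_cancel, add_sub_cancel_right] at this

theorem wpow_succ (w : List (Letter g)) (s : ℕ) : wpow w (s + 1) = wpow w s ++ w := by
  simp [wpow, List.replicate_succ']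

/-- The ladder word, crossing the wall of the `n`-th letter and then following it with step `e`. -/
def ladder (e n : ℤ) (s : ℕ) : List (Letter g) := letter n :: wpow (run e (n + e) (2 * g - 1)) s

/-- The families `d1` and `d2` list ladders only for positive letters other than `c_1`. In the
remaining cases the last block of the ladder, with the closing letter, is itself a forbidden half
relator. -/
theorem IsDReduced.not_infix_ladder {u : List (Letter g)} (hu : IsDReduced u) {e n : ℤ}
    (he : e = 1 ∨ e = -1) (hn : Own g e n) {s : ℕ} (hs : 1 ≤ s) :
    ¬ ladder e n s ++ [letter (n + 2 * g)] <:+: u := by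
  have hg2 := hg.out
  have key : ¬ Own g e (n + e) → ¬ ladder e n s ++ [letter (n + 2 * g)] <:+: u := by
    intro hno hin
    apply hu.not_infix_half he hno
    refine List.IsInfix.trans ?_ hin
    obtain ⟨s, rfl⟩ : ∃ s', s = s' + 1 := ⟨s - 1, by omega⟩
    refine ⟨letter n :: wpow (run e (n + e) (2 * g - 1)) s, [], ?_⟩
    have e1 : 2 * g = (2 * g - 1) + 1 := by omega
    rw [ladder, wpow_succ]
    have e2 : (run e (n + e) (2 * g) : List (Letter g)) =
        run e (n + e) (2 * g - 1) ++ [letter (n + 2 * g)] := by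
      conv_lhs => rw [e1, run_concat]
      congr 2
      apply letter_congr
      have : ((2 * g - 1 : ℕ) : ℤ) = 2 * g - 1 := by omega
      rw [this]
      rcases he with rfl | rfl
      · ring_nf; rfl
      · exact Int.modEq_iff_dvd.2 ⟨1, by ring⟩
    rw [e2]; simp
  by_cases hno : Own g e (n + e)
  swap
  · exact key hno
  have em := emod_modEq (g := g) n
  have h0 := Int.emod_nonneg n (by omega : (4 * g : ℤ) ≠ 0)
  have h1 := Int.emod_lt_of_pos n (by omega : (0 : ℤ) < 4 * g)
  -- Two consecutive starts satisfying `Own` leave exactly the letters `c_2, …, c_{2g}`.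
  have hpos : 0 < n % (4 * g) ∧ n % (4 * g) < 2 * g := by
    rcases he with rfl | rfl
    · simp only [Own, if_true, add_sub_cancel_right] at hn hno
      refine ⟨lt_of_le_of_ne h0 fun h => ?_, hno⟩
      have : (n - 1) % (4 * g) = 4 * g - 1 := emod_sub_one h.symm
      omega
    · simp only [Own] at hn hno
      norm_num at hn hno
      refine ⟨lt_of_le_of_ne h0 fun h => ?_, hn⟩
      have : (n - 1) % (4 * g) = 4 * g - 1 := emod_sub_one h.symm
      rw [← sub_eq_add_neg] at hno
      omega
  obtain ⟨j, hj⟩ := exists_fin_of_lt h0 hpos.2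
  have em1 : (n % (4 * g) + 2 * g) ≡ n + 2 * g [ZMOD 4 * g] := em.add_right _
  rcases he with rfl | rfl
  · have := hu _ _ (Basis.d2 j s (by omega) hs)
    rwa [letter_pos, letter_neg, hj, letter_congr em1, letter_congr em, pos_above_neg_below, hj,
      run_congr _ (em.add_right 1)] at this
  · have := hu _ _ (Basis.d1 j s (by omega) hs)
    rwa [letter_pos, letter_neg, hj, letter_congr em1, letter_congr em,
      pos_below_neg_above_reverse, hj, run_congr _ (em.sub_right 1)] at this

end
end
end SurfaceLoops

/-! ### Regions of the ping-pong argument -/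

namespace SurfaceLoops
open Real
noncomputable section
section
variable {g : ℕ} [hg : Fact (2 ≤ g)]

/-! ### The translations of the letters -/

variable (g) in
theorem rotationMatrix_pow_apply (n : ℕ) :
    ((rotationMatrix g ^ n : SL(2, ℝ)) : Matrix (Fin 2) (Fin 2) ℝ) =
      !![cos (n * angle g), sin (n * angle g); -sin (n * angle g), cos (n * angle g)] := by
  induction n with
  | zero => simp [Matrix.one_fin_two]
  | succ n ih =>
    rw [pow_succ, Matrix.SpecialLinearGroup.coe_mul, ih]
    ext i j
    fin_cases i <;> fin_cases j <;>
      simp [rotationMatrix, add_mul, cos_add, sin_add] <;> ring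

variable (g) in
theorem half_turn_apply : ∃ s : ℝ, s ^ 2 = 1 ∧
    ((rotationMatrix g ^ (2 * g) : SL(2, ℝ)) : Matrix (Fin 2) (Fin 2) ℝ) = !![0, s; -s, 0] := by
  have hb := two_g_mul_beta g
  have ha := angle_eq g
  have e : ((2 * g : ℕ) : ℝ) * angle g = g * π - π / 2 := by
    push_cast; linear_combination g * ha - hb / 2
  have hc : cos (((2 * g : ℕ) : ℝ) * angle g) = 0 := by
    rw [e, cos_sub_pi_div_two, sin_nat_mul_pi]
  refine ⟨sin (((2 * g : ℕ) : ℝ) * angle g), ?_, ?_⟩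
  · have := sin_sq_add_cos_sq (((2 * g : ℕ) : ℝ) * angle g)
    rw [hc] at this; linarith
  · rw [rotationMatrix_pow_apply, hc]

variable (g) in
-- `M_g^{2g}` is a half turn about `i`, so it reverses the axis of `Q_g`.
theorem half_turn_mul_stretch :
    rotationMatrix g ^ (2 * g) * stretchMatrix g =
      (stretchMatrix g)⁻¹ * rotationMatrix g ^ (2 * g) := by
  obtain ⟨s, -, hs⟩ := half_turn_apply g
  obtain ⟨h1, h2, h3, h4⟩ := stretchMatrix_inv_apply g
  obtain ⟨k1, k2, k3, k4⟩ := stretchMatrix_apply g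
  have e1 := Matrix.eta_fin_two ((stretchMatrix g : SL(2, ℝ)) : Matrix (Fin 2) (Fin 2) ℝ)
  have e2 := Matrix.eta_fin_two (((stretchMatrix g)⁻¹ : SL(2, ℝ)) : Matrix (Fin 2) (Fin 2) ℝ)
  rw [h1, h2, h3, h4] at e2
  rw [k1, k2, k3, k4] at e1
  apply Subtype.ext
  rw [Matrix.SpecialLinearGroup.coe_mul, Matrix.SpecialLinearGroup.coe_mul, hs, e1, e2]
  simp [mul_comm]

variable (g) in
theorem half_turn_sq : (rotationMatrix g ^ (2 * g)) ^ 2 = -1 := by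
  obtain ⟨s, h, hs⟩ := half_turn_apply g
  ext i j
  rw [sq, Matrix.SpecialLinearGroup.coe_mul, hs, Matrix.SpecialLinearGroup.coe_neg]
  fin_cases i <;> fin_cases j <;>
    simp [Matrix.mul_apply, Fin.sum_univ_two] <;> linarith

theorem trans_opp (n : ℤ) : trans g (n + 2 * g) = (trans g n)⁻¹ := by
  have h := half_turn_mul_stretch g
  have e : rotationMatrix g ^ (n + 2 * g + 1) =
      rotationMatrix g ^ (2 * g) * rotationMatrix g ^ (n + 1) := by
    rw [← zpow_natCast, ← zpow_add]; congr 1; push_cast; ring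
  have h' : (rotationMatrix g ^ (2 * g))⁻¹ * stretchMatrix g * rotationMatrix g ^ (2 * g) =
      (stretchMatrix g)⁻¹ := by
    have h2 := congrArg Inv.inv h
    rw [mul_inv_rev, mul_inv_rev, inv_inv] at h2
    rw [← h2]; group
  rw [trans, trans, zpow_neg, e]
  calc _ = (rotationMatrix g ^ (n + 1))⁻¹ * ((rotationMatrix g ^ (2 * g))⁻¹ * stretchMatrix g *
        rotationMatrix g ^ (2 * g)) * rotationMatrix g ^ (n + 1) := by group
    _ = _ := by rw [h']; group

theorem letterTranslation_eq (a : Letter g) : letterTranslation g a = trans g (idx a) := by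
  obtain ⟨j, b⟩ := a
  have h : delta g j = trans g j := by
    rw [delta, trans, zpow_neg]
    norm_cast
  cases b
  · simp only [letterTranslation, idx, Bool.false_eq_true, if_false]
    rw [trans_opp, h]
  · simp only [letterTranslation, idx, if_true, add_zero]
    exact h

/-- Passing to the opposite letter twice inverts twice, so the periodicity holds in `SL(2, ℝ)`
itself and not merely up to sign. -/
theorem trans_congr {n m : ℤ} (h : n ≡ m [ZMOD 4 * g]) : trans g n = trans g m := by
  have per : ∀ n : ℤ, trans g (n + 4 * g) = trans g n := fun n => by
    rw [show n + 4 * g = n + 2 * g + 2 * g by ring, trans_opp, trans_opp, inv_inv]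
  obtain ⟨k, hk⟩ := h.dvd
  have : m = n + k * (4 * g) := by linarith
  rw [this]
  exact ((Function.Periodic.int_mul (f := trans g) per k) n).symm

theorem letterTranslation_letter (n : ℤ) : letterTranslation g (letter n) = trans g n := by
  rw [letterTranslation_eq, idx_letter]
  exact trans_congr (emod_modEq n)

/-- The element of `SL(2, ℝ)` represented by a word. -/
def eval (u : List (Letter g)) : SL(2, ℝ) := (u.map (letterTranslation g)).prod

theorem eval_cons (a : Letter g) (u : List (Letter g)) :
    eval (a :: u) = letterTranslation g a * eval u := by simp [eval]

theorem eval_append (u v : List (Letter g)) : eval (u ++ v) = eval u * eval v := by simp [eval]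

/-! ### The regions of the ping-pong argument -/

theorem eq_of_modEq {a b : ℤ} (h : a ≡ b [ZMOD 4 * g]) (h1 : a - b < 4 * g)
    (h2 : b - a < 4 * g) : a = b := by
  obtain ⟨k, hk⟩ := h.dvd
  have := hg.out
  have hk0 : k = 0 := by
    rcases lt_trichotomy k 0 with h | h | h
    · nlinarith
    · exact h
    · nlinarith
  rw [hk0] at hk; linarith

theorem wall_neg {n m : ℤ} {z : ℍ} (hn : 0 ≤ wall g n z) (h0 : ¬ n ≡ m [ZMOD 4 * g])
    (h1 : ¬ n ≡ m + 2 * g + 1 [ZMOD 4 * g]) (h2 : ¬ n ≡ m + 2 * g - 1 [ZMOD 4 * g]) :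
    wall g m z < 0 := by
  have key : ∀ c : ℤ, (n - m) % (4 * g) = c → n ≡ m + c [ZMOD 4 * g] := by
    rintro c rfl
    have := (emod_modEq (g := g) (n - m)).add_left m
    rw [add_sub_cancel] at this
    exact this.symm
  refine wall_neg_of_nonneg (fun h => h0 ?_) (fun h => h1 ?_) (fun h => h2 ?_) hn
  · simpa using key _ h
  · rw [add_assoc]; exact key _ h
  · rw [add_sub_assoc]; exact key _ h

variable (g) in
/-- The sines occurring in the rotation about a vertex of the polygon. -/
def sn (t : ℝ) : ℝ := sin (t * beta g)

theorem sn_pos {t : ℝ} (h0 : 0 < t) (h1 : t < 2 * g) : 0 < sn g t := by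
  have hb := two_g_mul_beta g
  have hp := beta_pos g
  exact sin_pos_of_pos_of_lt_pi (by positivity) (by nlinarith)

theorem sn_nonneg {t : ℝ} (h0 : 0 ≤ t) (h1 : t ≤ 2 * g) : 0 ≤ sn g t := by
  have hb := two_g_mul_beta g
  have hp := beta_pos g
  exact sin_nonneg_of_nonneg_of_le_pi (by positivity) (by nlinarith)

/-- The recurrence has the coefficient `2 cos β` of `wall_adj_trans_inv`; changing frame across a
wall therefore shifts the index of the sines by one. -/
theorem sn_add_one (t : ℝ) : sn g (t + 1) = 2 * cos (beta g) * sn g t - sn g (t - 1) := by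
  simp only [sn, add_mul, sub_mul, one_mul, sin_add, sin_sub]; ring

theorem sn_two_g : sn g (2 * g) = 0 := by rw [sn, two_g_mul_beta, sin_pi]

/-- The region of the points that a reduced continuation can reach from the base point `i`, after
the `x`-th letter, where `m e` bounds the number of successive turns with step `e`. -/
def InRegion (x : ℤ) (m : ℤ → ℕ) (z : ℍ) : Prop :=
  wall g (x + 2 * g) z < 0 ∧ ∀ e : ℤ, e = 1 ∨ e = -1 →
    sn g (m e) * wall g (x + e) z + sn g (m e - 1) * wall g (x + 2 * g) z < 0

/-- The region of a state in the frame before its last letter. -/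
theorem InRegion.trans_smul {x : ℤ} {m : ℤ → ℕ} {z : ℍ} (h : InRegion (g := g) x m z) :
    0 < wall g x (trans g x • z) ∧ ∀ e : ℤ, e = 1 ∨ e = -1 →
      sn g (m e) * wall g (x + 2 * g - e) (trans g x • z) +
        sn g (m e + 1) * wall g x (trans g x • z) < 0 := by
  have h1 := wall_opp_trans_inv (g := g) x (trans g x • z)
  rw [inv_smul_smul] at h1
  refine ⟨by linarith [h.1], fun e he => ?_⟩
  have h2 := wall_adj_trans_inv (g := g) he x (trans g x • z)
  rw [inv_smul_smul] at h2
  have h3 := h.2 e he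
  rw [h1, h2] at h3
  rw [sn_add_one]
  linarith

variable (g) in
-- For `1 ≤ m ≤ 2g` both sines are nonnegative and they never vanish together. At `m = 1` the
-- condition forbids the wall next to the one behind; at `m = 2g` it reduces to the condition on the
-- wall behind.
theorem comb_neg {m : ℕ} (h1 : 1 ≤ m) (h2 : m ≤ 2 * g) {a b : ℝ} (ha : a < 0) (hb : b < 0) :
    sn g m * a + sn g (m - 1) * b < 0 := by
  have hm1 : (1 : ℝ) ≤ m := by exact_mod_cast h1
  have hm2 : (m : ℝ) ≤ 2 * g := by exact_mod_cast h2
  have hg2 := two_le_cast g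
  have s2 := sn_nonneg (g := g) (t := m - 1) (by linarith) (by linarith)
  rcases h2.lt_or_eq with h | h
  · have s1 := sn_pos (g := g) (t := m) (by linarith) (by exact_mod_cast h)
    nlinarith [mul_neg_of_pos_of_neg s1 ha, mul_nonneg s2 (neg_nonneg.2 hb.le)]
  · have s1 := sn_nonneg (g := g) (t := m) (by linarith) hm2
    have s3 := sn_pos (g := g) (t := m - 1) (by rw [h]; push_cast; linarith) (by linarith)
    nlinarith [mul_neg_of_pos_of_neg s3 hb, mul_nonneg s1 (neg_nonneg.2 ha.le)]

/-- A wall does not meet the second next wall, even behind the wall between them. -/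
theorem comb_adj_neg {e : ℤ} (he : e = 1 ∨ e = -1) (x : ℤ) {z : ℍ}
    (hy : 0 < wall g (x + 2 * g + 2 * e) z) (hx : 0 < wall g (x + e) z) :
    2 * cos (beta g) * wall g (x + e) z + wall g (x + 2 * g) z < 0 := by
  have hg2 := hg.out
  have he' : -e = 1 ∨ -e = -1 := by omega
  have h1 := wall_adj_trans_inv (g := g) he (x + e) z
  have h2 := wall_adj_trans_inv (g := g) he' (x + e) z
  rw [show x + e + 2 * g - e = x + 2 * g by ring] at h1
  rw [show x + e + 2 * g - -e = x + 2 * g + 2 * e by ring] at h2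
  have hc := cos_beta_pos g
  -- Seen from across wall `x + e`, the two neighbouring walls become those of `x` and `x + 2e`,
  -- which are not angular neighbours and so bound disjoint half-planes.
  have h3 : 0 ≤ wall g (x + e + -e) ((trans g (x + e))⁻¹ • z) := by rw [h2]; positivity
  have h4 : wall g (x + e + e) ((trans g (x + e))⁻¹ • z) < 0 := by
    refine wall_neg h3 (fun h => ?_) (fun h => ?_) (fun h => ?_)
    · have := eq_of_modEq h (by omega) (by omega); omega
    · have := eq_of_modEq h (by omega) (by omega); omega
    · have := eq_of_modEq h (by omega) (by omega); omega
  rw [h1] at h4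
  linarith

/-- If wall `x + e` has been crossed, the recurrence rewrites the combination as `sn (m - 1) (2 cos
β · w + v) - sn (m - 2) w`, where `w` and `v` are the values at `x + e` and `x + 2g`; then
`comb_adj_neg` applies. -/
theorem comb_neg_of_second {e : ℤ} (he : e = 1 ∨ e = -1) (x : ℤ) {z : ℍ} {m : ℕ} (hm : 2 ≤ m)
    (hm' : m ≤ 2 * g) (hy : 0 < wall g (x + 2 * g + 2 * e) z) (hx : wall g (x + 2 * g) z < 0) :
    sn g m * wall g (x + e) z + sn g (m - 1) * wall g (x + 2 * g) z < 0 := by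
  have hm1 : (2 : ℝ) ≤ m := by exact_mod_cast hm
  have hm2 : (m : ℝ) ≤ 2 * g := by exact_mod_cast hm'
  have s1 := sn_nonneg (g := g) (t := m) (by linarith) hm2
  have s2 := sn_pos (g := g) (t := m - 1) (by linarith) (by linarith)
  have s3 := sn_nonneg (g := g) (t := m - 1 - 1) (by linarith) (by linarith)
  have hs := sn_add_one (g := g) ((m : ℝ) - 1)
  rw [sub_add_cancel] at hs
  rcases le_or_gt (wall g (x + e) z) 0 with h | h
  · nlinarith [mul_neg_of_pos_of_neg s2 hx, mul_nonneg s1 (neg_nonneg.2 h)]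
  · have h1 := comb_adj_neg he x hy h
    rw [hs]
    nlinarith [mul_neg_of_pos_of_neg s2 h1, mul_nonneg s3 h.le]

/-- One move of the ping-pong. A turn `y = x + e` costs one unit of the budget, by the rotation of
walls. The only other letter whose half-plane can meet that of `x + e`, apart from backtracking, is
its second angular neighbour `y = x + 2g + 2e`; if the budget was already `1`, the region after `y`
must avoid wall `x + e`, which is what the new budget `2g - 1` says. For all other letters the
half-planes are disjoint. -/
theorem InRegion.step {x y : ℤ} {m m' : ℤ → ℕ} {z : ℍ}
    (hm : ∀ e : ℤ, e = 1 ∨ e = -1 → 1 ≤ m e ∧ m e ≤ 2 * g)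
    (hxy : ¬ y ≡ x + 2 * g [ZMOD 4 * g])
    (hturn : ∀ e : ℤ, e = 1 ∨ e = -1 → y ≡ x + e [ZMOD 4 * g] → 2 ≤ m e ∧ m' e = m e - 1)
    (hskip : ∀ e : ℤ, e = 1 ∨ e = -1 → y ≡ x + 2 * g + 2 * e [ZMOD 4 * g] → m e = 1 →
      m' e = 2 * g - 1)
    (h : InRegion (g := g) y m' z) : InRegion (g := g) x m (trans g y • z) := by
  have hg2 := hg.out
  have hg2' := two_le_cast g
  set w := trans g y • z
  obtain ⟨hpos, hR⟩ : _ ∧ _ := h.trans_smul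
  have G : ∀ e : ℤ, e = 1 ∨ e = -1 → ¬ y ≡ x + e [ZMOD 4 * g] →
      ¬ y ≡ x + 2 * g + 2 * e [ZMOD 4 * g] → wall g (x + e) w < 0 := by
    intro e he h1 h2
    refine wall_neg hpos.le h1 (fun h => ?_) (fun h => ?_)
    · rcases he with rfl | rfl
      · exact h2 (by convert h using 1; ring)
      · exact hxy (by convert h using 1; ring)
    · rcases he with rfl | rfl
      · exact hxy (by convert h using 1; ring)
      · exact h2 (by convert h using 1; ring)
  have turn : ∀ e : ℤ, e = 1 ∨ e = -1 → y ≡ x + e [ZMOD 4 * g] →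
      sn g (m e) * wall g (x + e) w + sn g (m e - 1) * wall g (x + 2 * g) w < 0 ∧
        wall g (x + 2 * g) w < 0 := by
    intro e he hy
    obtain ⟨h2, h3⟩ := hturn e he hy
    have h4 := hR e he
    rw [h3, wall_congr (m := x + 2 * g) (by
      convert (hy.add_right (2 * g)).sub_right e using 1; ring),
      wall_congr hy, Nat.cast_sub (by omega)] at h4
    rw [wall_congr hy] at hpos
    simp only [Nat.cast_one, sub_add_cancel] at h4
    have hm1 : (2 : ℝ) ≤ m e := by exact_mod_cast h2
    have hm2 : (m e : ℝ) ≤ 2 * g := by exact_mod_cast (hm e he).2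
    have s1 := sn_nonneg (g := g) (t := m e) (by linarith) hm2
    have s2 := sn_pos (g := g) (t := m e - 1) (by linarith) (by linarith)
    refine ⟨by linarith, ?_⟩
    by_contra hc
    push Not at hc
    nlinarith [mul_nonneg s1 hpos.le, mul_nonneg s2.le hc]
  have hneg : wall g (x + 2 * g) w < 0 := by
    by_cases h1 : y ≡ x + 1 [ZMOD 4 * g]
    · exact (turn 1 (Or.inl rfl) h1).2
    by_cases h2 : y ≡ x + -1 [ZMOD 4 * g]
    · exact (turn (-1) (Or.inr rfl) h2).2
    refine wall_neg hpos.le hxy (fun h => h1 (h.trans ?_)) (fun h => h2 (h.trans ?_))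
    · exact Int.modEq_iff_dvd.2 ⟨-1, by ring⟩
    · exact Int.modEq_iff_dvd.2 ⟨-1, by ring⟩
  refine ⟨hneg, fun e he => ?_⟩
  obtain ⟨hm1, hm2⟩ := hm e he
  by_cases h1 : y ≡ x + e [ZMOD 4 * g]
  · exact (turn e he h1).1
  by_cases h2 : y ≡ x + 2 * g + 2 * e [ZMOD 4 * g]
  · rcases hm1.eq_or_lt with hme | hme
    · have h3 := hskip e he h2 hme.symm
      have h4 := hR e he
      -- With budget `2g - 1` the second sine is `sn (2g) = 0`, so the inequality concerns wall `x +
      -- e` alone.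
      rw [h3, wall_congr (n := y + 2 * g - e) (m := x + e), Nat.cast_sub (by omega)] at h4
      · simp only [Nat.cast_one, sub_add_cancel, Nat.cast_mul, Nat.cast_ofNat, sn_two_g] at h4
        have s1 := sn_pos (g := g) (t := 2 * g - 1) (by linarith) (by linarith)
        have : wall g (x + e) w < 0 := by
          by_contra hc
          push Not at hc
          nlinarith [mul_nonneg s1.le hc]
        exact comb_neg g hm1 hm2 this hneg
      · refine ((h2.add_right (2 * g)).sub_right e).trans ?_
        exact Int.modEq_iff_dvd.2 ⟨-1, by ring⟩
    · rw [wall_congr h2] at hpos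
      exact comb_neg_of_second he x hme hm2 hpos hneg
  · exact comb_neg g hm1 hm2 (G e he h1 h2) hneg

end
end
end SurfaceLoops

/-! ### Turn budgets of reduced words and uniqueness of normal forms -/

namespace SurfaceLoops
open Real
noncomputable section
section
variable {g : ℕ} [hg : Fact (2 ≤ g)]

/-! ### The states reached by reduced words -/

/-- The word `p` ends with a piece of a relator, or of a ladder, that can be continued by at most
`m - 1` turns with step `e`. -/
def Valid (e : ℤ) (p : List (Letter g)) (m : ℕ) : Prop :=
  1 ≤ m ∧ m ≤ 2 * g ∧
  ((∃ n k, ¬ Own g e n ∧ 1 ≤ k ∧ k + m = 2 * g ∧ run e n k <:+ p) ∨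
   (∃ n s k, Own g e n ∧ (1 ≤ k ∨ s = 0) ∧ k + m = 2 * g ∧
    ladder e n s ++ run e (n + e) k <:+ p))

open Classical in
/-- The initial bound on the number of turns after the `y`-th letter. -/
def start (g : ℕ) (e y : ℤ) : ℕ := if Own g e y then 2 * g else 2 * g - 1

/-- A letter starting a forbidden half relator has already used one of its `2g` letters. Any other
letter is the first letter of a ladder with no blocks and has used nothing. -/
theorem valid_start (e y : ℤ) (p : List (Letter g)) :
    Valid e (p ++ [letter y]) (start g e y) := by
  have := hg.out
  unfold start
  split_ifs with h
  · exact ⟨by omega, le_rfl, Or.inr ⟨y, 0, 0, h, Or.inr rfl, by omega, p, by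
      simp [ladder, wpow, run_zero]⟩⟩
  · exact ⟨by omega, by omega, Or.inl ⟨y, 1, h, le_rfl, by omega, p, by rw [run_one]⟩⟩

theorem letter_eq_of_suffix {x n : ℤ} {l p : List (Letter g)}
    (h : l ++ [letter n] <:+ p ++ [letter x]) : n ≡ x [ZMOD 4 * g] := by
  obtain ⟨t, ht⟩ := h
  rw [← List.append_assoc] at ht
  exact letter_eq_iff.1 (List.append_singleton_inj.1 ht).2

theorem suffix_concat {l p : List (Letter g)} (h : l <:+ p) (a : Letter g) :
    l ++ [a] <:+ p ++ [a] := by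
  obtain ⟨t, rfl⟩ := h
  exact ⟨t, by simp⟩

/-- The last letter of a piece of a ladder. -/
theorem ladder_run_last {e n x : ℤ} {s k : ℕ} {p : List (Letter g)} (hk : 1 ≤ k ∨ s = 0)
    (h : ladder e n s ++ run e (n + e) k <:+ p ++ [letter x]) : n + e * k ≡ x [ZMOD 4 * g] := by
  rcases Nat.eq_zero_or_pos k with rfl | hk'
  · obtain rfl : s = 0 := by omega
    have : ladder e n 0 ++ run e (n + e) 0 = ([] ++ [letter n] : List (Letter g)) := by
      simp [ladder, wpow, run_zero]
    rw [this] at h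
    simpa using letter_eq_of_suffix h
  · obtain ⟨k, rfl⟩ : ∃ k', k = k' + 1 := ⟨k - 1, by omega⟩
    rw [run_concat, ← List.append_assoc] at h
    convert letter_eq_of_suffix h using 1
    push_cast; ring

theorem run_last {e n x : ℤ} {k : ℕ} {p : List (Letter g)} (hk : 1 ≤ k)
    (h : run e n k <:+ p ++ [letter x]) : n + e * k ≡ x + e [ZMOD 4 * g] := by
  obtain ⟨k, rfl⟩ : ∃ k', k = k' + 1 := ⟨k - 1, by omega⟩
  rw [run_concat] at h
  convert (letter_eq_of_suffix h).add_right e using 1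
  push_cast; ring

theorem Valid.turn {e x y : ℤ} {p : List (Letter g)} {m : ℕ}
    (h : Valid e (p ++ [letter x]) m) (hy : y ≡ x + e [ZMOD 4 * g]) (hm : 2 ≤ m) :
    Valid e (p ++ [letter x] ++ [letter y]) (m - 1) := by
  obtain ⟨h1, h2, h⟩ := h
  refine ⟨by omega, by omega, ?_⟩
  rcases h with ⟨n, k, hn, hk, hkm, hs⟩ | ⟨n, s, k, hn, hk, hkm, hs⟩
  · refine Or.inl ⟨n, k + 1, hn, by omega, by omega, ?_⟩
    rw [run_concat, letter_congr ((run_last hk hs).trans hy.symm)]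
    exact suffix_concat hs _
  · refine Or.inr ⟨n, s, k + 1, hn, by omega, by omega, ?_⟩
    have := ((ladder_run_last hk hs).add_right e).trans hy.symm
    rw [run_concat, letter_congr (n := n + e + e * k) (m := y), ← List.append_assoc]
    · exact suffix_concat hs _
    · convert this using 1; ring

theorem ladder_full (e n : ℤ) (s : ℕ) :
    (ladder e n s ++ run e (n + e) (2 * g - 1) : List (Letter g)) = ladder e n (s + 1) := by
  simp [ladder, wpow_succ]

/-- With the budget at `1`, a further turn completes either the half relator or, after a full last
block, the ladder with its closing letter `n + 2g`. -/
theorem Valid.not_turn {e x y : ℤ} {p : List (Letter g)} (he : e = 1 ∨ e = -1)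
    (h : Valid e (p ++ [letter x]) 1) (hu : IsDReduced (p ++ [letter x] ++ [letter y])) :
    ¬ y ≡ x + e [ZMOD 4 * g] := by
  have hg2 := hg.out
  have hgc : ((2 * g - 1 : ℕ) : ℤ) = 2 * g - 1 := by omega
  intro hy
  obtain ⟨h1, h2, h⟩ := h
  rcases h with ⟨n, k, hn, hk, hkm, hs⟩ | ⟨n, s, k, hn, hk, hkm, hs⟩
  · refine hu.not_infix_half he hn ?_
    rw [← hkm, run_concat, letter_congr ((run_last hk hs).trans hy.symm)]
    exact (suffix_concat hs _).isInfix
  · obtain rfl : k = 2 * g - 1 := by omega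
    have h3 := ((ladder_run_last hk hs).add_right e).trans hy.symm
    rw [ladder_full] at hs
    refine hu.not_infix_ladder he hn (s := s + 1) (by omega) ?_
    rw [letter_congr (n := n + 2 * g) (m := y)]
    · exact (suffix_concat hs _).isInfix
    · refine Int.ModEq.trans ?_ h3
      rw [hgc]
      rcases he with rfl | rfl
      · exact Int.modEq_iff_dvd.2 ⟨0, by ring⟩
      · exact Int.modEq_iff_dvd.2 ⟨-1, by ring⟩

theorem Own.congr {e n m : ℤ} (h : n ≡ m [ZMOD 4 * g]) : Own g e n ↔ Own g e m := by
  unfold Own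
  have h1 : n % (4 * g) = m % (4 * g) := h
  have h2 : (n - 1) % (4 * g) = (m - 1) % (4 * g) := h.sub_right 1
  split_ifs <;> simp only [h1, h2]

/-- After an exhausted budget the letter `x + 2g + 2e` passes to the next face. In the first case it
is congruent to the start `n` of the old half relator and starts a forbidden one again; in the
second it is the first letter `n + e` of the next block of the ladder. Either way one letter has
been used. -/
theorem Valid.skip {e x y : ℤ} {p : List (Letter g)} (he : e = 1 ∨ e = -1)
    (h : Valid e (p ++ [letter x]) 1) (hy : y ≡ x + 2 * g + 2 * e [ZMOD 4 * g]) :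
    Valid e (p ++ [letter x] ++ [letter y]) (2 * g - 1) := by
  have hg2 := hg.out
  have hgc : ((2 * g - 1 : ℕ) : ℤ) = 2 * g - 1 := by omega
  obtain ⟨h1, h2, h⟩ := h
  refine ⟨by omega, by omega, ?_⟩
  rcases h with ⟨n, k, hn, hk, hkm, hs⟩ | ⟨n, s, k, hn, hk, hkm, hs⟩
  · refine Or.inl ⟨y, 1, ?_, le_rfl, by omega, _, by rw [run_one]⟩
    obtain rfl : k = 2 * g - 1 := by omega
    have h3 := run_last hk hs
    rwa [Own.congr (m := n)]
    refine hy.trans ?_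
    have h4 := (h3.add_right (2 * g + e)).symm
    refine Int.ModEq.trans ?_ (h4.trans ?_)
    · exact Int.modEq_iff_dvd.2 ⟨0, by ring⟩
    · rw [hgc]
      rcases he with rfl | rfl
      · exact Int.modEq_iff_dvd.2 ⟨-1, by ring⟩
      · exact Int.modEq_iff_dvd.2 ⟨0, by ring⟩
  · obtain rfl : k = 2 * g - 1 := by omega
    have h3 := ladder_run_last hk hs
    rw [ladder_full] at hs
    refine Or.inr ⟨n, s + 1, 1, hn, Or.inl le_rfl, by omega, ?_⟩
    rw [run_one, letter_congr (n := n + e) (m := y)]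
    · exact suffix_concat hs _
    · have h4 := (h3.add_right (2 * g + 2 * e))
      refine Int.ModEq.trans ?_ (h4.trans ?_)
      · rw [hgc]
        rcases he with rfl | rfl
        · exact Int.modEq_iff_dvd.2 ⟨1, by ring⟩
        · exact Int.modEq_iff_dvd.2 ⟨0, by ring⟩
      · rw [← add_assoc]; exact hy.symm

/-! ### Ping-pong -/

variable (g) in
/-- The open fundamental polygon centred at `i`. -/
def polygon : Set ℍ := {z | ∀ n : ℤ, wall g n z < 0}

theorem inRegion_of_mem_polygon {x : ℤ} {m : ℤ → ℕ} {z : ℍ} (hz : z ∈ polygon g)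
    (hm : ∀ e : ℤ, e = 1 ∨ e = -1 → 1 ≤ m e ∧ m e ≤ 2 * g) : InRegion (g := g) x m z :=
  ⟨hz _, fun e he => comb_neg g (hm e he).1 (hm e he).2 (hz _) (hz _)⟩

theorem inRegion_of_isDReduced (q p : List (Letter g)) (x : ℤ) (m : ℤ → ℕ)
    (hu : IsDReduced (p ++ [letter x] ++ q))
    (hm : ∀ e : ℤ, e = 1 ∨ e = -1 → Valid e (p ++ [letter x]) (m e)) {z : ℍ}
    (hz : z ∈ polygon g) : InRegion (g := g) x m (eval q • z) := by
  classical
  induction q generalizing p x m with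
  | nil => simpa [eval] using inRegion_of_mem_polygon hz fun e he => ⟨(hm e he).1, (hm e he).2.1⟩
  | cons a q ih =>
    obtain ⟨y, rfl⟩ : ∃ y : ℤ, a = letter y := ⟨idx a, (letter_idx a).symm⟩
    have hu2 : IsDReduced (p ++ [letter x] ++ [letter y] ++ q) := by simpa using hu
    have hu1 : IsDReduced (p ++ [letter x] ++ [letter y]) := fun v w hvw hin =>
      hu2 v w hvw (hin.trans ⟨[], q, by simp⟩)
    rw [eval_cons, letterTranslation_letter, mul_smul]
    -- The three cases match `Valid.turn`, `Valid.skip` and a fresh start; they are made separately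
    -- for the two sides.
    let m' : ℤ → ℕ := fun e => if y ≡ x + e [ZMOD 4 * g] then m e - 1 else
      if y ≡ x + 2 * g + 2 * e [ZMOD 4 * g] ∧ m e = 1 then 2 * g - 1 else start g e y
    have hturn : ∀ e : ℤ, e = 1 ∨ e = -1 → y ≡ x + e [ZMOD 4 * g] → 2 ≤ m e := by
      intro e he h
      have h1 := (hm e he).1
      by_contra hc
      have h2 : m e = 1 := by omega
      have h3 := hm e he
      rw [h2] at h3
      exact h3.not_turn he hu1 h
    refine InRegion.step (m' := m') (fun e he => ⟨(hm e he).1, (hm e he).2.1⟩) ?_ ?_ ?_ ?_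
    · intro h
      refine hu1.not_infix_backtrack x ?_
      rw [← letter_congr h]
      exact ⟨p, [], by simp⟩
    · exact fun e he h => ⟨hturn e he h, if_pos h⟩
    · intro e he h h1
      have : ¬ y ≡ x + e [ZMOD 4 * g] := fun h' => by have := hturn e he h'; omega
      simp only [m', if_neg this, if_pos (And.intro h h1)]
    · refine ih (p ++ [letter x]) y m' hu2 fun e he => ?_
      simp only [m']
      split_ifs with h1 h2
      · exact (hm e he).turn h1 (hturn e he h1)
      · have h3 := hm e he
        rw [h2.2] at h3
        exact h3.skip he h2.1
      · exact valid_start _ _ _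

/-- A reduced word moves the polygon across the wall of its first letter. -/
theorem wall_pos_of_isDReduced {x : ℤ} {q : List (Letter g)} (hu : IsDReduced (letter x :: q))
    {z : ℍ} (hz : z ∈ polygon g) :
    0 < wall g x (eval (letter x :: q) • z) ∧ ∀ e : ℤ, e = 1 ∨ e = -1 → ¬ Own g e x →
      wall g (x + 2 * g - e) (eval (letter x :: q) • z) < 0 := by
  have hg2' := two_le_cast g
  have h := (inRegion_of_isDReduced q [] x (fun e => start g e x) hu
    (fun e _ => valid_start e x []) hz).trans_smul
  rw [eval_cons, letterTranslation_letter, mul_smul]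
  refine ⟨h.1, fun e he hno => ?_⟩
  have h2 := h.2 e he
  simp only [start, if_neg hno] at h2
  rw [Nat.cast_sub (by have := hg.out; omega)] at h2
  simp only [Nat.cast_one, sub_add_cancel, Nat.cast_mul, Nat.cast_ofNat, sn_two_g] at h2
  have s1 := sn_pos (g := g) (t := 2 * g - 1) (by linarith) (by linarith)
  by_contra hc
  push Not at hc
  nlinarith [mul_nonneg s1.le hc]

variable (g) in
theorem quad_I : quad UpperHalfPlane.I = (1, 0, 1) := by
  simp [quad]

theorem I_mem_polygon : UpperHalfPlane.I ∈ polygon g := by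
  intro n
  have := dee_pos g
  simp [wall, wallAt, quad_I, this]

theorem own_right {x : ℤ} : Own g 1 x ↔ (x - 1) % (4 * g) < 2 * g := by simp [Own]

theorem own_left {x : ℤ} : Own g (-1) x ↔ x % (4 * g) < 2 * g := by norm_num [Own]

theorem emod_opp_not_lt {n : ℤ} (h : n % (4 * g) < 2 * g) : ¬ (n + 2 * g) % (4 * g) < 2 * g := by
  have := hg.out
  have h0 := Int.emod_nonneg n (by omega : (4 * g : ℤ) ≠ 0)
  have e : (n + 2 * g) % (4 * g) = n % (4 * g) + 2 * g := by
    rw [Int.add_emod, Int.emod_eq_of_lt (a := 2 * g) (by omega) (by omega)]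
    exact Int.emod_eq_of_lt (by omega) (by omega)
  omega

/-- The letters `x` and `x + 2g - e` begin the two half boundaries of one face at a vertex. Exactly
one of these halves can be a leading word in each relation, so they do not both satisfy `Own`. -/
theorem not_own_adj {e x : ℤ} (he : e = 1 ∨ e = -1) (h : Own g e x) :
    ¬ Own g (-e) (x + 2 * g - e) := by
  rcases he with rfl | rfl
  · rw [own_left, show x + 2 * g - 1 = x - 1 + 2 * g by ring]
    exact emod_opp_not_lt (own_right.1 h)
  · rw [neg_neg, own_right, show x + 2 * g - -1 - 1 = x + 2 * g by ring]
    exact emod_opp_not_lt (own_left.1 h)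

/-- A common image lies behind the walls of both first letters. Distinct letters must then be
angular neighbours, and the sharper conclusion of `wall_pos_of_isDReduced` excludes whichever of
them starts a leading half relator. -/
theorem first_letter_eq {x y : ℤ} {p q : List (Letter g)} (hp : IsDReduced (letter x :: p))
    (hq : IsDReduced (letter y :: q)) {z : ℍ} (hz : z ∈ polygon g)
    (h : eval (letter x :: p) • z = eval (letter y :: q) • z) :
    (letter x : Letter g) = letter y := by
  by_contra hxy
  rw [letter_eq_iff] at hxy
  obtain ⟨hx, hx'⟩ := wall_pos_of_isDReduced hp hz
  obtain ⟨hy, hy'⟩ := wall_pos_of_isDReduced hq hz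
  rw [← h] at hy hy'
  have key : ∃ e : ℤ, (e = 1 ∨ e = -1) ∧ y ≡ x + 2 * g - e [ZMOD 4 * g] := by
    by_contra hc
    push Not at hc
    refine hx.not_gt (wall_neg hy.le (fun h => hxy h.symm) (fun h => ?_) (fun h => ?_))
    · exact hc (-1) (Or.inr rfl) (by rwa [sub_neg_eq_add])
    · exact hc 1 (Or.inl rfl) h
  obtain ⟨e, he, hye⟩ := key
  have hox : Own g e x := by
    by_contra hno
    have := hx' e he hno
    rw [← wall_congr hye] at this
    exact hy.not_gt this
  have hoy : Own g (-e) y := by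
    by_contra hno
    have := hy' (-e) (by omega) hno
    rw [wall_congr (m := x)] at this
    · exact hx.not_gt this
    · have h3 := (hye.add_right (2 * g)).sub_right (-e)
      refine h3.trans ?_
      exact Int.modEq_iff_dvd.2 ⟨-1, by ring⟩
  exact not_own_adj he hox ((Own.congr hye).1 hoy)

theorem IsDReduced.tail {a : Letter g} {q : List (Letter g)} (h : IsDReduced (a :: q)) :
    IsDReduced q := fun v w hvw hin => h v w hvw (hin.trans ⟨[a], [], by simp⟩)

/-- Reduced words are normal forms. -/
theorem eq_of_eval_smul_eq {p q : List (Letter g)} (hp : IsDReduced p) (hq : IsDReduced q)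
    {z : ℍ} (hz : z ∈ polygon g) (h : eval p • z = eval q • z) : p = q := by
  induction p generalizing q with
  | nil =>
    cases q with
    | nil => rfl
    | cons b q =>
      exfalso
      rw [← letter_idx b] at hq h
      have := (wall_pos_of_isDReduced hq hz).1
      rw [← h] at this
      simp only [eval, List.map_nil, List.prod_nil, one_smul] at this
      exact this.not_gt (hz _)
  | cons a p ih =>
    cases q with
    | nil =>
      exfalso
      rw [← letter_idx a] at hp h
      have := (wall_pos_of_isDReduced hp hz).1
      rw [h] at this
      simp only [eval, List.map_nil, List.prod_nil, one_smul] at this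
      exact this.not_gt (hz _)
    | cons b q =>
      obtain rfl : a = b := by
        rw [← letter_idx a] at hp h
        rw [← letter_idx b] at hq h
        have := first_letter_eq hp hq hz h
        rwa [letter_idx, letter_idx] at this
      rw [eval_cons, eval_cons, mul_smul, mul_smul] at h
      rw [ih hp.tail hq.tail (smul_left_cancel _ h)]

end
end
end SurfaceLoops

/-! ### Relations in the group and existence of normal forms -/

namespace SurfaceLoops
open Real
noncomputable section
section
variable {g : ℕ} [hg : Fact (2 ≤ g)]

/-! ### The relations -/

/-- The conjugating powers of `M` telescope between consecutive letters, leaving one factor `M`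
after each `Q`. -/
theorem eval_run_left (n : ℤ) (k : ℕ) :
    eval (run (-1) n k : List (Letter g)) = rotationMatrix g ^ (-(n + 1)) *
      (stretchMatrix g * rotationMatrix g) ^ k * rotationMatrix g ^ (n + 1 - k) := by
  induction k with
  | zero =>
    simp only [run_zero, eval, List.map_nil, List.prod_nil, pow_zero, mul_one, ← zpow_add]
    simp
  | succ k ih =>
    rw [run_concat, eval_append, ih, eval_cons, letterTranslation_letter, trans, pow_succ]
    simp only [eval, List.map_nil, List.prod_nil, mul_one]
    have e1 : rotationMatrix g ^ (-(n + -1 * (k : ℤ) + 1)) =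
        (rotationMatrix g ^ (n + 1 - (k : ℤ)))⁻¹ := by rw [← zpow_neg]; congr 1; ring
    have e2 : rotationMatrix g ^ (n + -1 * (k : ℤ) + 1) =
        rotationMatrix g * rotationMatrix g ^ (n + 1 - ((k + 1 : ℕ) : ℤ)) := by
      rw [← zpow_one_add]; congr 1; push_cast; ring
    rw [e1, e2]; group

theorem eval_run_right (n : ℤ) (k : ℕ) :
    eval (run 1 n k : List (Letter g)) = rotationMatrix g ^ (-(n + 1)) *
      (stretchMatrix g * (rotationMatrix g)⁻¹) ^ k * rotationMatrix g ^ (n + 1 + k) := by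
  induction k with
  | zero =>
    simp only [run_zero, eval, List.map_nil, List.prod_nil, pow_zero, mul_one, ← zpow_add]
    simp
  | succ k ih =>
    rw [run_concat, eval_append, ih, eval_cons, letterTranslation_letter, trans, pow_succ]
    simp only [eval, List.map_nil, List.prod_nil, mul_one]
    have e1 : rotationMatrix g ^ (-(n + 1 * (k : ℤ) + 1)) =
        (rotationMatrix g ^ (n + 1 + (k : ℤ)))⁻¹ := by rw [← zpow_neg]; congr 1; ring
    have e2 : rotationMatrix g ^ (n + 1 * (k : ℤ) + 1) =
        (rotationMatrix g)⁻¹ * rotationMatrix g ^ (n + 1 + ((k + 1 : ℕ) : ℤ)) := by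
      rw [← zpow_neg_one, ← zpow_add]; congr 1; push_cast; ring
    rw [e1, e2]; group

/-- Cayley–Hamilton, with the Chebyshev recurrence written in sines. -/
theorem pow_two_by_two (A : Matrix (Fin 2) (Fin 2) ℝ) (α : ℝ) (hdet : A.det = 1)
    (htr : A.trace = 2 * cos α) (n : ℕ) :
    sin α • A ^ n = sin (n * α) • A - sin (n * α - α) • (1 : Matrix (Fin 2) (Fin 2) ℝ) := by
  have hsq : A * A = (2 * cos α) • A - 1 := by
    rw [Matrix.det_fin_two] at hdet
    rw [Matrix.trace_fin_two] at htr
    ext i j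
    fin_cases i <;> fin_cases j <;> simp [Matrix.mul_apply, Fin.sum_univ_two]
    · linear_combination A 0 0 * htr - hdet
    · linear_combination A 0 1 * htr
    · linear_combination A 1 0 * htr
    · linear_combination A 1 1 * htr - hdet
  induction n with
  | zero => simp
  | succ n ih =>
    rw [pow_succ, ← smul_mul_assoc, ih, sub_mul, smul_mul_assoc, smul_mul_assoc, hsq, one_mul,
      smul_sub, smul_smul, sub_sub, add_comm, ← sub_sub, ← sub_smul]
    congr 2
    · push_cast; rw [add_mul, one_mul, sin_add, sin_sub]; ring
    · push_cast; congr 1; ring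

/-- The trace of `QM` is `2 cos (β / 2)`, so `QM` is elliptic and its `4g`-th power corresponds to
the angle `4g · β / 2 = π`. This is the cycle condition at the vertices of the polygon. -/
theorem stretch_mul_rotation_pow :
    (stretchMatrix g * rotationMatrix g) ^ (4 * g) = -1 := by
  have hb := two_g_mul_beta g
  have hs := sin_half_pos g
  have ha : cos (angle g) = sin (beta g / 2) := by
    have : angle g = π / 2 - beta g / 2 := by linarith [angle_eq g]
    rw [this, cos_pi_div_two_sub]
  have h := pow_two_by_two ((stretchMatrix g * rotationMatrix g : SL(2, ℝ)) :
    Matrix (Fin 2) (Fin 2) ℝ) (beta g / 2) (Matrix.SpecialLinearGroup.det_coe _) (by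
      obtain ⟨k1, k2, k3, k4⟩ := stretchMatrix_apply g
      obtain ⟨h1, h2, h3, h4⟩ := rotationMatrix_apply g
      rw [Matrix.SpecialLinearGroup.coe_mul, Matrix.trace_fin_two, Matrix.mul_apply,
        Matrix.mul_apply, Fin.sum_univ_two, Fin.sum_univ_two, k1, k2, k3, k4, h1, h2, h3, h4,
        stretch_inv, stretch_eq, ha]
      change _ = 2 * chi g
      field_simp; ring) (4 * g)
  have e : ((4 * g : ℕ) : ℝ) * (beta g / 2) = π := by push_cast; linarith
  rw [e, sin_pi, zero_smul, zero_sub, sin_pi_sub, ← smul_neg] at h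
  apply Subtype.ext
  rw [Matrix.SpecialLinearGroup.coe_pow, Matrix.SpecialLinearGroup.coe_neg,
    Matrix.SpecialLinearGroup.coe_one]
  exact smul_right_injective _ hs.ne' h

/-- The two halves of the boundary of a face. -/
theorem eval_run_left_eq (n : ℤ) :
    eval (run (-1) n (2 * g) : List (Letter g)) =
      eval (run 1 (n + 2 * g + 1) (2 * g) : List (Letter g)) := by
  have hJ := half_turn_mul_stretch g
  have hJ2 := half_turn_sq g
  have hA := stretch_mul_rotation_pow (g := g)
  rw [eval_run_left, eval_run_right]
  set M := rotationMatrix g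
  set Q := stretchMatrix g
  set J := M ^ (2 * g) with hJdef
  have hJM : M * J = J * M := (Commute.refl M).pow_right _
  have e1 : M ^ (n + 1 - ((2 * g : ℕ) : ℤ)) = J⁻¹ * M ^ (n + 1) := by
    rw [hJdef, ← zpow_natCast, ← zpow_neg, ← zpow_add]; congr 1; ring
  have e2 : M ^ (-(n + 2 * (g : ℤ) + 1 + 1)) = M ^ (-(n + 1)) * (J⁻¹ * M⁻¹) := by
    rw [hJdef, ← zpow_natCast, ← zpow_neg, ← zpow_neg_one, ← zpow_add, ← zpow_add]; congr 1
    push_cast; ring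
  have e3 : M ^ (n + 2 * (g : ℤ) + 1 + 1 + ((2 * g : ℕ) : ℤ)) = J * (J * M) * M ^ (n + 1) := by
    rw [hJdef, ← zpow_natCast, ← zpow_add_one, ← zpow_add, ← zpow_add]; congr 1
    push_cast; ring
  rw [e1, e2, e3]
  -- The half turn inverts `Q`, which makes the right-turning product a conjugate of the inverse of
  -- the left-turning one. The signs from `J² = -1` and `X² = -1` then cancel.
  have hB : Q * M⁻¹ = (J⁻¹ * M) * (Q * M)⁻¹ * (J⁻¹ * M)⁻¹ := by
    have : Q = J⁻¹ * (Q⁻¹ * J) := by rw [← hJ, inv_mul_cancel_left]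
    calc Q * M⁻¹ = J⁻¹ * (Q⁻¹ * J) * M⁻¹ := by rw [← this]
      _ = J⁻¹ * Q⁻¹ * (J * M⁻¹) := by group
      _ = J⁻¹ * Q⁻¹ * (M⁻¹ * J) := by
        congr 1
        rw [mul_inv_eq_iff_eq_mul, mul_assoc, ← hJM, inv_mul_cancel_left]
      _ = _ := by group
  rw [hB, conj_pow, inv_pow]
  have hA' : (Q * M) ^ (2 * g) * (Q * M) ^ (2 * g) = -1 := by
    rw [← pow_add, ← hA]; congr 1; ring
  set X := (Q * M) ^ (2 * g)
  have hX : X⁻¹ = -X := by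
    rw [inv_eq_iff_mul_eq_one, mul_neg, hA', neg_neg]
  have hJJ : J * J = -1 := by rw [← sq, hJ2]
  have hJi : J⁻¹ = -J := by
    rw [inv_eq_iff_mul_eq_one, mul_neg, hJJ, neg_neg]
  have a1 : J⁻¹ * M⁻¹ * (J⁻¹ * M) = -1 := by
    rw [mul_assoc, hJi, neg_mul J M, ← hJM, mul_neg, inv_mul_cancel_left, neg_mul_neg, hJJ]
  have a2 : (J⁻¹ * M)⁻¹ * (J * (J * M)) = -J := by
    rw [← mul_assoc J, hJJ, mul_inv_rev, inv_inv, neg_mul, one_mul, mul_neg, mul_assoc, ← hJM,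
      inv_mul_cancel_left]
  calc _ = M ^ (-(n + 1)) * (X * J⁻¹) * M ^ (n + 1) := by group
    _ = M ^ (-(n + 1)) * (J⁻¹ * M⁻¹ * (J⁻¹ * M) * X⁻¹ * ((J⁻¹ * M)⁻¹ * (J * (J * M)))) *
        M ^ (n + 1) := by
      rw [a1, a2, hX, hJi]; simp
    _ = _ := by simp only [mul_assoc]

/-- The weight of a letter; leading words have the larger first letter. -/
def weight (a : Letter g) : ℕ := (if idx a < 2 * g then 2 * g - idx a else idx a + 1).toNat

theorem weight_letter {n : ℤ} (h0 : 0 ≤ n) (h1 : n < 4 * g) :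
    weight (letter n : Letter g) = (if n < 2 * g then 2 * g - n else n + 1).toNat := by
  rw [weight, idx_letter, Int.emod_eq_of_lt h0 h1]

theorem eval_wpow (w : List (Letter g)) (s : ℕ) : eval (wpow w s) = eval w ^ s := by
  induction s with
  | zero => simp [wpow, eval]
  | succ s ih => rw [wpow_succ, eval_append, ih, pow_succ]

/-- The ladder relations for all `s` are powers of one conjugation relation, itself an equality of
half relators. -/
theorem eval_conj (j : Fin (2 * g)) (w w' : List (Letter g)) (s : ℕ)
    (h : eval ((j, true) :: w) = eval (w' ++ [(j, true)])) :
    eval ((j, true) :: (wpow w s ++ [(j, false)])) = eval (wpow w' s) := by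
  rw [eval_cons, eval_append] at h
  rw [eval_cons, eval_append, eval_wpow, eval_wpow]
  simp only [eval, List.map_cons, List.map_nil, List.prod_cons, List.prod_nil, mul_one] at h ⊢
  have e : letterTranslation g (j, false) = (letterTranslation g (j, true))⁻¹ := by
    simp [letterTranslation]
  rw [e, ← mul_assoc, ← conj_pow, h, mul_inv_cancel_right]

theorem Basis.eval_eq {v w : List (Letter g)} (h : Basis g v w) : eval v = eval w := by
  have hg2 := hg.out
  have hgc : ((2 * g - 1 : ℕ) : ℤ) = 2 * g - 1 := by omega
  have h1 : 2 * g = (2 * g - 1) + 1 := by omega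
  cases h with
  | d1 j s hj hs =>
    apply eval_conj
    rw [pos_below_neg_above_reverse, neg_above_pos_below, letter_pos]
    have e1 : letter (j : ℕ) :: run (-1) ((j : ℕ) - 1) (2 * g - 1) =
      (run (-1) (j : ℕ) (2 * g) : List (Letter g)) := by
      conv_rhs => rw [run_split (-1) _ (h1.trans (add_comm _ _)), run_one]
      simp [sub_eq_add_neg]
    have e2 : run 1 ((j : ℕ) + 2 * g + 1) (2 * g - 1) ++ [letter (j : ℕ)] =
      (run 1 ((j : ℕ) + 2 * g + 1) (2 * g) : List (Letter g)) := by
      conv_rhs => rw [run_split 1 _ h1, run_one]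
      congr 2; apply letter_congr
      rw [hgc]; exact Int.modEq_iff_dvd.2 ⟨1, by ring⟩
    rw [e1, e2, eval_run_left_eq]
  | d2 j s hj hs =>
    apply eval_conj
    rw [pos_above_neg_below, neg_below_pos_above_reverse, letter_pos]
    have e1 : letter (j : ℕ) :: run 1 ((j : ℕ) + 1) (2 * g - 1) =
      (run 1 (j : ℕ) (2 * g) : List (Letter g)) := by
      conv_rhs => rw [run_split 1 _ (h1.trans (add_comm _ _)), run_one]
      simp
    have e2 : run (-1) ((j : ℕ) + 2 * g - 1) (2 * g - 1) ++ [letter (j : ℕ)] =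
      (run (-1) ((j : ℕ) + 2 * g - 1) (2 * g) : List (Letter g)) := by
      conv_rhs => rw [run_split (-1) _ h1, run_one]
      congr 3
      rw [hgc]; ring
    rw [e1, e2, eval_run_left_eq]
    congr 1
    exact run_congr _ (Int.modEq_iff_dvd.2 ⟨1, by ring⟩) _
  | d3 =>
    rw [neg_all_reverse, neg_all, eval_run_left_eq]
    congr 1
    exact run_congr _ (Int.modEq_iff_dvd.2 ⟨-1, by ring⟩) _
  | d4 =>
    rw [pos_all, pos_all_reverse, eval_run_left_eq]
    congr 1
    exact run_congr _ (Int.modEq_iff_dvd.2 ⟨1, by ring⟩) _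
  | d5 i hi =>
    rw [neg_atLeast_pos_below, pos_below_neg_atLeast_reverse, eval_run_left_eq]
    congr 2; ring
  | d6 i hi =>
    rw [neg_below_pos_atLeast_reverse, pos_atLeast_neg_below, eval_run_left_eq]
    congr 1
    exact run_congr _ (Int.modEq_iff_dvd.2 ⟨-1, by ring⟩) _
  | d7 i => simp [eval, letterTranslation]
  | d8 i => simp [eval, letterTranslation]

theorem wpow_length (w : List (Letter g)) (s : ℕ) : (wpow w s).length = s * w.length := by
  simp [wpow]

/-- A leading word is larger than the other word of its binomial. -/
theorem Basis.decreasing {v w : List (Letter g)} (h : Basis g v w) :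
    w.length < v.length ∨ w.length = v.length ∧
      ∃ a b v' w', v = a :: v' ∧ w = b :: w' ∧ weight b < weight a := by
  have hg2 := hg.out
  have h1 : 2 * g = 1 + (2 * g - 1) := by omega
  have key : ∀ e e' n n' : ℤ, 0 ≤ n → n < 4 * g → 0 ≤ n' → n' < 4 * g →
      (if n' < 2 * g then 2 * g - n' else n' + 1).toNat <
        (if n < 2 * g then 2 * g - n else n + 1).toNat →
      ((run e' n' (2 * g) : List (Letter g)).length = (run e n (2 * g) : List (Letter g)).length ∧
      ∃ a b v' w', (run e n (2 * g) : List (Letter g)) = a :: v' ∧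
        (run e' n' (2 * g) : List (Letter g)) = b :: w' ∧ weight b < weight a) := by
    intro e e' n n' a1 a2 a3 a4 hw
    refine ⟨by simp [run_length], (letter n : Letter g), (letter n' : Letter g), _, _,
      (run_split (g := g) e n h1).trans (by rw [run_one]; rfl),
      (run_split (g := g) e' n' h1).trans (by rw [run_one]; rfl), ?_⟩
    rwa [weight_letter a1 a2, weight_letter a3 a4]
  cases h with
  | d1 j s hj hs =>
    left
    rw [pos_below_neg_above_reverse, neg_above_pos_below]
    simp [wpow_length, run_length]
  | d2 j s hj hs =>
    left
    rw [neg_below_pos_above_reverse, pos_above_neg_below]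
    simp [wpow_length, run_length]
  | d3 =>
    right
    rw [neg_all_reverse, neg_all]
    refine key _ _ _ _ ?_ ?_ ?_ ?_ ?_ <;> [skip; skip; skip; skip; split_ifs] <;> omega
  | d4 =>
    right
    rw [pos_all, pos_all_reverse]
    refine key _ _ _ _ ?_ ?_ ?_ ?_ ?_ <;> [skip; skip; skip; skip; split_ifs] <;> omega
  | d5 i hi =>
    right
    rw [neg_atLeast_pos_below, pos_below_neg_atLeast_reverse]
    refine key _ _ _ _ ?_ ?_ ?_ ?_ ?_ <;> [skip; skip; skip; skip; split_ifs] <;> omega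
  | d6 i hi =>
    right
    rw [neg_below_pos_atLeast_reverse, pos_atLeast_neg_below]
    refine key _ _ _ _ ?_ ?_ ?_ ?_ ?_ <;> [skip; skip; skip; skip; split_ifs] <;> omega
  | d7 i => left; simp
  | d8 i => left; simp

/-- Every element of the subgroup generated by the translations is represented by a reduced
word. -/
theorem exists_isDReduced_of_eval (u : List (Letter g)) :
    ∃ w : List (Letter g), IsDReduced w ∧ eval w = eval u := by
  let r : Letter g → Letter g → Prop := fun a b => weight a < weight b
  -- Rewriting a leading word shortens the word or lowers its weight at the first changed position,
  -- so the length-lexicographic order makes reduction terminate.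
  have wf : WellFounded (List.Shortlex r) :=
    List.Shortlex.wf (InvImage.wf weight (wellFounded_lt (α := ℕ)))
  induction u using wf.induction with
  | h u ih =>
    by_cases hu : IsDReduced u
    · exact ⟨u, hu, rfl⟩
    · simp only [IsDReduced, not_forall, not_not] at hu
      obtain ⟨v, w, hvw, s, t, rfl⟩ := hu
      obtain ⟨x, hx, hxe⟩ := ih (s ++ w ++ t) (by
        rcases hvw.decreasing with h | ⟨h, a, b, v', w', rfl, rfl, hab⟩
        · exact List.Shortlex.of_length_lt (by simp; omega)
        · refine List.Shortlex.of_lex (by simp at h ⊢; omega) ?_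
          simp only [List.append_assoc, List.cons_append]
          exact List.Lex.append_left r (List.Lex.rel hab) s)
      refine ⟨x, hx, hxe.trans ?_⟩
      rw [eval_append, eval_append, eval_append, eval_append, hvw.eval_eq]

/-- The formal inverse of a word. -/
def invWord (u : List (Letter g)) : List (Letter g) := (u.map fun a => (a.1, !a.2)).reverse

theorem eval_invWord (u : List (Letter g)) : eval (invWord u) = (eval u)⁻¹ := by
  induction u with
  | nil => simp [eval, invWord]
  | cons a u ih =>
    have : invWord (a :: u) = invWord u ++ [(a.1, !a.2)] := by simp [invWord]
    rw [this, eval_append, ih, eval_cons a, mul_inv_rev]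
    congr 1
    obtain ⟨j, b⟩ := a
    cases b <;> simp [eval, letterTranslation]

theorem exists_isDReduced_of_mem {γ : SL(2, ℝ)} (hγ : γ ∈ Gam g) :
    ∃ w : List (Letter g), IsDReduced w ∧ eval w = γ := by
  suffices ∃ u : List (Letter g), eval u = γ by
    obtain ⟨u, rfl⟩ := this
    exact exists_isDReduced_of_eval u
  induction hγ using Subgroup.closure_induction with
  | mem x hx =>
    obtain ⟨j, rfl⟩ := hx
    exact ⟨[(j, true)], by simp [eval, letterTranslation]⟩
  | one => exact ⟨[], by simp [eval]⟩
  | mul x y _ _ hx hy =>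
    obtain ⟨u, rfl⟩ := hx
    obtain ⟨v, rfl⟩ := hy
    exact ⟨u ++ v, eval_append u v⟩
  | inv x _ hx =>
    obtain ⟨u, rfl⟩ := hx
    exact ⟨invWord u, eval_invWord u⟩

theorem letterTranslation_mem (a : Letter g) : letterTranslation g a ∈ Gam g := by
  have : delta g a.1 ∈ Gam g := Subgroup.subset_closure ⟨_, rfl⟩
  unfold letterTranslation
  split_ifs
  · exact this
  · exact inv_mem this

/-- The group acts freely on the orbits of the points of the polygon. -/
theorem eq_one_of_smul_eq {γ : SL(2, ℝ)} (hγ : γ ∈ Gam g) {z : ℍ} (hz : z ∈ polygon g)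
    (h : γ • z = z) : γ = 1 := by
  obtain ⟨w, hw, rfl⟩ := exists_isDReduced_of_mem hγ
  have hnil : IsDReduced ([] : List (Letter g)) := by
    intro v w hvw hin
    rw [List.infix_nil] at hin
    rcases hvw.decreasing with h | ⟨-, a, b, v', w', h, -⟩
    · simp [hin] at h
    · simp [hin] at h
  have := eq_of_eval_smul_eq hw hnil hz (by simpa [eval] using h)
  rw [this]; simp [eval]

end
end
end SurfaceLoops

/-! ### The embedded Cayley graph and the action along it -/

namespace SurfaceLoops
open Real
noncomputable section
section
variable {g : ℕ} [hg : Fact (2 ≤ g)]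

/-! ### The edges of the Cayley graph -/

variable (g) in
/-- The unit-speed parametrization, up to a constant, of the imaginary axis. -/
def ray (t : ℝ) : ℍ := ⟨⟨0, exp (2 * t * log (stretch g))⟩, exp_pos _⟩

variable (g) in
/-- The parametrization of the edge from `i` to `trans g n • i`. -/
def edge (n : ℤ) (t : ℝ) : ℍ := (rotationMatrix g ^ (n + 1))⁻¹ • ray g t

theorem ray_re (t : ℝ) : (ray g t).re = 0 := rfl

theorem ray_im (t : ℝ) : (ray g t).im = exp (2 * t * log (stretch g)) := rfl

theorem log_stretch_pos : 0 < log (stretch g) := log_pos (one_lt_stretch g)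

theorem ray_zero : ray g 0 = UpperHalfPlane.I := by
  apply UpperHalfPlane.ext_re_im <;> simp [ray_re, ray_im]

theorem stretch_inv_smul_ray (t : ℝ) : (stretchMatrix g)⁻¹ • ray g t = ray g (t - 1) := by
  obtain ⟨h1, h2, h3, h4⟩ := stretchMatrix_inv_apply g
  obtain ⟨k1, k2, -⟩ := im_smul_SL (stretchMatrix g)⁻¹ (ray g t)
  have hs := stretch_pos g
  apply UpperHalfPlane.ext_re_im
  · rw [k2, h1, h2, h3, h4]; simp [ray_re]
  · rw [k1, h3, h4, ray_re, ray_im, ray_im]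
    have e : 2 * (t - 1) * log (stretch g) = 2 * t * log (stretch g) - 2 * log (stretch g) := by
      ring
    rw [e, exp_sub, two_mul (log (stretch g)), exp_add, exp_log hs]
    simp [sq]

theorem half_turn_inv_smul_ray (t : ℝ) :
    (rotationMatrix g ^ (2 * g))⁻¹ • ray g t = ray g (-t) := by
  rw [inv_smul_eq_iff]
  obtain ⟨s, hs1, hs⟩ := half_turn_apply g
  obtain ⟨k1, k2, -⟩ := im_smul_SL (rotationMatrix g ^ (2 * g)) (ray g (-t))
  have e00 : (rotationMatrix g ^ (2 * g) : SL(2, ℝ)) 0 0 = 0 := by rw [hs]; rfl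
  have e01 : (rotationMatrix g ^ (2 * g) : SL(2, ℝ)) 0 1 = s := by rw [hs]; rfl
  have e10 : (rotationMatrix g ^ (2 * g) : SL(2, ℝ)) 1 0 = -s := by rw [hs]; rfl
  have e11 : (rotationMatrix g ^ (2 * g) : SL(2, ℝ)) 1 1 = 0 := by rw [hs]; rfl
  apply UpperHalfPlane.ext_re_im
  · rw [k2, e00, e01, e10, e11]; simp [ray_re]
  · rw [k1, e10, e11, ray_re, ray_im, ray_im]
    have e : 2 * -t * log (stretch g) = -(2 * t * log (stretch g)) := by ring
    rw [e, exp_neg]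
    have := exp_pos (2 * t * log (stretch g))
    simp only [mul_zero, add_zero, mul_pow, neg_sq, hs1]
    field_simp; simp

theorem rotation_smul_I : rotationMatrix g • UpperHalfPlane.I = UpperHalfPlane.I := by
  obtain ⟨h1, h2, h3, h4⟩ := rotationMatrix_apply g
  obtain ⟨k1, k2, -⟩ := im_smul_SL (rotationMatrix g) UpperHalfPlane.I
  have hs := sin_sq_add_cos_sq (angle g)
  have hs' : cos (angle g) ^ 2 + sin (angle g) ^ 2 = 1 := by linarith
  apply UpperHalfPlane.ext_re_im
  · rw [k2, h1, h2, h3, h4]; simp [mul_comm]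
  · rw [k1, h3, h4]; simp [hs']

theorem rotation_zpow_smul_I (n : ℤ) :
    rotationMatrix g ^ n • UpperHalfPlane.I = UpperHalfPlane.I :=
  (MulAction.stabilizer SL(2, ℝ) UpperHalfPlane.I).zpow_mem
    (MulAction.mem_stabilizer_iff.2 rotation_smul_I) n

theorem edge_zero (n : ℤ) : edge g n 0 = UpperHalfPlane.I := by
  rw [edge, ray_zero, ← zpow_neg, rotation_zpow_smul_I]

theorem edge_opp (n : ℤ) (t : ℝ) : edge g (n + 2 * g) t = (trans g n)⁻¹ • edge g n (1 - t) := by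
  have e : (trans g n)⁻¹ = (rotationMatrix g ^ (n + 1))⁻¹ * ((stretchMatrix g)⁻¹ *
      rotationMatrix g ^ (n + 1)) := by
    unfold trans; group
  have e2 : rotationMatrix g ^ (n + 2 * g + 1) =
      rotationMatrix g ^ (2 * g) * rotationMatrix g ^ (n + 1) := by
    rw [← zpow_natCast, ← zpow_add]; congr 1; push_cast; ring
  rw [edge, edge, e, e2, mul_inv_rev, mul_smul, mul_smul, mul_smul, smul_inv_smul,
    stretch_inv_smul_ray, half_turn_inv_smul_ray]
  congr 2; ring

theorem edge_congr {n m : ℤ} (h : n ≡ m [ZMOD 4 * g]) (t : ℝ) : edge g n t = edge g m t := by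
  have per : ∀ n : ℤ, edge g (n + 4 * g) t = edge g n t := fun n => by
    rw [show n + 4 * g = n + 2 * g + 2 * g by ring, edge_opp, edge_opp, trans_opp, inv_inv,
      smul_inv_smul]
    congr 1; ring
  obtain ⟨k, hk⟩ := h.dvd
  have : m = n + k * (4 * g) := by linarith
  rw [this]
  exact ((Function.Periodic.int_mul (f := fun n => edge g n t) per k) n).symm

theorem edge_one (n : ℤ) : edge g n 1 = trans g n • UpperHalfPlane.I := by
  have := edge_opp (g := g) n 0
  rw [edge_zero, sub_zero] at this
  rw [this, smul_inv_smul]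

theorem trans_smul_edge_opp (n : ℤ) (t : ℝ) :
    trans g n • edge g (n + 2 * g) t = edge g n (1 - t) := by
  rw [edge_opp, smul_inv_smul]

theorem continuous_ray : Continuous (ray g) := by
  rw [UpperHalfPlane.isEmbedding_coe.continuous_iff]
  have : (UpperHalfPlane.coe ∘ ray g) = fun t : ℝ =>
      ((exp (2 * t * log (stretch g)) : ℝ) : ℂ) * Complex.I := by
    ext t
    apply Complex.ext
    · rw [Complex.re_ofReal_mul]; simp [ray]
    · rw [Complex.im_ofReal_mul]; simp [ray]
  rw [this]
  fun_prop

theorem continuous_edge (n : ℤ) : Continuous (edge g n) :=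
  continuous_ray.const_smul _

theorem continuous_quad : Continuous quad := by
  unfold quad
  have h1 := UpperHalfPlane.continuous_re
  have h2 := UpperHalfPlane.continuous_im
  have h3 : ∀ z : ℍ, z.im ≠ 0 := fun z => z.im_ne_zero
  exact ((h1.pow 2 |>.add (h2.pow 2)).div h2 h3).prodMk
    ((h1.div h2 h3).prodMk (continuous_const.div h2 h3))

theorem continuous_wall (n : ℤ) : Continuous (wall g n) := by
  have h1 : Continuous fun z => (quad z).1 := continuous_quad.fst
  have h2 : Continuous fun z => (quad z).2.1 := continuous_quad.snd.fst
  have h3 : Continuous fun z => (quad z).2.2 := continuous_quad.snd.snd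
  exact (continuous_const.mul ((((h1.sub h3).div_const 2).mul continuous_const).add
    (h2.mul continuous_const))).sub (continuous_const.mul ((h1.add h3).div_const 2))

theorem quad_ray (t : ℝ) : quad (ray g t) =
    (exp (2 * t * log (stretch g)), 0, (exp (2 * t * log (stretch g)))⁻¹) := by
  have := exp_pos (2 * t * log (stretch g))
  simp only [quad, ray_re, ray_im]
  refine Prod.ext ?_ (Prod.ext ?_ ?_)
  · simp only; field_simp; ring
  · simp
  · simp

theorem wall_edge (l n : ℤ) (t : ℝ) :
    wall g l (edge g n t) = chi g * ((exp (2 * t * log (stretch g)) -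
      (exp (2 * t * log (stretch g)))⁻¹) / 2 *
        cos ((l + 1) * (π - beta g) - (n + 1) * (π - beta g))) -
      dee g * ((exp (2 * t * log (stretch g)) + (exp (2 * t * log (stretch g)))⁻¹) / 2) := by
  rw [wall, edge, ← zpow_neg, wallAt_rotation_zpow, wallAt, quad_ray]
  simp only [zero_mul, add_zero]
  congr 4
  push_cast; ring

theorem one_le_exp_ray {t : ℝ} (ht : 0 ≤ t) : 1 ≤ exp (2 * t * log (stretch g)) := by
  have := log_stretch_pos (g := g)
  exact one_le_exp (by positivity)

theorem cos_letter_angle_le {l n : ℤ} (h : ¬ l ≡ n [ZMOD 4 * g]) :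
    cos ((l + 1) * (π - beta g) - (n + 1) * (π - beta g)) ≤ cos (beta g) := by
  have hg2 := hg.out
  rw [cos_letter_angle_emod]
  have hl := Int.emod_nonneg (l - n) (by omega : (4 * g : ℤ) ≠ 0)
  have hu := Int.emod_lt_of_pos (l - n) (by omega : (0 : ℤ) < 4 * g)
  have h0 : (l - n) % (4 * g) ≠ 0 := by
    intro h0
    exact h (Int.modEq_iff_dvd.2 (by
      rw [← neg_sub, dvd_neg]; exact Int.dvd_of_emod_eq_zero h0))
  set d := (l - n) % (4 * g)
  have := cos_letter_angle (g := g) hl hu (k := 1) (by norm_num)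
    (by rintro -; push_cast; omega)
    (by intro ho; rw [Int.not_even_iff] at ho; rw [le_abs]; push_cast; omega)
  simpa using this

theorem wall_edge_neg {l n : ℤ} (h : ¬ l ≡ n [ZMOD 4 * g]) {t : ℝ} (ht : 0 ≤ t) :
    wall g l (edge g n t) < 0 := by
  have hc := cos_letter_angle_le h
  rw [wall_edge]
  rw [← dee_sq] at hc
  set c := cos ((l + 1) * (π - beta g) - (n + 1) * (π - beta g))
  have hy := one_le_exp_ray (g := g) ht
  set y := exp (2 * t * log (stretch g))
  have hd := dee_pos g
  have hd1 := dee_lt_one g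
  have hx := chi_pos g
  have hx1 := chi_lt_one g
  have hy' : 0 < y⁻¹ := by positivity
  have hyi : y⁻¹ ≤ 1 := inv_le_one_of_one_le₀ hy
  have h1 : chi g * ((y - y⁻¹) / 2 * c) ≤ chi g * ((y - y⁻¹) / 2 * dee g ^ 2) := by
    apply mul_le_mul_of_nonneg_left _ hx.le
    exact mul_le_mul_of_nonneg_left hc (by linarith)
  have h2 : chi g * ((y - y⁻¹) / 2 * dee g ^ 2) ≤ dee g * ((y - y⁻¹) / 2) := by
    have h3 : chi g * dee g ≤ 1 := by nlinarith
    have h4 : 0 ≤ dee g * ((y - y⁻¹) / 2) := mul_nonneg hd.le (by linarith)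
    nlinarith [mul_le_mul_of_nonneg_right h3 h4]
  nlinarith

/-- The factorization locates the crossing of the wall at the midpoint, where the exponential equals
`λ_g`. -/
theorem wall_edge_self (n : ℤ) (t : ℝ) :
    2 * exp (2 * t * log (stretch g)) * wall g n (edge g n t) =
      (chi g - dee g) * (exp (2 * t * log (stretch g)) ^ 2 - stretch g ^ 2) := by
  have h := stretch_sq g
  rw [wall_edge, sub_self, cos_zero]
  have := exp_pos (2 * t * log (stretch g))
  field_simp
  linear_combination h

theorem wall_edge_self_neg (n : ℤ) {t : ℝ} (ht : t < 1 / 2) : wall g n (edge g n t) < 0 := by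
  have h := wall_edge_self (g := g) n t
  have hl := log_stretch_pos (g := g)
  have h1 : exp (2 * t * log (stretch g)) < stretch g := by
    conv_rhs => rw [← exp_log (stretch_pos g)]
    exact exp_lt_exp.2 (by nlinarith)
  have h0 := exp_pos (2 * t * log (stretch g))
  have hd := dee_lt_chi g
  by_contra hc
  push Not at hc
  have h2 : exp (2 * t * log (stretch g)) ^ 2 < stretch g ^ 2 := by gcongr
  nlinarith [mul_nonneg h0.le hc]

theorem edge_mem_polygon (n : ℤ) {t : ℝ} (h0 : 0 ≤ t) (h1 : t < 1 / 2) :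
    edge g n t ∈ polygon g := by
  intro l
  by_cases h : l ≡ n [ZMOD 4 * g]
  · rw [wall_congr h]; exact wall_edge_self_neg n h1
  · exact wall_edge_neg h h0

/-- The midpoint is on the boundary of the polygon; it is reached by taking closures, at the price
of a weak inequality. -/
theorem wall_nonneg_of_isDReduced {x : ℤ} {q : List (Letter g)} (hu : IsDReduced (letter x :: q))
    (n : ℤ) {t : ℝ} (h0 : 0 ≤ t) (h1 : t ≤ 1 / 2) :
    0 ≤ wall g x (eval (letter x :: q) • edge g n t) := by
  have hc : IsClosed {s : ℝ | 0 ≤ wall g x (eval (letter x :: q) • edge g n s)} :=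
    isClosed_le continuous_const
      ((continuous_wall x).comp ((continuous_edge n).const_smul (eval (letter x :: q))))
  have hsub : Set.Ico (0 : ℝ) (1 / 2) ⊆ _ := fun s hs =>
    (wall_pos_of_isDReduced hu (edge_mem_polygon n hs.1 hs.2)).1.le
  have := closure_minimal (t := {s : ℝ | 0 ≤ wall g x (eval (letter x :: q) • edge g n s)}) hsub hc
  rw [closure_Ico (by norm_num)] at this
  exact this ⟨h0, h1⟩

/-! ### Intersections of edges -/

/-- The distance to `i` determines the parameter, and away from `i` the value of the wall of `x`
determines the direction. -/
theorem edge_eq_edge {x y : ℤ} {s t : ℝ} (hs : 0 ≤ s) (ht : 0 ≤ t)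
    (h : edge g x s = edge g y t) : s = t ∧ (s = 0 ∨ x ≡ y [ZMOD 4 * g]) := by
  have hl := log_stretch_pos (g := g)
  have hdist : ∀ (n : ℤ) (r : ℝ), 0 ≤ r → dist (edge g n r) UpperHalfPlane.I =
      2 * r * log (stretch g) := by
    intro n r hr
    have e : UpperHalfPlane.I = (rotationMatrix g ^ (n + 1))⁻¹ • ray g 0 := by
      rw [← edge, edge_zero]
    rw [e, edge, dist_smul, UpperHalfPlane.dist_of_re_eq (by rw [ray_re, ray_re]), ray_im, ray_im,
      log_exp, log_exp, Real.dist_eq]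
    simp
    have := abs_of_nonneg (by positivity : 0 ≤ 2 * r * log (stretch g))
    simpa using this
  have hst : s = t := by
    have h1 := hdist x s hs
    rw [h, hdist y t ht] at h1
    nlinarith
  refine ⟨hst, ?_⟩
  subst hst
  by_contra hc
  push Not at hc
  have h1 := wall_edge (g := g) x x s
  have h2 := wall_edge (g := g) x y s
  rw [h, h2, sub_self, cos_zero] at h1
  have h3 := cos_letter_angle_le hc.2
  have h4 := cos_beta_lt_one g
  have hpos : 0 < s := lt_of_le_of_ne hs (Ne.symm hc.1)
  have hy : 1 < exp (2 * s * log (stretch g)) := one_lt_exp_iff.2 (by positivity)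
  have hyi : (exp (2 * s * log (stretch g)))⁻¹ < 1 := inv_lt_one_of_one_lt₀ hy
  have hx := chi_pos g
  have h5 : 0 < chi g * ((exp (2 * s * log (stretch g)) -
      (exp (2 * s * log (stretch g)))⁻¹) / 2) := mul_pos hx (by linarith)
  nlinarith

/-- Half-edges meet only in the obvious way. -/
theorem smul_edge_eq_edge {γ : SL(2, ℝ)} (hγ : γ ∈ Gam g) {x y : ℤ} {s t : ℝ} (hs : 0 ≤ s)
    (hs' : s ≤ 1 / 2) (ht : 0 ≤ t) (ht' : t ≤ 1 / 2) (h : γ • edge g x s = edge g y t) :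
    s = t ∧ ((γ = 1 ∧ (s = 0 ∨ x ≡ y [ZMOD 4 * g])) ∨
      (γ = trans g y ∧ s = 1 / 2 ∧ x ≡ y + 2 * g [ZMOD 4 * g])) := by
  obtain ⟨w, hw, rfl⟩ := exists_isDReduced_of_mem hγ
  rcases w with _ | ⟨a, w⟩
  · simp only [eval, List.map_nil, List.prod_nil, one_smul] at h ⊢
    obtain ⟨h1, h2⟩ := edge_eq_edge hs ht h
    exact ⟨h1, Or.inl ⟨trivial, h2⟩⟩
  obtain ⟨n, rfl⟩ : ∃ n : ℤ, a = letter n := ⟨idx a, (letter_idx a).symm⟩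
  -- A nonempty reduced word moves the half-edge behind the wall of its first letter. The target
  -- half-edge meets that wall only at its midpoint and only for the letter `y`; a second letter
  -- would have to undo the first.
  have h1 := wall_nonneg_of_isDReduced hw x hs hs'
  rw [h] at h1
  have hn : n ≡ y [ZMOD 4 * g] := by
    by_contra hc
    exact h1.not_gt (wall_edge_neg hc ht)
  have ht2 : t = 1 / 2 := by
    by_contra hc
    rw [wall_congr hn] at h1
    exact h1.not_gt (wall_edge_self_neg y (lt_of_le_of_ne ht' hc))
  subst ht2
  rw [letter_congr hn] at hw h ⊢
  rw [eval_cons, letterTranslation_letter, mul_smul, smul_eq_iff_eq_inv_smul] at h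
  have e := edge_opp (g := g) y (1 / 2)
  norm_num at e
  norm_num at h
  rw [← e] at h
  rcases w with _ | ⟨b, w⟩
  · simp only [eval, List.map_nil, List.prod_nil, one_smul] at h
    obtain ⟨h2, h3⟩ := edge_eq_edge hs (by norm_num) h
    refine ⟨by linarith, Or.inr ⟨by simp [eval, letterTranslation_letter], by linarith, ?_⟩⟩
    rcases h3 with h3 | h3
    · rw [h3] at h2; norm_num at h2
    · exact h3
  · exfalso
    obtain ⟨m, rfl⟩ : ∃ m : ℤ, b = letter m := ⟨idx b, (letter_idx b).symm⟩
    have h1 := wall_nonneg_of_isDReduced hw.tail x hs hs'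
    rw [h] at h1
    have hm : m ≡ y + 2 * g [ZMOD 4 * g] := by
      by_contra hc
      exact h1.not_gt (wall_edge_neg hc (by norm_num))
    rw [letter_congr hm] at hw
    exact hw.not_infix_backtrack y ⟨[], w, by simp⟩

/-! ### Discontinuity of the action along the graph -/

variable (g) in
/-- The points near which at most one wall of the polygon passes. -/
def starSet (n : ℤ) : Set ℍ := {z | ∀ a : Letter g, letter n ≠ a → wall g (idx a) z < 0}

theorem isOpen_starSet (n : ℤ) : IsOpen (starSet g n) := by
  have : starSet g n = ⋂ a : Letter g, {z | letter n ≠ a → wall g (idx a) z < 0} := by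
    ext z; simp [starSet]
  rw [this]
  refine isOpen_iInter_of_finite fun a => ?_
  by_cases h : letter n = a
  · simp [h]
  · simpa [h] using isOpen_lt (continuous_wall (idx a)) continuous_const

theorem edge_mem_starSet (n : ℤ) {t : ℝ} (ht : 0 ≤ t) : edge g n t ∈ starSet g n := by
  intro a ha
  refine wall_edge_neg (fun h => ha ?_) ht
  rw [← letter_idx a]; exact (letter_congr h).symm

theorem letter_eq_of_mem_starSet {n m : ℤ} {z : ℍ} (hz : z ∈ starSet g n)
    (h : 0 ≤ wall g m z) : (letter m : Letter g) = letter n := by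
  by_contra hc
  have := hz (letter m) (Ne.symm hc)
  rw [idx_letter, wall_congr (emod_modEq m)] at this
  exact h.not_gt this

/-- Near a point of the half-edge only wall `x` can be crossed, and in the frame beyond it only wall
`x + 2g`. A nearby image by a reduced word thus allows only the word of the single letter `x`, since
a second letter would backtrack. -/
theorem exists_dist_half_edge (x : ℤ) {t : ℝ} (h0 : 0 ≤ t) (h1 : t ≤ 1 / 2) :
    ∃ ε > 0, ∀ γ ∈ Gam g, dist (γ • edge g x t) (edge g x t) < ε → γ = 1 := by
  set z := edge g x t with hz
  have hg2 := hg.out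
  have hne : z ≠ trans g x • z := by
    intro h
    have h2 := wall_opp_trans_inv (g := g) x z
    have h3 : (trans g x)⁻¹ • z = z := by rw [inv_smul_eq_iff]; exact h
    rw [h3] at h2
    have h4 : wall g (x + 2 * g) z < 0 := by
      refine wall_edge_neg (fun h => ?_) h0
      have := eq_of_modEq h (by omega) (by omega); omega
    have h5 : wall g x z ≤ 0 := by
      have h6 := wall_edge_self (g := g) x t
      have hl := log_stretch_pos (g := g)
      have h7 : exp (2 * t * log (stretch g)) ≤ stretch g := by
        conv_rhs => rw [← exp_log (stretch_pos g)]
        exact exp_le_exp.2 (by nlinarith)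
      have h8 := exp_pos (2 * t * log (stretch g))
      have hd := dee_lt_chi g
      by_contra hc
      push Not at hc
      have h9 : exp (2 * t * log (stretch g)) ^ 2 ≤ stretch g ^ 2 := by gcongr
      nlinarith [mul_pos h8 hc]
    linarith
  -- The three sets control the first letter, control the second letter, and remove the image under
  -- the single letter `x`.
  let U : Set ℍ := starSet g x ∩ ((fun p => (trans g x)⁻¹ • p) ⁻¹' starSet g (x + 2 * g)) ∩
    {trans g x • z}ᶜ
  have hU : IsOpen U := ((isOpen_starSet x).inter
    ((isOpen_starSet _).preimage (continuous_const_smul _))).inter isOpen_compl_singleton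
  have hzU : z ∈ U := by
    refine ⟨⟨edge_mem_starSet x h0, ?_⟩, hne⟩
    have := edge_opp (g := g) x (1 - t)
    rw [sub_sub_cancel] at this
    change (trans g x)⁻¹ • edge g x t ∈ starSet g (x + 2 * g)
    rw [← this]
    exact edge_mem_starSet _ (by linarith)
  obtain ⟨ε, hε, hball⟩ := Metric.isOpen_iff.1 hU z hzU
  refine ⟨ε, hε, fun γ hγ hd => ?_⟩
  obtain ⟨⟨hγ1, hγ2⟩, hγ3⟩ := hball hd
  obtain ⟨w, hw, rfl⟩ := exists_isDReduced_of_mem hγ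
  rcases w with _ | ⟨a, w⟩
  · simp [eval]
  exfalso
  obtain ⟨n, rfl⟩ : ∃ n : ℤ, a = letter n := ⟨idx a, (letter_idx a).symm⟩
  have hn := letter_eq_of_mem_starSet hγ1 (wall_nonneg_of_isDReduced hw x h0 h1)
  rw [hn] at hw hγ2 hγ3
  have e : ∀ w : List (Letter g), eval (letter x :: w) • z = trans g x • (eval w • z) := fun w => by
    rw [eval_cons, letterTranslation_letter, mul_smul]
  rw [e] at hγ3
  change (trans g x)⁻¹ • (eval (letter x :: w) • z) ∈ starSet g (x + 2 * g) at hγ2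
  rw [e, inv_smul_smul] at hγ2
  rcases w with _ | ⟨b, w⟩
  · exact hγ3 (by simp [eval])
  · obtain ⟨m, rfl⟩ : ∃ m : ℤ, b = letter m := ⟨idx b, (letter_idx b).symm⟩
    have hm := letter_eq_of_mem_starSet hγ2 (wall_nonneg_of_isDReduced hw.tail x h0 h1)
    rw [hm] at hw
    exact hw.not_infix_backtrack x ⟨[], w, by simp⟩

variable (g) in
/-- The union of all translates of the edges. -/
def graph : Set ℍ := {z | ∃ γ ∈ Gam g, ∃ x : ℤ, ∃ t ∈ Set.Icc (0 : ℝ) 1, z = γ • edge g x t}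

theorem trans_mem (n : ℤ) : trans g n ∈ Gam g := by
  rw [← letterTranslation_letter]; exact letterTranslation_mem _

theorem exists_half_edge {z : ℍ} (hz : z ∈ graph g) :
    ∃ γ ∈ Gam g, ∃ x : ℤ, ∃ t : ℝ, 0 ≤ t ∧ t ≤ 1 / 2 ∧ z = γ • edge g x t := by
  obtain ⟨γ, hγ, x, t, ⟨h0, h1⟩, rfl⟩ := hz
  rcases le_total t (1 / 2) with h | h
  · exact ⟨γ, hγ, x, t, h0, h, rfl⟩
  · refine ⟨γ * trans g x, mul_mem hγ (trans_mem x), x + 2 * g, 1 - t, by linarith, by linarith, ?_⟩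
    rw [mul_smul, trans_smul_edge_opp, sub_sub_cancel]

theorem exists_dist_graph {z : ℍ} (hz : z ∈ graph g) :
    ∃ ε > 0, ∀ γ ∈ Gam g, dist (γ • z) z < ε → γ = 1 := by
  obtain ⟨η, hη, x, t, h0, h1, rfl⟩ := exists_half_edge hz
  obtain ⟨ε, hε, h⟩ := exists_dist_half_edge (g := g) x h0 h1
  refine ⟨ε, hε, fun γ hγ hd => ?_⟩
  have h2 := h (η⁻¹ * γ * η) (mul_mem (mul_mem (inv_mem hη) hγ) hη) (by
    rw [← dist_smul η, smul_smul, ← mul_assoc, ← mul_assoc, mul_inv_cancel, one_mul, mul_smul]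
    exact hd)
  rwa [mul_assoc, inv_mul_eq_one, eq_comm, mul_eq_right] at h2

end
end
end SurfaceLoops

/-! ### Liftings, inverse words and periodic words -/

namespace SurfaceLoops
open Real
noncomputable section
section
variable {g : ℕ} [hg : Fact (2 ≤ g)]

/-! ### Uniqueness of geodesics -/

theorem dist_ray (s t : ℝ) : dist (ray g s) (ray g t) = |s - t| * (2 * log (stretch g)) := by
  have hl := log_stretch_pos (g := g)
  have e : 2 * s * log (stretch g) - 2 * t * log (stretch g) = (s - t) * (2 * log (stretch g)) := by
    ring
  rw [UpperHalfPlane.dist_of_re_eq (by rw [ray_re, ray_re]), ray_im, ray_im, log_exp, log_exp,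
    Real.dist_eq, e, abs_mul, abs_of_pos (by positivity : 0 < 2 * log (stretch g))]

/-- The logarithm of the height is `1`-Lipschitz, so the two distances fix the height from both
sides; equal distance to `i` then forces real part zero. -/
theorem eq_ray_of_dist {z : ℍ} {t : ℝ} (ht : t ∈ Set.Icc (0 : ℝ) 1)
    (h0 : dist z (ray g 0) = t * (2 * log (stretch g)))
    (h1 : dist z (ray g 1) = (1 - t) * (2 * log (stretch g))) : z = ray g t := by
  have e0 := UpperHalfPlane.dist_log_im_le z (ray g 0)
  have e1 := UpperHalfPlane.dist_log_im_le z (ray g 1)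
  rw [h0, ray_im, log_exp, Real.dist_eq, abs_le] at e0
  rw [h1, ray_im, log_exp, Real.dist_eq, abs_le] at e1
  have hlog : log z.im = 2 * t * log (stretch g) := by linarith [e0.2, e1.1]
  have him : z.im = (ray g t).im := by rw [ray_im, ← hlog, exp_log z.im_pos]
  refine UpperHalfPlane.ext_re_im ?_ him
  have hd : dist z (ray g 0) = dist (ray g t) (ray g 0) := by
    rw [h0, dist_ray, sub_zero, abs_of_nonneg ht.1]
  have hc := congrArg cosh hd
  rw [UpperHalfPlane.cosh_dist', UpperHalfPlane.cosh_dist', ← him, ray_re, ray_re] at hc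
  have hp : 0 < 2 * z.im * (ray g 0).im := by have := z.im_pos; have := (ray g 0).im_pos; positivity
  rw [div_left_inj' hp.ne'] at hc
  rw [ray_re]
  nlinarith

theorem IsGeodesicSegment.eq_edge {c : ℝ → ℍ} {a : Letter g}
    (h : IsGeodesicSegment c UpperHalfPlane.I (letterTranslation g a • UpperHalfPlane.I)) {t : ℝ}
    (ht : t ∈ Set.Icc (0 : ℝ) 1) : c t = edge g (idx a) t := by
  obtain ⟨h0, h1, h2⟩ := h
  rw [letterTranslation_eq, ← edge_one] at h1 h2
  rw [← edge_zero (g := g) (idx a)] at h0 h2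
  have hd : dist (edge g (idx a) 0) (edge g (idx a) 1) = 2 * log (stretch g) := by
    rw [edge, edge, dist_smul, dist_ray]; simp
  rw [hd] at h2
  have k0 := h2 t ht 0 ⟨le_rfl, zero_le_one⟩
  have k1 := h2 t ht 1 ⟨zero_le_one, le_rfl⟩
  rw [h0, sub_zero, abs_of_nonneg ht.1, edge] at k0
  rw [h1, abs_sub_comm, abs_of_nonneg (sub_nonneg.2 ht.2), edge] at k1
  rw [edge, eq_inv_smul_iff]
  apply eq_ray_of_dist ht
  · rw [← k0, ← dist_smul (rotationMatrix g ^ (idx a + 1))⁻¹, inv_smul_smul]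
  · rw [← k1, ← dist_smul (rotationMatrix g ^ (idx a + 1))⁻¹, inv_smul_smul]

/-! ### Lifts along the graph -/

theorem proj_eq_iff {z w : ℍ} : proj g z = proj g w ↔ ∃ γ ∈ Gam g, w = γ • z := by
  rw [proj, proj, eq_comm, Quotient.eq]
  constructor
  · rintro ⟨⟨γ, hγ⟩, h⟩
    exact ⟨γ, hγ, h.symm⟩
  · rintro ⟨γ, hγ, h⟩
    exact ⟨⟨γ, hγ⟩, h.symm⟩

theorem proj_smul {γ : SL(2, ℝ)} (hγ : γ ∈ Gam g) (z : ℍ) : proj g (γ • z) = proj g z :=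
  (proj_eq_iff.2 ⟨γ, hγ, rfl⟩).symm

theorem exists_ball_graph {z : ℍ} (hz : z ∈ graph g) :
    ∃ ε > 0, ∀ γ ∈ Gam g, ∀ p q : ℍ, dist p z < ε → dist q z < ε → γ • p = q → γ = 1 := by
  obtain ⟨ε, hε, h⟩ := exists_dist_graph hz
  refine ⟨ε / 2, by positivity, fun γ hγ p q hp hq hpq => h γ hγ ?_⟩
  calc dist (γ • z) z ≤ dist (γ • z) (γ • p) + dist (γ • p) z := dist_triangle _ _ _
    _ < ε / 2 + ε / 2 := by
      rw [dist_smul, dist_comm, hpq]; exact add_lt_add hp hq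
    _ = ε := by ring

theorem eq_one_of_smul_eq_graph {γ : SL(2, ℝ)} (hγ : γ ∈ Gam g) {z : ℍ} (hz : z ∈ graph g)
    (h : γ • z = z) : γ = 1 := by
  obtain ⟨ε, hε, h'⟩ := exists_dist_graph hz
  exact h' γ hγ (by rwa [h, dist_self])

/-- Uniqueness of liftings up to `Γ_g` for maps into the graph. The set where a fixed group element
works is closed, and it is open by discontinuity along the graph, so no covering property of `proj`
on all of `ℍ` is needed. -/
theorem exists_eq_smul {T : Type*} [TopologicalSpace T] [PreconnectedSpace T] [Nonempty T]
    {f h : T → ℍ} (hf : Continuous f) (hh : Continuous h) (hp : ∀ t, proj g (f t) = proj g (h t))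
    (hG : ∀ t, f t ∈ graph g) : ∃ γ ∈ Gam g, ∀ t, h t = γ • f t := by
  obtain ⟨t₀⟩ := ‹Nonempty T›
  obtain ⟨γ, hγ, h0⟩ := proj_eq_iff.1 (hp t₀)
  refine ⟨γ, hγ, ?_⟩
  have hcl : IsClosed {t | h t = γ • f t} := isClosed_eq hh (hf.const_smul γ)
  have hop : IsOpen {t | h t = γ • f t} := by
    rw [isOpen_iff_mem_nhds]
    intro t ht
    obtain ⟨ε, hε, hb⟩ := exists_ball_graph (hG t)
    filter_upwards [hf.continuousAt.preimage_mem_nhds (Metric.ball_mem_nhds _ hε),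
      hh.continuousAt.preimage_mem_nhds (Metric.ball_mem_nhds _ hε)] with s hs1 hs2
    obtain ⟨η, hη, hs⟩ := proj_eq_iff.1 (hp s)
    have hs2 : dist (h s) (h t) < ε := hs2
    rw [show h t = γ • f t from ht] at hs2
    have := hb (γ⁻¹ * η) (mul_mem (inv_mem hγ) hη) (f s) (γ⁻¹ • h s) hs1
      (by rwa [← dist_smul γ, smul_inv_smul]) (by rw [mul_smul, hs])
    rw [inv_mul_eq_one] at this
    change h s = γ • f s
    rw [hs, this]
  have := IsClopen.eq_univ ⟨hcl, hop⟩ ⟨t₀, h0⟩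
  intro t
  have ht : t ∈ {t | h t = γ • f t} := by rw [this]; trivial
  exact ht

/-! ### Inverses of reduced words, and periodic words -/

theorem invWord_append (u v : List (Letter g)) : invWord (u ++ v) = invWord v ++ invWord u := by
  simp [invWord]

theorem invWord_invWord (u : List (Letter g)) : invWord (invWord u) = u := by
  simp [invWord, Function.comp_def]

theorem invWord_pos (l : List (Fin (2 * g))) : invWord (pos l) = neg l.reverse := by
  simp [invWord, pos, neg, Function.comp_def]

theorem invWord_neg (l : List (Fin (2 * g))) : invWord (neg l) = pos l.reverse := by
  simp [invWord, pos, neg, Function.comp_def]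

theorem invWord_wpow (w : List (Letter g)) (s : ℕ) : invWord (wpow w s) = wpow (invWord w) s := by
  simp [invWord, wpow, List.reverse_flatten, List.map_flatten]

/-- Formal inversion exchanges `d1` with `d2`, `d3` with `d4` and `d5` with `d6`. It makes reversed
paths reduced. -/
theorem Basis.invWord {v w : List (Letter g)} (h : Basis g v w) :
    ∃ w', Basis g (SurfaceLoops.invWord v) w' := by
  have e : ∀ (j : Fin (2 * g)) (w : List (Letter g)), SurfaceLoops.invWord ((j, true) ::
      (w ++ [(j, false)])) = (j, true) :: (SurfaceLoops.invWord w ++ [(j, false)]) := by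
    intro j w; simp [SurfaceLoops.invWord]
  cases h with
  | d1 j s hj hs =>
    rw [e, invWord_wpow, invWord_append, invWord_pos, invWord_neg, List.reverse_reverse,
      List.reverse_reverse]
    exact ⟨_, .d2 j s hj hs⟩
  | d2 j s hj hs =>
    rw [e, invWord_wpow, invWord_append, invWord_pos, invWord_neg]
    exact ⟨_, .d1 j s hj hs⟩
  | d3 => rw [invWord_neg, List.reverse_reverse]; exact ⟨_, .d4⟩
  | d4 => rw [invWord_pos]; exact ⟨_, .d3⟩
  | d5 i hi => rw [invWord_append, invWord_pos, invWord_neg]; exact ⟨_, .d6 i hi⟩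
  | d6 i hi =>
    rw [invWord_append, invWord_pos, invWord_neg, List.reverse_reverse, List.reverse_reverse]
    exact ⟨_, .d5 i hi⟩
  | d7 i => exact ⟨_, .d7 i⟩
  | d8 i => exact ⟨_, .d8 i⟩

theorem IsDReduced.invWord {u : List (Letter g)} (h : IsDReduced u) :
    IsDReduced (SurfaceLoops.invWord u) := by
  rintro v w hvw ⟨s, t, hst⟩
  obtain ⟨w', hw'⟩ := hvw.invWord
  refine h _ _ hw' ⟨SurfaceLoops.invWord t, SurfaceLoops.invWord s, ?_⟩
  rw [← invWord_invWord u, ← hst, invWord_append, invWord_append, List.append_assoc]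

theorem nodup_pos {l : List (Fin (2 * g))} (h : l.Nodup) : (pos l).Nodup :=
  h.map fun _ _ h => congrArg Prod.fst h

theorem nodup_neg {l : List (Fin (2 * g))} (h : l.Nodup) : (neg l).Nodup :=
  h.map fun _ _ h => congrArg Prod.fst h

theorem disjoint_neg_pos (l l' : List (Fin (2 * g))) : (neg l).Disjoint (pos l') := by
  intro a h h'
  simp only [neg, pos, List.mem_map] at h h'
  obtain ⟨i, -, rfl⟩ := h
  obtain ⟨j, -, h⟩ := h'
  simp at h

theorem exists_cons_of_nodup {v : List (Letter g)} (h : v.Nodup) (hv : v ≠ []) :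
    ∃ a t, v = a :: t ∧ a ∉ t := by
  rcases v with _ | ⟨a, t⟩
  · exact absurd rfl hv
  · exact ⟨a, t, rfl, (List.nodup_cons.1 h).1⟩

theorem nodup_all : (all g).Nodup := List.nodup_finRange _

theorem mem_wpow {w : List (Letter g)} {s : ℕ} {a : Letter g} (h : a ∈ wpow w s) : a ∈ w := by
  simp only [wpow, List.mem_flatten, List.mem_replicate] at h
  obtain ⟨l, ⟨-, rfl⟩, h⟩ := h
  exact h

theorem Basis.head_notMem {v w : List (Letter g)} (h : Basis g v w) : ∃ a t, v = a :: t ∧ a ∉ t := by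
  have hg2 := hg.out
  have hall : ∀ l : List (Fin (2 * g)), l.length = (all g).length → l ≠ [] := fun l hl =>
    List.ne_nil_of_length_pos (by rw [hl]; simp [all]; omega)
  cases h with
  | d1 j s hj hs =>
    refine ⟨_, _, rfl, fun h => ?_⟩
    rcases List.mem_append.1 h with h | h
    · have := mem_wpow h
      simp [pos, neg, below, above] at this
    · simp at h
  | d2 j s hj hs =>
    refine ⟨_, _, rfl, fun h => ?_⟩
    rcases List.mem_append.1 h with h | h
    · have := mem_wpow h
      simp [pos, neg, below, above] at this
    · simp at h
  | d3 =>
    refine exists_cons_of_nodup (nodup_neg (List.nodup_reverse.2 nodup_all)) fun h => ?_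
    exact hall _ (by simp) (List.map_eq_nil_iff.1 h)
  | d4 =>
    refine exists_cons_of_nodup (nodup_pos nodup_all) fun h => ?_
    exact hall _ rfl (List.map_eq_nil_iff.1 h)
  | d5 i hi =>
    refine exists_cons_of_nodup ((nodup_neg (nodup_all.filter _)).append
      (nodup_pos (nodup_all.filter _)) (disjoint_neg_pos _ _)) fun h => ?_
    have := (List.append_eq_nil_iff.1 h).1
    simp [neg, atLeast, all] at this
    exact absurd (this i) (lt_irrefl i)
  | d6 i hi =>
    refine exists_cons_of_nodup ((nodup_neg (List.nodup_reverse.2 (nodup_all.filter _))).append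
      (nodup_pos (List.nodup_reverse.2 (nodup_all.filter _))) (disjoint_neg_pos _ _)) fun h => ?_
    have := (List.append_eq_nil_iff.1 h).2
    simp [pos, atLeast, all] at this
    exact absurd (this i) (lt_irrefl i)
  | d7 i => exact ⟨_, _, rfl, by simp⟩
  | d8 i => exact ⟨_, _, rfl, by simp⟩

/-- The finite subwords of a bi-infinite word. -/
def seg (a : ℤ → Letter g) (n : ℤ) (k : ℕ) : List (Letter g) :=
  (List.range k).map fun i : ℕ => a (n + i)

theorem seg_length (a : ℤ → Letter g) (n : ℤ) (k : ℕ) : (seg a n k).length = k := by simp [seg]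

theorem seg_add (a : ℤ → Letter g) (n : ℤ) (k l : ℕ) :
    seg a n (k + l) = seg a n k ++ seg a (n + k) l := by
  simp [seg, List.range_add, add_assoc, Function.comp_def]

theorem seg_succ (a : ℤ → Letter g) (n : ℤ) (k : ℕ) :
    seg a n (k + 1) = seg a n k ++ [a (n + k)] := by
  rw [seg_add]; simp [seg]

theorem invWord_seg (a : ℤ → Letter g) (n : ℤ) (k : ℕ) :
    invWord (seg a n k) = seg (fun i => ((a (-1 - i)).1, !(a (-1 - i)).2)) (-n - k) k := by
  apply List.ext_getElem
  · simp [invWord, seg]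
  · intro i h1 h2
    have h : i < k := by simpa [seg] using h2
    have e : n + ((k - 1 - i : ℕ) : ℤ) = -1 - (-n - k + i) := by omega
    simp [invWord, seg, e]

theorem exists_seg_of_infix {a : ℤ → Letter g} {n : ℤ} {k : ℕ} {v : List (Letter g)}
    (h : v <:+: seg a n k) : ∃ n', v = seg a n' v.length := by
  obtain ⟨s, t, hst⟩ := h
  have hk : k = s.length + v.length + t.length := by
    have := congrArg List.length hst
    simp [seg] at this; omega
  rw [hk, seg_add, seg_add] at hst
  have h1 := List.append_inj_left hst (by simp [seg])
  exact ⟨n + s.length, List.append_inj_right h1 (by simp [seg])⟩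

/-- The bi-infinite periodic word determined by a non-empty word. -/
def periodic (u : List (Letter g)) (hu : u ≠ []) (n : ℤ) : Letter g :=
  u[(n % u.length).toNat]'(by
    have h : 0 < (u.length : ℤ) := by exact_mod_cast List.length_pos_of_ne_nil hu
    have := Int.emod_nonneg n h.ne'
    have := Int.emod_lt_of_pos n h
    omega)

theorem periodic_add_length (u : List (Letter g)) (hu : u ≠ []) (n : ℤ) :
    periodic u hu (n + u.length) = periodic u hu n := by
  simp [periodic]

theorem seg_periodic_length (u : List (Letter g)) (hu : u ≠ []) (n : ℤ) :
    seg (periodic u hu) n u.length = u.rotate (n % u.length).toNat := by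
  apply List.ext_getElem
  · simp [seg]
  · intro i h1 h2
    have h : 0 < (u.length : ℤ) := by exact_mod_cast List.length_pos_of_ne_nil hu
    have h3 := Int.emod_nonneg n h.ne'
    have e : ((n + i) % (u.length : ℤ)).toNat = (i + (n % u.length).toNat) % u.length := by
      zify
      rw [Int.toNat_of_nonneg (Int.emod_nonneg _ h.ne'), Int.toNat_of_nonneg h3]
      simp [add_comm]
    simp [seg, periodic, List.getElem_rotate, e]

/-- A leading word no longer than the period lies in a rotation of `u`. A longer one would contain
its first letter again one period later, contrary to `Basis.head_notMem`. -/
theorem IsCyclicallyDReduced.seg_periodic {u : List (Letter g)} (h : IsCyclicallyDReduced u)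
    (hu : u ≠ []) (n : ℤ) (k : ℕ) : IsDReduced (seg (periodic u hu) n k) := by
  intro v w hvw hv
  obtain ⟨n', hn'⟩ := exists_seg_of_infix hv
  rcases le_or_gt v.length u.length with hl | hl
  · refine h (n' % u.length).toNat v w hvw ?_
    rw [← seg_periodic_length u hu, ← Nat.add_sub_cancel' hl, seg_add, ← hn']
    exact (List.prefix_append _ _).isInfix
  · obtain ⟨a, t, hat, ha⟩ := hvw.head_notMem
    have hlen := congrArg List.length hat
    rw [hlen, List.length_cons, add_comm, seg_add] at hn'
    have hp := List.length_pos_of_ne_nil hu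
    rw [hat] at hn'
    simp only [seg, List.range_one, List.map_cons, List.map_nil, List.cons_append,
      List.nil_append, List.cons.injEq] at hn'
    apply ha
    rw [hn'.2, List.mem_map]
    refine ⟨u.length - 1, List.mem_range.2 (by simp at hlen; omega), ?_⟩
    rw [hn'.1]
    have := periodic_add_length u hu n'
    rw [show ((0 : ℕ) : ℤ) = 0 from rfl, add_zero, ← this]
    congr 1
    push_cast [Nat.cast_sub hp]
    ring

end
end
end SurfaceLoops

/-! ### Common values of reduced paths -/

namespace SurfaceLoops
open Real
noncomputable section
section
variable {g : ℕ} [hg : Fact (2 ≤ g)]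

/-! ### Paths in the graph that spell reduced words -/

/-- The path `f` runs with constant speed through the vertices `P n • i`, along the edges
prescribed by the bi-infinite word `a`, all of whose finite subwords are `D`-reduced. -/
structure IsReducedPath (f : ℝ → ℍ) (P : ℤ → SL(2, ℝ)) (a : ℤ → Letter g) : Prop where
  mem : ∀ n, P n ∈ Gam g
  succ : ∀ n, P (n + 1) = P n * letterTranslation g (a n)
  apply : ∀ (n : ℤ), ∀ t ∈ Set.Icc (0 : ℝ) 1, f (n + t) = P n • edge g (idx (a n)) t
  reduced : ∀ n k, IsDReduced (seg a n k)

namespace IsReducedPath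

variable {f h : ℝ → ℍ} {P Q : ℤ → SL(2, ℝ)} {a b : ℤ → Letter g}

theorem apply_add_natCast (hf : IsReducedPath f P a) (n : ℤ) (k : ℕ) :
    P (n + k) = P n * eval (seg a n k) := by
  induction k with
  | zero => simp [seg, eval]
  | succ k ih =>
    rw [seg_succ, eval_append, ← mul_assoc, ← ih, Nat.cast_succ, ← add_assoc, hf.succ]
    simp [eval]

theorem letterTranslation_not (c : Letter g) :
    letterTranslation g (c.1, !c.2) = (letterTranslation g c)⁻¹ := by
  rcases c with ⟨i, _ | _⟩ <;> simp [letterTranslation]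

theorem idx_not (c : Letter g) : idx ((c.1, !c.2) : Letter g) ≡ idx c + 2 * g [ZMOD 4 * g] := by
  rcases c with ⟨i, _ | _⟩
  · exact Int.modEq_iff_dvd.2 ⟨1, by simp [idx]; ring⟩
  · exact Int.modEq_iff_dvd.2 ⟨0, by simp [idx]⟩

theorem reverse (hf : IsReducedPath f P a) : IsReducedPath (fun t => f (-t)) (fun n => P (-n))
    fun n => ((a (-1 - n)).1, !(a (-1 - n)).2) where
  mem n := hf.mem _
  succ n := by
    have := hf.succ (-1 - n)
    rw [show -1 - n + 1 = -n by ring] at this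
    rw [letterTranslation_not, this, mul_assoc, mul_inv_cancel, mul_one]
    congr 1; ring
  apply n t ht := by
    have h1 := hf.succ (-1 - n)
    rw [show -1 - n + 1 = -n by ring] at h1
    have h2 := hf.apply (-1 - n) (1 - t) ⟨by linarith [ht.2], by linarith [ht.1]⟩
    rw [h1, edge_congr (idx_not _), mul_smul, letterTranslation_eq, trans_smul_edge_opp, ← h2]
    congr 1; push_cast; ring
  reduced n k := by
    have := (hf.reduced (-n - k) k).invWord
    rw [invWord_seg] at this
    convert this using 2
    ring

/-- Every parameter lies within distance `1 / 2` of an integer, whose vertex is the start of the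
half-edge containing the point. -/
theorem exists_half_edge (hf : IsReducedPath f P a) (s : ℝ) : ∃ (n σ x : ℤ) (r : ℝ),
    0 ≤ r ∧ r ≤ 1 / 2 ∧ s = n + σ * r ∧ P (n + σ) = P n * trans g x ∧
      ∀ r' ∈ Set.Icc (0 : ℝ) 1, f (n + σ * r') = P n • edge g x r' := by
  rcases le_total (Int.fract s) (1 / 2) with h | h
  · refine ⟨⌊s⌋, 1, idx (a ⌊s⌋), Int.fract s, Int.fract_nonneg s, h, ?_, ?_, fun r' hr' => ?_⟩
    · rw [Int.cast_one, one_mul, Int.floor_add_fract]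
    · rw [hf.succ, letterTranslation_eq]
    · rw [Int.cast_one, one_mul]; exact hf.apply _ _ hr'
  · refine ⟨⌊s⌋ + 1, -1, idx (a ⌊s⌋) + 2 * g, 1 - Int.fract s, ?_, by linarith, ?_, ?_,
      fun r' hr' => ?_⟩
    · linarith [Int.fract_lt_one s]
    · push_cast; linarith [Int.floor_add_fract s]
    · rw [hf.succ, letterTranslation_eq, trans_opp, mul_assoc, mul_inv_cancel, mul_one]
      congr 1; ring
    · rw [hf.succ, letterTranslation_eq, mul_smul, trans_smul_edge_opp,
        ← hf.apply ⌊s⌋ (1 - r') ⟨by linarith [hr'.2], by linarith [hr'.1]⟩]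
      congr 1; push_cast; ring

/-- A common value is joined by a segment of common values to a common vertex. -/
theorem exists_vertex (hf : IsReducedPath f P a) (hh : IsReducedPath h Q b) {z : ℝ × ℝ}
    (hz : z ∈ cvp f h) : ∃ n k : ℤ, P n = Q k ∧ segment ℝ ((n : ℝ), (k : ℝ)) z ⊆ cvp f h := by
  obtain ⟨s, t⟩ := z
  obtain ⟨n, σ, x, r, h0, h1, rfl, hP, hfx⟩ := hf.exists_half_edge s
  obtain ⟨k, τ, y, r', h0', h1', rfl, hQ, hhy⟩ := hh.exists_half_edge t
  have e : f (n + σ * r) = h (k + τ * r') := hz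
  have hr : r ∈ Set.Icc (0 : ℝ) 1 := ⟨h0, by linarith⟩
  rw [hfx r hr, hhy r' ⟨h0', by linarith⟩, ← inv_smul_eq_iff, smul_smul] at e
  -- Either both half-edges start at the same vertex, or they meet at the midpoint of one edge from
  -- opposite ends. In the second case the far end `k + τ` of the second edge is the common vertex.
  obtain ⟨rfl, ⟨h2, h3⟩ | ⟨h2, h3, h4⟩⟩ :=
    smul_edge_eq_edge (mul_mem (inv_mem (hh.mem k)) (hf.mem n)) h0 h1 h0' h1' e
  · rw [inv_mul_eq_one] at h2
    refine ⟨n, k, h2.symm, ?_⟩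
    rw [segment_eq_image']
    rintro _ ⟨θ, hθ, rfl⟩
    have hθr : θ * r ∈ Set.Icc (0 : ℝ) 1 := ⟨mul_nonneg hθ.1 h0, by nlinarith [hθ.1, hθ.2]⟩
    have e1 : (n : ℝ) + θ * (n + σ * r - n) = n + σ * (θ * r) := by ring
    have e2 : (k : ℝ) + θ * (k + τ * r - k) = k + τ * (θ * r) := by ring
    change f (n + θ * (n + σ * r - n)) = h (k + θ * (k + τ * r - k))
    rw [e1, e2, hfx _ hθr, hhy _ hθr, h2]
    congr 1
    rcases h3 with rfl | h3
    · rw [mul_zero, edge_zero, edge_zero]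
    · rw [edge_congr h3]
  · rw [inv_mul_eq_iff_eq_mul] at h2
    refine ⟨n, k + τ, by rw [h2, hQ], ?_⟩
    rw [segment_eq_image']
    rintro _ ⟨θ, hθ, rfl⟩
    have hθr : θ * r ∈ Set.Icc (0 : ℝ) 1 := ⟨mul_nonneg hθ.1 h0, by nlinarith [hθ.1, hθ.2]⟩
    have hθr' : 1 - θ * r ∈ Set.Icc (0 : ℝ) 1 := ⟨by linarith [hθr.2], by linarith [hθr.1]⟩
    have e1 : (n : ℝ) + θ * (n + σ * r - n) = n + σ * (θ * r) := by ring
    have e2 : ((k + τ : ℤ) : ℝ) + θ * (k + τ * r - (k + τ : ℤ)) = k + τ * (1 - θ * r) := by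
      rw [h3]; push_cast; ring
    change f (n + θ * (n + σ * r - n)) = h ((k + τ : ℤ) + θ * (k + τ * r - (k + τ : ℤ)))
    rw [e1, e2, hfx _ hθr, hhy _ hθr', h2, edge_congr h4, mul_smul, trans_smul_edge_opp]

theorem eq_of_seg_eq (hf : IsReducedPath f P a) (hh : IsReducedPath h Q b) {n k : ℤ}
    (hnk : P n = Q k) (i : ℕ) (hs : seg a n i = seg b k i) {r : ℝ} (hr : r ∈ Set.Icc (0 : ℝ) i) :
    f (n + r) = h (k + r) := by
  induction i with
  | zero =>
    have hr0 : r = 0 := le_antisymm (by simpa using hr.2) hr.1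
    have h1 := hf.apply n 0 ⟨le_rfl, zero_le_one⟩
    have h2 := hh.apply k 0 ⟨le_rfl, zero_le_one⟩
    rw [hr0, h1, h2, edge_zero, edge_zero, hnk]
  | succ i ih =>
    rw [seg_succ, seg_succ] at hs
    obtain ⟨h1, h2⟩ := List.append_inj hs (by simp [seg])
    rw [List.cons.injEq] at h2
    rcases le_total r i with hri | hri
    · exact ih h1 ⟨hr.1, hri⟩
    · have hr1 : r - i ∈ Set.Icc (0 : ℝ) 1 := by
        have := hr.2
        push_cast at this
        exact ⟨by linarith, by linarith⟩
      have h3 := hf.apply (n + i) _ hr1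
      have h4 := hh.apply (k + i) _ hr1
      rw [hf.apply_add_natCast, h1, hnk, ← hh.apply_add_natCast, h2.1, ← h4] at h3
      push_cast at h3
      convert h3 using 2 <;> ring

/-- Both words carry one common vertex to the other. Being reduced, they coincide as words, in
particular in length, so the paths agree at equal speed in between. -/
theorem segment_subset_of_le (hf : IsReducedPath f P a) (hh : IsReducedPath h Q b) {n k n' k' : ℤ}
    (h1 : P n = Q k) (h2 : P n' = Q k') (hn : n ≤ n') (hk : k ≤ k') :
    segment ℝ ((n : ℝ), (k : ℝ)) ((n' : ℝ), (k' : ℝ)) ⊆ cvp f h := by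
  obtain ⟨i, rfl⟩ := Int.le.dest hn
  obtain ⟨j, rfl⟩ := Int.le.dest hk
  rw [hf.apply_add_natCast, hh.apply_add_natCast, h1, mul_right_inj] at h2
  have hs := eq_of_eval_smul_eq (hf.reduced n i) (hh.reduced k j) I_mem_polygon (by rw [h2])
  have hij : i = j := by simpa [seg_length] using congrArg List.length hs
  subst hij
  rw [segment_eq_image']
  rintro _ ⟨θ, hθ, rfl⟩
  have e := hf.eq_of_seg_eq hh h1 i hs (r := θ * i)
    ⟨mul_nonneg hθ.1 i.cast_nonneg, mul_le_of_le_one_left i.cast_nonneg hθ.2⟩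
  change f (n + θ * ((n + i : ℤ) - n)) = h (k + θ * ((k + i : ℤ) - k))
  rw [show ((n + i : ℤ) : ℝ) - n = i by push_cast; ring,
    show ((k + i : ℤ) : ℝ) - k = i by push_cast; ring]
  exact e

/-- Paths running in opposite directions are reduced to the previous case by reversing the second
one. -/
theorem segment_subset (hf : IsReducedPath f P a) (hh : IsReducedPath h Q b) {n k n' k' : ℤ}
    (h1 : P n = Q k) (h2 : P n' = Q k') :
    segment ℝ ((n : ℝ), (k : ℝ)) ((n' : ℝ), (k' : ℝ)) ⊆ cvp f h := by
  have key : ∀ {n k n' k' : ℤ}, P n = Q k → P n' = Q k' → n ≤ n' →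
      segment ℝ ((n : ℝ), (k : ℝ)) ((n' : ℝ), (k' : ℝ)) ⊆ cvp f h := by
    intro n k n' k' h1 h2 hn
    rcases le_total k k' with hk | hk
    · exact hf.segment_subset_of_le hh h1 h2 hn hk
    · have := hf.segment_subset_of_le hh.reverse (n := n) (n' := n') (k := -k) (k' := -k')
        (by rw [neg_neg, h1]) (by rw [neg_neg, h2]) hn (neg_le_neg hk)
      rw [segment_eq_image'] at this ⊢
      rintro _ ⟨θ, hθ, rfl⟩
      have e : f (n + θ * (n' - n)) = h (-((-k : ℤ) + θ * ((-k' : ℤ) - (-k : ℤ)))) :=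
        this ⟨θ, hθ, rfl⟩
      change f (n + θ * (n' - n)) = h (k + θ * (k' - k))
      rw [e]
      congr 1; push_cast; ring
  rcases le_total n n' with hn | hn
  · exact key h1 h2 hn
  · rw [segment_symm]; exact key h2 h1 hn

theorem isPreconnected_cvp (hf : IsReducedPath f P a) (hh : IsReducedPath h Q b) :
    IsPreconnected (cvp f h) := by
  rcases (cvp f h).eq_empty_or_nonempty with h0 | ⟨z, hz⟩
  · rw [h0]; exact isPreconnected_empty
  obtain ⟨n, k, hnk, hs⟩ := hf.exists_vertex hh hz
  refine isPreconnected_of_forall ((n : ℝ), (k : ℝ)) fun w hw => ?_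
  obtain ⟨n', k', hnk', hs'⟩ := hf.exists_vertex hh hw
  refine ⟨segment ℝ ((n : ℝ), (k : ℝ)) ((n' : ℝ), (k' : ℝ)) ∪ segment ℝ ((n' : ℝ), (k' : ℝ)) w,
    Set.union_subset (hf.segment_subset hh hnk hnk') hs', Or.inl (left_mem_segment _ _ _),
    Or.inr (right_mem_segment _ _ _), ?_⟩
  exact IsPreconnected.union _ (right_mem_segment _ _ _) (left_mem_segment _ _ _)
    (convex_segment _ _).isPreconnected (convex_segment _ _).isPreconnected

theorem mem_graph (hf : IsReducedPath f P a) (s : ℝ) : f s ∈ graph g := by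
  refine ⟨_, hf.mem ⌊s⌋, idx (a ⌊s⌋), Int.fract s,
    ⟨Int.fract_nonneg s, (Int.fract_lt_one s).le⟩, ?_⟩
  rw [← hf.apply _ _ ⟨Int.fract_nonneg s, (Int.fract_lt_one s).le⟩, Int.floor_add_fract]

end IsReducedPath

/-! ### Lifts of piecewise geodesic loops -/

theorem circleProj_add_intCast (t : ℝ) (n : ℤ) : circleProj (t + n) = circleProj t := by
  rw [circleProj, circleProj, mul_add, Circle.exp_add, show 2 * π * n = n * (2 * π) by ring,
    Circle.exp_int_mul_two_pi, mul_one]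

theorem IsPiecewiseGeodesicLoop.apply {u : List (Letter g)} {φ : C(Circle, Surface g)}
    (h : IsPiecewiseGeodesicLoop u φ) (n : ℤ) {t : ℝ} (ht : t ∈ Set.Icc (0 : ℝ) 1) :
    φ (circleProj ((n + t) / u.length)) = proj g (edge g (idx (periodic u h.1 n)) t) := by
  have hp : 0 < (u.length : ℤ) := by exact_mod_cast List.length_pos_of_ne_nil h.1
  have hp' : (u.length : ℝ) ≠ 0 := by exact_mod_cast hp.ne'
  obtain ⟨k, hk⟩ := Int.eq_ofNat_of_zero_le (Int.emod_nonneg n hp.ne')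
  have hk' : k < u.length := by have := Int.emod_lt_of_pos n hp; omega
  obtain ⟨c, hc, hφ⟩ := h.2 ⟨k, hk'⟩
  have e : ((n : ℝ) + t) / u.length = (k + t) / u.length + (n / (u.length : ℤ) : ℤ) := by
    have := Int.emod_add_mul_ediv n u.length
    rw [hk] at this
    have : (n : ℝ) = k + u.length * (n / (u.length : ℤ) : ℤ) := by exact_mod_cast this.symm
    field_simp
    rw [this]; ring
  have e2 : periodic u h.1 n = u.get ⟨k, hk'⟩ := by simp [periodic, hk]
  rw [e, circleProj_add_intCast, e2, ← hc.eq_edge ht]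
  exact hφ t ht

theorem IsLifting.exists_isReducedPath {u : List (Letter g)} {φ : C(Circle, Surface g)}
    (h : IsPiecewiseGeodesicLoop u φ) (hu : IsCyclicallyDReduced u) {φ' : C(ℝ, ℍ)}
    (h' : IsLifting φ' φ) : ∃ P, IsReducedPath (fun t => φ' (t / u.length)) P (periodic u h.1) := by
  have key : ∀ n : ℤ, ∃ γ ∈ Gam g, ∀ t : unitInterval,
      φ' ((n + t) / u.length) = γ • edge g (idx (periodic u h.1 n)) t := by
    intro n
    refine exists_eq_smul ((continuous_edge _).comp continuous_subtype_val) ?_ ?_ ?_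
    · have := φ'.continuous
      fun_prop
    · intro t
      rw [h', h.apply n t.2]
    · intro t
      exact ⟨1, one_mem _, _, t, t.2, (one_smul _ _).symm⟩
  choose P hP hP' using key
  -- The translations found on consecutive edges agree at the shared vertex; freeness on the orbit
  -- of `i` turns this into the recursion for `P`.
  refine ⟨P, hP, fun n => ?_, fun n t ht => hP' n ⟨t, ht⟩, hu.seg_periodic h.1⟩
  have h1 := hP' n 1
  have h2 := hP' (n + 1) 0
  rw [Set.Icc.coe_one, edge_one, ← letterTranslation_eq] at h1
  rw [Set.Icc.coe_zero, edge_zero] at h2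
  push_cast at h2
  rw [add_zero, h1, ← inv_smul_eq_iff, smul_smul, smul_smul] at h2
  have := eq_one_of_smul_eq (mul_mem (mul_mem (inv_mem (hP (n + 1))) (hP n))
    (letterTranslation_mem _)) I_mem_polygon h2
  rw [mul_assoc, inv_mul_eq_one] at this
  exact this

theorem IsLifting.mem_graph {u : List (Letter g)} {φ : C(Circle, Surface g)}
    (h : IsPiecewiseGeodesicLoop u φ) (hu : IsCyclicallyDReduced u) {φ' : C(ℝ, ℍ)}
    (h' : IsLifting φ' φ) (s : ℝ) : φ' s ∈ graph g := by
  obtain ⟨P, hP⟩ := h'.exists_isReducedPath h hu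
  have hp : (u.length : ℝ) ≠ 0 := by exact_mod_cast (List.length_pos_of_ne_nil h.1).ne'
  have := hP.mem_graph (s * u.length)
  rwa [mul_div_cancel_right₀ _ hp] at this

theorem IsLifting.isPreconnected_cvp {u v : List (Letter g)} {φ ψ : C(Circle, Surface g)}
    (hφ : IsPiecewiseGeodesicLoop u φ) (hψ : IsPiecewiseGeodesicLoop v ψ)
    (hu : IsCyclicallyDReduced u) (hv : IsCyclicallyDReduced v) {φ' ψ' : C(ℝ, ℍ)}
    (hφ' : IsLifting φ' φ) (hψ' : IsLifting ψ' ψ) : IsPreconnected (cvp φ' ψ') := by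
  obtain ⟨P, hP⟩ := hφ'.exists_isReducedPath hφ hu
  obtain ⟨Q, hQ⟩ := hψ'.exists_isReducedPath hψ hv
  have hp : (u.length : ℝ) ≠ 0 := by exact_mod_cast (List.length_pos_of_ne_nil hφ.1).ne'
  have hq : (v.length : ℝ) ≠ 0 := by exact_mod_cast (List.length_pos_of_ne_nil hψ.1).ne'
  have e : cvp φ' ψ' = (fun z : ℝ × ℝ => (z.1 / u.length, z.2 / v.length)) ''
      cvp (fun t => φ' (t / u.length)) fun t => ψ' (t / v.length) := by
    ext ⟨s, t⟩
    constructor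
    · intro h
      refine ⟨(s * u.length, t * v.length), ?_, Prod.ext (mul_div_cancel_right₀ s hp)
        (mul_div_cancel_right₀ t hq)⟩
      change φ' (s * u.length / u.length) = ψ' (t * v.length / v.length)
      rw [mul_div_cancel_right₀ _ hp, mul_div_cancel_right₀ _ hq]; exact h
    · rintro ⟨z, hz, h⟩
      rw [← h]; exact hz
  rw [e]
  refine (hP.isPreconnected_cvp hQ).image _ (Continuous.continuousOn ?_)
  fun_prop

end
end
end SurfaceLoops

/-! ### Common value classes as connected components -/

namespace SurfaceLoops
open Real
noncomputable section
section
variable {g : ℕ} [hg : Fact (2 ≤ g)]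

/-! ### Existence and uniqueness of lifts -/

theorem circleProj_surjective : Function.Surjective circleProj := fun z => by
  refine ⟨Complex.arg z / (2 * π), ?_⟩
  rw [circleProj, mul_div_cancel₀ _ (by positivity), Circle.exp_arg]

theorem exists_of_circleProj_eq {s t : ℝ} (h : circleProj s = circleProj t) :
    ∃ n : ℤ, s = t + n := by
  obtain ⟨n, hn⟩ := Circle.exp_eq_exp.1 h
  refine ⟨n, mul_left_cancel₀ (by positivity : 2 * π ≠ 0) ?_⟩
  rw [hn]; ring

theorem map_circleProj_nhds (t : ℝ) : Filter.map circleProj (nhds t) = nhds (circleProj t) := by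
  have h := ((isLocalHomeomorph_circleExp).map_nhds_eq (2 * π * t))
  have h2 := (Homeomorph.mulLeft₀ (2 * π) (by positivity)).map_nhds_eq t
  have e : circleProj = Circle.exp ∘ Homeomorph.mulLeft₀ (2 * π) (by positivity) := rfl
  rw [e, ← Filter.map_map, h2]
  exact h

theorem continuous_circleProj : Continuous circleProj :=
  continuous_iff_continuousAt.2 fun t => (map_circleProj_nhds t).le

theorem locallyFinite_Icc_intCast : LocallyFinite fun n : ℤ => Set.Icc (n : ℝ) (n + 1) := by
  intro x
  refine ⟨Set.Ioo (x - 1) (x + 1), Ioo_mem_nhds (by linarith) (by linarith),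
    (Set.finite_Icc (⌊x⌋ - 2) (⌊x⌋ + 2)).subset ?_⟩
  rintro n ⟨y, ⟨h1, h2⟩, h3, h4⟩
  have h5 := Int.floor_le x
  have h6 := Int.lt_floor_add_one x
  constructor
  · have : ((⌊x⌋ - 2 : ℤ) : ℝ) ≤ n := by push_cast; linarith
    exact_mod_cast this
  · have : (n : ℝ) ≤ ((⌊x⌋ + 2 : ℤ) : ℝ) := by push_cast; linarith
    exact_mod_cast this

theorem exists_vertices (a : ℤ → Letter g) : ∃ P : ℤ → SL(2, ℝ), (∀ n, P n ∈ Gam g) ∧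
    ∀ n, P (n + 1) = P n * letterTranslation g (a n) := by
  have hmem : ∀ w : List (Letter g), eval w ∈ Gam g := fun w =>
    Subgroup.list_prod_mem _ fun x hx => by
      obtain ⟨c, -, rfl⟩ := List.mem_map.1 hx
      exact letterTranslation_mem c
  -- One of the two factors is always trivial, so a single formula serves both signs of `n`.
  refine ⟨fun n => eval (seg a 0 n.toNat) * (eval (seg a n (-n).toNat))⁻¹,
    fun n => mul_mem (hmem _) (inv_mem (hmem _)), fun n => ?_⟩
  rcases le_or_gt 0 n with hn | hn
  · obtain ⟨k, rfl⟩ := Int.eq_ofNat_of_zero_le hn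
    have e : (-((k : ℤ) + 1)).toNat = 0 := by omega
    have e1 : ((k : ℤ) + 1).toNat = k + 1 := by omega
    have e2 : (-(k : ℤ)).toNat = 0 := by omega
    simp only [e, e1, e2, Int.toNat_natCast]
    rw [seg_succ, eval_append, zero_add]
    simp [seg, eval]
  · have e : (n + 1).toNat = 0 := by omega
    have e1 : n.toNat = 0 := by omega
    have e2 : (-n).toNat = 1 + (-(n + 1)).toNat := by omega
    simp only [e, e1, e2]
    rw [seg_add, eval_append]
    simp [seg, eval]

theorem IsPiecewiseGeodesicLoop.exists_isLifting {u : List (Letter g)} {φ : C(Circle, Surface g)}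
    (h : IsPiecewiseGeodesicLoop u φ) : ∃ φ' : C(ℝ, ℍ), IsLifting φ' φ := by
  obtain ⟨P, hP, hsucc⟩ := exists_vertices (periodic u h.1)
  have hp : (u.length : ℝ) ≠ 0 := by exact_mod_cast (List.length_pos_of_ne_nil h.1).ne'
  let F : ℝ → ℍ := fun s => P ⌊s⌋ • edge g (idx (periodic u h.1 ⌊s⌋)) (Int.fract s)
  have hF : ∀ (n : ℤ), ∀ s ∈ Set.Icc (n : ℝ) (n + 1),
      F s = P n • edge g (idx (periodic u h.1 n)) (s - n) := by
    intro n s hs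
    rcases hs.2.lt_or_eq with h1 | h1
    · have : ⌊s⌋ = n := Int.floor_eq_iff.2 ⟨hs.1, h1⟩
      simp only [F, Int.fract, this]
    · have h2 : s = ((n + 1 : ℤ) : ℝ) := by rw [h1]; push_cast; rfl
      simp only [F, h2, Int.floor_intCast, Int.fract_intCast, edge_zero, hsucc]
      push_cast
      rw [add_sub_cancel_left, edge_one, letterTranslation_eq, mul_smul]
  have hcont : Continuous F := by
    refine locallyFinite_Icc_intCast.continuous ?_ (fun n => isClosed_Icc) fun n => ?_
    · refine Set.eq_univ_of_forall fun s => Set.mem_iUnion.2 ⟨⌊s⌋, Int.floor_le s, ?_⟩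
      exact (Int.lt_floor_add_one s).le
    · refine ContinuousOn.congr (Continuous.continuousOn ?_) (hF n)
      exact ((continuous_edge _).comp (continuous_id.sub continuous_const)).const_smul _
  refine ⟨⟨fun s => F (s * u.length), by fun_prop⟩, fun s => ?_⟩
  have h1 := h.apply ⌊s * u.length⌋
    ⟨Int.fract_nonneg (s * u.length), (Int.fract_lt_one (s * u.length)).le⟩
  rw [Int.floor_add_fract, mul_div_cancel_right₀ _ hp] at h1
  rw [h1]
  exact proj_smul (hP _) _

theorem IsLifting.smul {φ : C(Circle, Surface g)} {φ' : C(ℝ, ℍ)} (h : IsLifting φ' φ)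
    {γ : SL(2, ℝ)} (hγ : γ ∈ Gam g) :
    IsLifting ⟨fun t => γ • φ' t, φ'.continuous.const_smul γ⟩ φ := fun t => by
  rw [← h t]; exact proj_smul hγ _

theorem IsLifting.exists_translate {u : List (Letter g)} {φ : C(Circle, Surface g)}
    (h : IsPiecewiseGeodesicLoop u φ) (hu : IsCyclicallyDReduced u) {φ' : C(ℝ, ℍ)}
    (h' : IsLifting φ' φ) (n : ℤ) : ∃ γ ∈ Gam g, ∀ t, φ' (t + n) = γ • φ' t := by
  refine exists_eq_smul φ'.continuous (by fun_prop) (fun t => ?_) (h'.mem_graph h hu)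
  rw [h', h', circleProj_add_intCast]

/-! ### Common value classes -/

section classes

variable {u v : List (Letter g)} {φ ψ : C(Circle, Surface g)}

theorem IsCommonValueClass.subset_cvp {C : Set (Circle × Circle)}
    (hC : IsCommonValueClass φ ψ C) : C ⊆ cvp φ ψ := by
  obtain ⟨-, φ', ψ', hφ', hψ', rfl⟩ := hC
  rintro _ ⟨⟨s, t⟩, hst, rfl⟩
  change φ (circleProj s) = ψ (circleProj t)
  rw [← hφ', ← hψ', show φ' s = ψ' t from hst]

theorem exists_isCommonValueClass_mem (hφ : IsPiecewiseGeodesicLoop u φ)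
    (hψ : IsPiecewiseGeodesicLoop v ψ) {z : Circle × Circle} (hz : z ∈ cvp φ ψ) :
    ∃ C, IsCommonValueClass φ ψ C ∧ z ∈ C := by
  obtain ⟨φ', hφ'⟩ := hφ.exists_isLifting
  obtain ⟨ψ', hψ'⟩ := hψ.exists_isLifting
  obtain ⟨x, y⟩ := z
  obtain ⟨s, rfl⟩ := circleProj_surjective x
  obtain ⟨t, rfl⟩ := circleProj_surjective y
  have h : φ (circleProj s) = ψ (circleProj t) := hz
  rw [← hφ', ← hψ', eq_comm, proj_eq_iff] at h
  obtain ⟨γ, hγ, h⟩ := h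
  have hmem : (circleProj s, circleProj t) ∈ Prod.map circleProj circleProj ''
      cvp φ' (⟨fun t => γ • ψ' t, ψ'.continuous.const_smul γ⟩ : C(ℝ, ℍ)) := ⟨(s, t), h, rfl⟩
  exact ⟨_, ⟨⟨_, hmem⟩, _, _, hφ', hψ'.smul hγ, rfl⟩, hmem⟩

theorem IsCommonValueClass.isConnected (hφ : IsPiecewiseGeodesicLoop u φ)
    (hψ : IsPiecewiseGeodesicLoop v ψ) (hu : IsCyclicallyDReduced u) (hv : IsCyclicallyDReduced v)
    {C : Set (Circle × Circle)} (hC : IsCommonValueClass φ ψ C) : IsConnected C := by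
  obtain ⟨hne, φ', ψ', hφ', hψ', rfl⟩ := hC
  exact ⟨hne, (IsLifting.isPreconnected_cvp hφ hψ hu hv hφ' hψ').image _
    (continuous_circleProj.prodMap continuous_circleProj).continuousOn⟩

/-- Whether a common value belongs to a given class depends only on the element of the group
that relates the chosen liftings of its two coordinates. -/
theorem mem_class_of_mem_class (hφ : IsPiecewiseGeodesicLoop u φ)
    (hψ : IsPiecewiseGeodesicLoop v ψ) (hu : IsCyclicallyDReduced u) (hv : IsCyclicallyDReduced v)
    {φ' ψ' : C(ℝ, ℍ)} (hφ' : IsLifting φ' φ) (hψ' : IsLifting ψ' ψ) {γ : SL(2, ℝ)}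
    (hγ : γ ∈ Gam g) {s t s₁ t₁ : ℝ} (h : φ' s = γ • ψ' t) (h₁ : φ' s₁ = γ • ψ' t₁)
    (hst : (circleProj s, circleProj t) ∈ Prod.map circleProj circleProj '' cvp φ' ψ') :
    (circleProj s₁, circleProj t₁) ∈ Prod.map circleProj circleProj '' cvp φ' ψ' := by
  obtain ⟨⟨s₂, t₂⟩, h₂, he⟩ := hst
  obtain ⟨n, hn⟩ := exists_of_circleProj_eq (congrArg Prod.fst he)
  obtain ⟨k, hk⟩ := exists_of_circleProj_eq (congrArg Prod.snd he)
  obtain rfl : s₂ = s + n := hn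
  obtain rfl : t₂ = t + k := hk
  obtain ⟨α, hα, hα'⟩ := hφ'.exists_translate hφ hu n
  obtain ⟨β, hβ, hβ'⟩ := hψ'.exists_translate hψ hv k
  have h₃ : φ' (s + n) = ψ' (t + k) := h₂
  rw [hα', hβ', h, ← inv_smul_eq_iff, smul_smul, smul_smul] at h₃
  have h₄ := eq_one_of_smul_eq_graph (mul_mem (inv_mem hβ) (mul_mem hα hγ))
    (hψ'.mem_graph hψ hv t) (by rw [← mul_assoc]; exact h₃)
  rw [inv_mul_eq_one] at h₄
  refine ⟨(s₁ + n, t₁ + k), ?_, Prod.ext (circleProj_add_intCast _ _) (circleProj_add_intCast _ _)⟩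
  change φ' (s₁ + n) = ψ' (t₁ + k)
  rw [hα', hβ', h₁, smul_smul, ← h₄]

/-- For fixed liftings, the group element relating their values at a common value is locally
constant, and it decides membership in the class. -/
theorem IsCommonValueClass.eventually_mem_iff (hφ : IsPiecewiseGeodesicLoop u φ)
    (hψ : IsPiecewiseGeodesicLoop v ψ) (hu : IsCyclicallyDReduced u) (hv : IsCyclicallyDReduced v)
    {C : Set (Circle × Circle)} (hC : IsCommonValueClass φ ψ C) {z : Circle × Circle}
    (hz : z ∈ cvp φ ψ) : ∀ᶠ w in nhds z, w ∈ cvp φ ψ → (w ∈ C ↔ z ∈ C) := by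
  obtain ⟨-, φ', ψ', hφ', hψ', rfl⟩ := hC
  obtain ⟨x, y⟩ := z
  obtain ⟨s, rfl⟩ := circleProj_surjective x
  obtain ⟨t, rfl⟩ := circleProj_surjective y
  have h : φ (circleProj s) = ψ (circleProj t) := hz
  rw [← hφ', ← hψ', eq_comm, proj_eq_iff] at h
  obtain ⟨γ, hγ, h⟩ := h
  obtain ⟨ε, hε, hb⟩ := exists_ball_graph (hφ'.mem_graph hφ hu s)
  -- Neighbourhoods in the torus are pulled back to `ℝ²`, where nearby pairs are compared with the
  -- same liftings.
  rw [nhds_prod_eq, ← map_circleProj_nhds, ← map_circleProj_nhds, Filter.prod_map_map_eq',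
    Filter.eventually_map]
  have h1 : ∀ᶠ r in nhds s, dist (φ' r) (φ' s) < ε :=
    φ'.continuous.continuousAt.eventually (Metric.ball_mem_nhds _ hε)
  have h2 : ∀ᶠ r in nhds t, dist (γ • ψ' r) (γ • ψ' t) < ε :=
    (ψ'.continuous.const_smul γ).continuousAt.eventually (Metric.ball_mem_nhds _ hε)
  filter_upwards [h1.prod_mk h2] with ⟨s₁, t₁⟩ ⟨hs₁, ht₁⟩ hw
  have h₁ : φ (circleProj s₁) = ψ (circleProj t₁) := hw
  rw [← hφ', ← hψ', eq_comm, proj_eq_iff] at h₁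
  obtain ⟨η, hη, h₁⟩ := h₁
  rw [← h] at ht₁
  have h₂ := hb (η * γ⁻¹) (mul_mem hη (inv_mem hγ)) (γ • ψ' t₁) (φ' s₁) ht₁ hs₁
    (by rw [mul_smul, inv_smul_smul, h₁])
  rw [mul_inv_eq_one] at h₂
  subst h₂
  exact ⟨mem_class_of_mem_class hφ hψ hu hv hφ' hψ' hγ h₁ h,
    mem_class_of_mem_class hφ hψ hu hv hφ' hψ' hγ h h₁⟩

/-- A class is connected, and by the local statement it is clopen in `cvp φ ψ`, so it contains the
component of each of its points. -/
theorem IsCommonValueClass.eq_connectedComponentIn (hφ : IsPiecewiseGeodesicLoop u φ)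
    (hψ : IsPiecewiseGeodesicLoop v ψ) (hu : IsCyclicallyDReduced u) (hv : IsCyclicallyDReduced v)
    {C : Set (Circle × Circle)} (hC : IsCommonValueClass φ ψ C) {z : Circle × Circle}
    (hz : z ∈ C) : C = connectedComponentIn (cvp φ ψ) z := by
  refine Set.Subset.antisymm ((hC.isConnected hφ hψ hu hv).isPreconnected.subset_connectedComponentIn
    hz hC.subset_cvp) ?_
  have key : ∀ w : cvp φ ψ, ∀ᶠ w' : cvp φ ψ in nhds w, ((w' : Circle × Circle) ∈ C ↔ (w : Circle × Circle) ∈ C) := by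
    intro w
    filter_upwards [continuous_subtype_val.continuousAt.eventually
      (hC.eventually_mem_iff hφ hψ hu hv w.2)] with w' hw'
    exact hw' w'.2
  have hclopen : IsClopen ((↑) ⁻¹' C : Set (cvp φ ψ)) := by
    refine ⟨isOpen_compl_iff.1 (isOpen_iff_mem_nhds.2 fun w hw => ?_),
      isOpen_iff_mem_nhds.2 fun w hw => ?_⟩
    · filter_upwards [key w] with w' hw' using fun h => hw (hw'.1 h)
    · filter_upwards [key w] with w' hw' using hw'.2 hw
  rw [connectedComponentIn_eq_image (hC.subset_cvp hz)]
  rintro _ ⟨w, hw, rfl⟩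
  exact hclopen.connectedComponent_subset (x := ⟨z, hC.subset_cvp hz⟩) hz hw

end classes

end
end
end SurfaceLoops

theorem mainTheorem5 (g : ℕ) [Fact (2 ≤ g)] (u v : List (SurfaceLoops.Letter g))
    (hu : SurfaceLoops.IsCyclicallyDReduced u) (hv : SurfaceLoops.IsCyclicallyDReduced v)
    (φ ψ : C(Circle, SurfaceLoops.Surface g))
    (hφ : SurfaceLoops.IsPiecewiseGeodesicLoop u φ)
    (hψ : SurfaceLoops.IsPiecewiseGeodesicLoop v ψ) :
    (∀ φ' ψ' : C(ℝ, UpperHalfPlane),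
      SurfaceLoops.IsLifting φ' φ → SurfaceLoops.IsLifting ψ' ψ →
        IsPreconnected (SurfaceLoops.cvp φ' ψ')) ∧
    (∀ C : Set (Circle × Circle), SurfaceLoops.IsCommonValueClass φ ψ C → IsConnected C) ∧
    (∀ C : Set (Circle × Circle), SurfaceLoops.IsCommonValueClass φ ψ C ↔
      ∃ z ∈ SurfaceLoops.cvp φ ψ, C = connectedComponentIn (SurfaceLoops.cvp φ ψ) z) := by
  refine ⟨fun φ' ψ' hφ' hψ' => SurfaceLoops.IsLifting.isPreconnected_cvp hφ hψ hu hv hφ' hψ',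
    fun C hC => hC.isConnected hφ hψ hu hv, fun C => ⟨fun hC => ?_, ?_⟩⟩
  · obtain ⟨z, hz⟩ := hC.1
    exact ⟨z, hC.subset_cvp hz, hC.eq_connectedComponentIn hφ hψ hu hv hz⟩
  · rintro ⟨z, hz, rfl⟩
    obtain ⟨C, hC, hzC⟩ := SurfaceLoops.exists_isCommonValueClass_mem hφ hψ hz
    rwa [← hC.eq_connectedComponentIn hφ hψ hu hv hzC]
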